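/- **Proposition 3.2.** Let $n\ge 1$ and $d\ge 0$ be integers, let $\sigma,c,a,b>0$ and $K>1$ be real numbers, and put $\kappa=18$. Let $Y$ be a random vector of $\mathbb R^n$ with independent components and mean $f=\mathbb E(Y)=(F(1/n),\dots,F(n/n))$ for some function $F$ on $(0,1]$. Assume that the components of $\xi=Y-f$ have finite exponential moments $\mathbb E[e^{\lambda\xi_i}]$ for $|\lambda|<1/c$ and satisfy $$\log\mathbb E\big[e^{\lambda\xi_i}\big]\le\frac{\lambda^2\sigma^2}{2(1-|\lambda|c)}\qquad\text{for all }\lambda\in(-1/c,1/c),\ i=1,\dots,n.$$ For a partition $m$ of $\{1,\dots,n\}$ each element of which consists of at least $d+1$ consecutive integers, let $S_m\subset\mathbb R^n$ be the linear span of the vectors $(P(1/n),\dots,P(n/n))$, where $P$ runs over the functions on $(0,1]$ that coincide with a polynomial of degree at most $d$ on each interval $\big(\frac{\min I-1}{n},\frac{\max I}{n}\big]$, $I\in m$. Let $D_m=\dim S_m$ and let $\hat f_m=\Pi_{S_m}Y$ be the orthogonal projection of $Y$ onto $S_m$ (the least-squares estimator). Let $\mathfrak m$ be such a partition with $$|I|\ge(d+1)a^2\log^2(n)\ge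 d+1\qquad\text{for all }I\in\mathfrak m,$$ and let $\mathcal M$ be a collection of such partitions $m$ with $S_m\subset S_{\mathfrak m}$. Let $\Delta_m\ge 0$ for $m\in\mathcal M$, put $\Sigma=\sum_{m\in\mathcal M}e^{-\Delta_m}$, and let $\mathrm{pen}:\mathcal M\to\mathbb R_+$ satisfy $$\mathrm{pen}(m)\ge K\kappa^2\Big(\sigma^2+c\,\frac{4\sqrt2(\sigma+c)(d+1)(b+2)}{a\kappa}\Big)(D_m+\Delta_m)\qquad\text{for all }m\in\mathcal M.$$ Let $\hat m$ be any (measurable) random element of $\mathcal M$ that minimizes $\mathrm{crit}(m)=|Y-\hat f_m|_2^2+\mathrm{pen}(m)$ over $m\in\mathcal M$. Then $|f-\hat f_{\hat m}|_2^2$ is integrable and $$\mathbb E\big(|f-\hat f_{\hat m}|_2^2\big)\le C(K)\Big[\inf_{m\in\mathcal M}\big[\mathbb E\big(|f-\hat f_m|_2^2\big)+\mathrm{pen}(m)\big]+R\Big],\qquad C(K)=\frac{K(K^2+K-1)}{(K-1)^3},$$ where $$R=\kappa^2\Big(\sigma^2+c\,\frac{4\sqrt2(\sigma+c)(d+1)(b+2)}{a\kappa}\Big)\Sigma+\frac{4(c+\sigma)^2(b+2)^2}{a^2n^b}.$$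 -/

import Mathlib

open MeasureTheory ProbabilityTheory

noncomputable section

namespace PiecewisePoly

/-- The real interval `((min I - 1) / n, max I / n]` attached to a nonempty finite set `I` of
positive integers. -/
def cell (n : ℕ) (I : Finset ℕ) : Set ℝ :=
  Set.Ioc (((sInf (I : Set ℕ) : ℕ) - 1 : ℝ) / n) (((I.sup id : ℕ) : ℝ) / n)

/-- Every element of the partition `m` of `{1, …, n}` consists of consecutive integers, and of at
least `d + 1` of them. -/
def IsAdmissible {n : ℕ} (d : ℕ) (m : Finpartition (Finset.Icc 1 n)) : Prop :=
  ∀ I ∈ m.parts, (I : Set ℕ).OrdConnected ∧ d + 1 ≤ I.card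

/-- `P` coincides, on the interval attached to each element of the partition `m`, with a polynomial
of degree at most `d`. (Only the values of `P` on `(0, 1]` are constrained.) -/
def IsPiecewisePolynomial {n : ℕ} (d : ℕ) (m : Finpartition (Finset.Icc 1 n)) (P : ℝ → ℝ) : Prop :=
  ∀ I ∈ m.parts, ∃ q : Polynomial ℝ, q.natDegree ≤ d ∧ ∀ x ∈ cell n I, P x = q.eval x

/-- The vector `(F (1 / n), …, F (n / n))` of `ℝⁿ`. -/
def sample (n : ℕ) (F : ℝ → ℝ) : EuclideanSpace ℝ (Fin n) :=
  WithLp.toLp 2 fun i => F (((i : ℕ) + 1 : ℝ) / n)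

/-- The model `S_m`: the linear span of the vectors `(P (1 / n), …, P (n / n))` where `P` runs among
the piecewise polynomials of degree at most `d` based on `m`. -/
def model {n : ℕ} (d : ℕ) (m : Finpartition (Finset.Icc 1 n)) :
    Submodule ℝ (EuclideanSpace ℝ (Fin n)) :=
  Submodule.span ℝ {v | ∃ P : ℝ → ℝ, IsPiecewisePolynomial d m P ∧ v = sample n P}

/-- The dimension `D_m` of `S_m`. -/
def dim {n : ℕ} (d : ℕ) (m : Finpartition (Finset.Icc 1 n)) : ℕ :=
  Module.finrank ℝ (model d m)

/-- The least-squares estimator on `S_m`: the orthogonal projection of the data `y` onto `S_m`. -/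
def lse {n : ℕ} (d : ℕ) (m : Finpartition (Finset.Icc 1 n)) (y : EuclideanSpace ℝ (Fin n)) :
    EuclideanSpace ℝ (Fin n) :=
  (model d m).starProjection y

/-- The penalized least-squares criterion. -/
def crit {n : ℕ} (d : ℕ) (pen : Finpartition (Finset.Icc 1 n) → ℝ)
    (y : EuclideanSpace ℝ (Fin n)) (m : Finpartition (Finset.Icc 1 n)) : ℝ :=
  ‖y - lse d m y‖ ^ 2 + pen m

/-- The exponential moment condition
`log E[exp (t X)] ≤ t² σ² / (2 (1 - |t| c))` for all `t ∈ (-1/c, 1/c)`, the exponential moments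
being finite. -/
def BernsteinCondition {Ω : Type*} [MeasurableSpace Ω] (μ : Measure Ω) (σ c : ℝ)
    (X : Ω → ℝ) : Prop :=
  ∀ t ∈ Set.Ioo (-(1 / c)) (1 / c),
    Integrable (fun ω => Real.exp (t * X ω)) μ ∧
      Real.log (∫ ω, Real.exp (t * X ω) ∂μ) ≤ t ^ 2 * σ ^ 2 / (2 * (1 - |t| * c))

/-- The numerical constant `κ`. -/
def kappa : ℝ := 18

/-- The factor `C(K)` of the risk bound. -/
def riskConst (K : ℝ) : ℝ := K * (K ^ 2 + K - 1) / (K - 1) ^ 3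

/-- The variance factor `σ² + c · 4√2 (σ + c)(d + 1)(b + 2) / (a κ)`. -/
def varFactor (σ c a b : ℝ) (d : ℕ) : ℝ :=
  σ ^ 2 + c * (4 * Real.sqrt 2 * (σ + c) * (d + 1) * (b + 2) / (a * kappa))

end PiecewisePoly

end

noncomputable section

namespace PiecewisePoly

/-! ### Polynomial inequalities on grids of consecutive integers. -/

section

/-! Let f₀ be the projection of f on the model of `m₀`. For each m let w_m be f₀ minus its
projection on S_m, and let B_m be the squared norm of the projection of ξ on S_m. By Pythagoras the
loss of m is |f - f₀|² + |w_m|² + B_m, while its criterion is a random term common to all m plus Q_m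
= |w_m|² + 2⟨ξ, w_m⟩ - B_m + pen(m). The selected partition therefore minimizes Q. It suffices to
find ρ > 0 with ρ C(K) ≥ 1 and a single integrable W such that ρ(|w_m|² + B_m) ≤ Q_m + W for all m
at once, with E W ≤ 324 V Σ, where V is the variance factor; this is `IsNoise.exists_excess_bound`.
Against a fixed m the linear term then costs nothing, ⟨ξ, w_m⟩ being centred.

The quadratic term. Each S_m is enlarged by the residuals of f₀ on its cells, which at most doubles
the dimension. `IsNoise.exists_dev_bound` bounds the squared norm X_m of the noise projected on this
space by 324 V (D_m + Δ_m) + W₁ with E W₁ ≤ 0.03 · 324 V Σ. Bernstein deviations have a Gaussian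
part, driven by the Euclidean norm of the direction, and a linear part, driven by its sup norm. The
cells of `m₀` are long, so polynomial inequalities on grids give |v|_∞ ≤ Λ|v|₂ on the largest model.
Off a rare event all coordinates of the projected noise are small, and a net of flat vectors gives
the tail (`IsNoise.local_tail`); the rare event is paid for by a fourth moment and a reserved tenth
of the threshold.

The linear term. If K ≤ 20, Cauchy–Schwarz inside the enlarged space gives -2⟨ξ, w_m⟩ ≤ |w_m|²/K +
K(X_m - B_m), and W = K W₁ works. For larger K this is too expensive. Then -2⟨ξ, w_m⟩ is split over
the cells A and each piece is compared with a cost α rss(A) + τ, where ατ does not depend on K.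
`IsNoise.exists_cell_bound` does this up to a variable of nonpositive mean, whatever the size of the
collection. If log n is small compared with d + 1, a union bound over all intervals suffices.
Otherwise cells are grouped by dyadic level of rss and by a greedily chosen point they contain. The
number of greedy points is bounded by the cost of any partition (`IsCellFamily.card_points_le`), and
within a class chaining applies because the residuals have entropy independent of n
(`card_separated_class_le`). That entropy bound rests on the doubling property of polynomials and on
a discrete Hilbert inequality. -/

theorem sum_le_sum_of_injOn {ι κ : Type*} {s : Finset ι} {t : Finset κ} {f : ι → ℝ} {g : κ → ℝ}
    (e : ι → κ) (hg : ∀ j ∈ t, 0 ≤ g j) (hmem : ∀ i ∈ s, e i ∈ t) (hinj : Set.InjOn e s)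
    (hfg : ∀ i ∈ s, f i ≤ g (e i)) : ∑ i ∈ s, f i ≤ ∑ j ∈ t, g j := by
  classical
  calc ∑ i ∈ s, f i ≤ ∑ i ∈ s, g (e i) := Finset.sum_le_sum hfg
    _ = ∑ j ∈ s.image e, g j := (Finset.sum_image hinj).symm
    _ ≤ ∑ j ∈ t, g j := Finset.sum_le_sum_of_subset_of_nonneg
        (Finset.image_subset_iff.2 hmem) fun j hj _ => hg j hj

open Polynomial in
/-- The coefficients of the polynomial representing the evaluation at `0` in `L²(0, 1)`. -/
theorem exists_hilbert_dual (d : ℕ) :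
    ∃ k : ℕ → ℝ, k 0 = ((d : ℝ) + 1) ^ 2 ∧
      ∀ i ≤ d, ∑ j ∈ Finset.range (d + 1), k j / ((i : ℝ) + j + 1) = if i = 0 then 1 else 0 := by
  -- Partial fractions: k_j is the residue at -(j + 1) of P / ∏ (X + j + 1). The zeros of P at 1, …,
  -- d give the vanishing equations, and its leading factor makes the quotient equal to 1 at 0.
  set v : ℕ → ℝ := fun j => -((j : ℝ) + 1) with hv
  set P : ℝ[X] := C ((-1) ^ d * ((d : ℝ) + 1)) * ∏ i ∈ Finset.range d, (X - C ((i : ℝ) + 1)) with hP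
  have hinj : Set.InjOn v (Finset.range (d + 1) : Finset ℕ) := by
    intro a _ b _ h
    simp only [hv] at h
    exact_mod_cast (by linarith : (a : ℝ) = b)
  have hdeg : P.degree < (Finset.range (d + 1)).card := by
    have h1 : P.natDegree ≤ d := by
      rw [hP]
      refine natDegree_C_mul_le _ _ |>.trans ?_
      refine (natDegree_prod_le _ _).trans ?_
      refine (Finset.sum_le_card_nsmul _ _ 1 fun i _ => (natDegree_X_sub_C _).le).trans ?_
      simp
    refine lt_of_le_of_lt (degree_le_of_natDegree_le h1) ?_
    simp
    exact_mod_cast Nat.lt_succ_self d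
  have hint := Lagrange.eq_interpolate hinj hdeg
  have key : ∀ i : ℕ, P.eval (i : ℝ) = (Lagrange.nodal (Finset.range (d + 1)) v).eval (i : ℝ) *
      ∑ j ∈ Finset.range (d + 1),
        (Lagrange.nodalWeight (Finset.range (d + 1)) v j * P.eval (v j)) / ((i : ℝ) + j + 1) := by
    intro i
    have h := Lagrange.eval_interpolate_not_at_node (s := Finset.range (d + 1)) (v := v)
      (fun j => P.eval (v j)) (x := (i : ℝ)) (by
        intro j _; simp only [hv]; intro h
        have : (0 : ℝ) ≤ i := by positivity
        have : (0 : ℝ) ≤ j := by positivity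
        linarith)
    rw [← hint] at h
    rw [h]
    congr 1
    refine Finset.sum_congr rfl fun j _ => ?_
    simp only [hv]
    rw [div_eq_mul_inv, sub_neg_eq_add, ← add_assoc]
    ring
  have hnod : ∀ i : ℕ, (Lagrange.nodal (Finset.range (d + 1)) v).eval (i : ℝ) ≠ 0 := by
    intro i
    rw [Lagrange.eval_nodal]
    refine Finset.prod_ne_zero_iff.2 fun j _ => ?_
    simp only [hv]
    have : (0 : ℝ) ≤ i := by positivity
    have : (0 : ℝ) ≤ j := by positivity
    linarith
  refine ⟨fun j => Lagrange.nodalWeight (Finset.range (d + 1)) v j * P.eval (v j), ?_, ?_⟩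
  · have h1 : Lagrange.nodalWeight (Finset.range (d + 1)) v 0 = ((d.factorial : ℝ))⁻¹ := by
      rw [Lagrange.nodalWeight, Finset.prod_inv_distrib]
      congr 1
      rw [Finset.range_eq_Ico, Finset.Ico_erase_left] 
      rw [← Finset.prod_range_add_one_eq_factorial]
      push_cast
      rw [← Finset.Ico_succ_left_eq_Ioo, Finset.prod_Ico_eq_prod_range]
      refine Finset.prod_congr (by simp) fun x _ => ?_
      simp only [hv, Nat.succ_eq_succ, Nat.succ_eq_add_one]; push_cast; ring
    have h2 : P.eval (v 0) = ((d : ℝ) + 1) * ((d + 1).factorial : ℝ) := by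
      rw [hP, eval_mul, eval_C, eval_prod]
      have : ∀ i ∈ Finset.range d, eval (v 0) (X - C ((i : ℝ) + 1)) = (-1) * ((i : ℝ) + 2) := by
        intro i _; simp [hv]; ring
      rw [Finset.prod_congr rfl this, Finset.prod_mul_distrib, Finset.prod_const, Finset.card_range]
      have h3 : ((d + 1).factorial : ℝ) = ∏ i ∈ Finset.range d, ((i : ℝ) + 2) := by
        rw [← Finset.prod_range_add_one_eq_factorial, Finset.prod_range_succ']
        push_cast
        simp only [add_assoc]; norm_num
      rw [h3]
      have : ((-1 : ℝ)) ^ d * (-1) ^ d = 1 := by rw [← mul_pow]; simp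
      linear_combination ((d : ℝ) + 1) * (∏ i ∈ Finset.range d, ((i : ℝ) + 2)) * this
    show Lagrange.nodalWeight (Finset.range (d + 1)) v 0 * P.eval (v 0) = _
    rw [h1, h2, Nat.factorial_succ]
    have : (d.factorial : ℝ) ≠ 0 := by positivity
    push_cast
    field_simp
  · intro i hi
    have hk := key i
    have hsum : ∑ j ∈ Finset.range (d + 1),
        (Lagrange.nodalWeight (Finset.range (d + 1)) v j * P.eval (v j)) / ((i : ℝ) + j + 1) =
        P.eval (i : ℝ) / (Lagrange.nodal (Finset.range (d + 1)) v).eval (i : ℝ) := by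
      rw [hk, mul_div_cancel_left₀ _ (hnod i)]
    rw [hsum]
    split_ifs with h0
    · subst h0
      rw [div_eq_one_iff_eq (hnod 0), Lagrange.eval_nodal, hP, eval_mul, eval_C, eval_prod]
      have : ∀ i ∈ Finset.range d, eval ((0 : ℕ) : ℝ) (X - C ((i : ℝ) + 1)) = (-1) * ((i : ℝ) + 1) := by
        intro i _; simp
      rw [Finset.prod_congr rfl this, Finset.prod_mul_distrib, Finset.prod_const, Finset.card_range,
        Finset.prod_range_succ]
      simp only [hv, Nat.cast_zero, zero_sub, neg_neg]
      have : ((-1 : ℝ)) ^ d * (-1) ^ d = 1 := by rw [← mul_pow]; simp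
      linear_combination ((d : ℝ) + 1) * (∏ i ∈ Finset.range d, ((i : ℝ) + 1)) * this
    · have : P.eval (i : ℝ) = 0 := by
        rw [hP, eval_mul, eval_prod]
        obtain ⟨i', rfl⟩ := Nat.exists_eq_succ_of_ne_zero h0
        rw [Finset.prod_eq_zero (i := i') (by simp; omega)]
        · simp
        · simp
      rw [this, zero_div]

-- Cauchy–Schwarz against the dual polynomial κ: integrating against κ evaluates at 0, so the
-- squared norm of κ is κ(0) = (d + 1)².
open Polynomial in
theorem sq_eval_zero_le_integral (d : ℕ) (q : ℝ[X]) (hq : q.natDegree ≤ d) :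
    q.eval 0 ^ 2 ≤ ((d : ℝ) + 1) ^ 2 * ∫ x in (0 : ℝ)..1, q.eval x ^ 2 := by
  obtain ⟨k, hk0, hk⟩ := exists_hilbert_dual d
  set κ : ℝ[X] := ∑ j ∈ Finset.range (d + 1), C (k j) * X ^ j with hκ
  have hdual : ∀ p : ℝ[X], p.natDegree ≤ d → ∫ x in (0 : ℝ)..1, p.eval x * κ.eval x = p.eval 0 := by
    intro p hp
    have h1 : ∀ x : ℝ, p.eval x * κ.eval x = ∑ i ∈ Finset.range (d + 1),
        ∑ j ∈ Finset.range (d + 1), (p.coeff i * k j) * x ^ (i + j) := by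
      intro x
      rw [eval_eq_sum_range' (Nat.lt_succ_of_le hp), hκ, eval_finsetSum, Finset.sum_mul_sum]
      refine Finset.sum_congr rfl fun i _ => Finset.sum_congr rfl fun j _ => ?_
      simp; ring
    simp_rw [h1]
    rw [intervalIntegral.integral_finsetSum (fun i _ => by
      apply Continuous.intervalIntegrable; fun_prop)]
    have h2 : ∀ i ∈ Finset.range (d + 1), ∫ x in (0 : ℝ)..1, ∑ j ∈ Finset.range (d + 1),
        (p.coeff i * k j) * x ^ (i + j) = p.coeff i * if i = 0 then 1 else 0 := by
      intro i hi
      rw [intervalIntegral.integral_finsetSum (fun i _ => by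
        apply Continuous.intervalIntegrable; fun_prop), ← hk i (by simp at hi; omega), Finset.mul_sum]
      refine Finset.sum_congr rfl fun j _ => ?_
      rw [intervalIntegral.integral_const_mul, integral_pow]
      simp; ring
    rw [Finset.sum_congr rfl h2]
    simp [coeff_zero_eq_eval_zero]
  have hκdeg : κ.natDegree ≤ d := by
    refine natDegree_sum_le_of_forall_le _ _ fun j hj => ?_
    refine (natDegree_C_mul_X_pow_le _ _).trans ?_
    simp at hj; omega
  have hκ0 : κ.eval 0 = ((d : ℝ) + 1) ^ 2 := by
    rw [hκ, eval_finsetSum, Finset.sum_range_succ']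
    simp [hk0]
  have hqk := hdual q hq
  have hkk := hdual κ hκdeg
  set D : ℝ := ((d : ℝ) + 1) ^ 2 with hD
  have hDpos : 0 < D := by positivity
  have hint : ∫ x in (0 : ℝ)..1, (q.eval x - (q.eval 0 / D) * κ.eval x) ^ 2 =
      (∫ x in (0 : ℝ)..1, q.eval x ^ 2) - 2 * (q.eval 0 / D) * q.eval 0 + (q.eval 0 / D) ^ 2 * D := by
    have : ∀ x : ℝ, (q.eval x - (q.eval 0 / D) * κ.eval x) ^ 2 =
        q.eval x ^ 2 - 2 * (q.eval 0 / D) * (q.eval x * κ.eval x) +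
          (q.eval 0 / D) ^ 2 * (κ.eval x * κ.eval x) := fun x => by ring
    simp_rw [this]
    rw [intervalIntegral.integral_add, intervalIntegral.integral_sub,
      intervalIntegral.integral_const_mul, intervalIntegral.integral_const_mul, hqk, hkk, hκ0]
    all_goals (apply Continuous.intervalIntegrable; fun_prop)
  have hnn : 0 ≤ ∫ x in (0 : ℝ)..1, (q.eval x - (q.eval 0 / D) * κ.eval x) ^ 2 :=
    intervalIntegral.integral_nonneg (by norm_num) fun x _ => sq_nonneg _
  rw [hint] at hnn
  have h3 : (q.eval 0 / D) ^ 2 * D = q.eval 0 ^ 2 / D := by field_simp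
  have h4 : 2 * (q.eval 0 / D) * q.eval 0 = 2 * (q.eval 0 ^ 2 / D) := by ring
  rw [h3, h4] at hnn
  have : q.eval 0 ^ 2 / D ≤ ∫ x in (0 : ℝ)..1, q.eval x ^ 2 := by linarith
  rw [div_le_iff₀ hDpos] at this
  linarith

open Polynomial in
/-- The Bernstein operator does not increase the degree. -/
theorem natDegree_bernstein_le (d : ℕ) : ∀ (N : ℕ) (p : ℝ[X]), p.natDegree ≤ d →
    (∑ j ∈ Finset.range (N + 1), C (p.eval (j : ℝ)) * bernsteinPolynomial ℝ N j).natDegree ≤ d := by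
  induction d with
  | zero =>
    intro N p hp
    obtain ⟨a, rfl⟩ : ∃ a, p = C a := ⟨_, eq_C_of_natDegree_le_zero hp⟩
    simp [← Finset.mul_sum, bernsteinPolynomial.sum]
  | succ d ih =>
    intro N p hp
    have hpe : ∀ x : ℝ, p.eval x = p.coeff 0 + x * (p.divX).eval x := by
      intro x
      conv_lhs => rw [← p.divX_mul_X_add]
      simp; ring
    have hdiv : (p.divX).natDegree ≤ d := by rw [natDegree_divX_eq_natDegree_tsub_one]; omega
    cases N with
    | zero =>
      simp [bernsteinPolynomial]
    | succ N =>
      -- With p(j) = p(0) + j q(j), the absorption identity for binomial coefficients turns the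
      -- second term into (N + 1) X times the order N transform of q(X + 1), whose degree is lower
      -- by one.
      have hstep : (∑ j ∈ Finset.range (N + 1 + 1), C (p.eval (j : ℝ)) *
          bernsteinPolynomial ℝ (N + 1) j) = C (p.coeff 0) + C ((N : ℝ) + 1) * X *
            ∑ j ∈ Finset.range (N + 1), C ((p.divX.comp (X + 1)).eval (j : ℝ)) *
              bernsteinPolynomial ℝ N j := by
        have h0 : C (p.coeff 0) = ∑ j ∈ Finset.range (N + 1 + 1),
            C (p.coeff 0) * bernsteinPolynomial ℝ (N + 1) j := by
          rw [← Finset.mul_sum, bernsteinPolynomial.sum, mul_one]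
        have h1 : ∀ j ∈ Finset.range (N + 1 + 1), C (p.eval (j : ℝ)) *
            bernsteinPolynomial ℝ (N + 1) j = C (p.coeff 0) * bernsteinPolynomial ℝ (N + 1) j +
              C ((j : ℝ) * p.divX.eval (j : ℝ)) * bernsteinPolynomial ℝ (N + 1) j := by
          intro j _
          rw [hpe, C_add, add_mul]
        rw [Finset.sum_congr rfl h1, Finset.sum_add_distrib, ← h0]
        congr 1
        rw [Finset.sum_range_succ', Finset.mul_sum]
        simp only [Nat.cast_zero, zero_mul, C_0, add_zero]
        refine Finset.sum_congr rfl fun j hj => ?_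
        have he : N + 1 - (j + 1) = N - j := by omega
        have hev : (p.divX.comp (X + 1)).eval (j : ℝ) = p.divX.eval ((j : ℝ) + 1) := by simp
        have hc : ((N + 1).choose (j + 1) : ℝ) * ((j : ℝ) + 1) = ((N : ℝ) + 1) * (N.choose j) := by
          exact_mod_cast (Nat.add_one_mul_choose_eq N j).symm
        have hc' : (((N + 1).choose (j + 1) : ℕ) : ℝ[X]) * (C ((j : ℝ) + 1)) =
            C ((N : ℝ) + 1) * ((N.choose j : ℕ) : ℝ[X]) := by
          rw [← C_eq_natCast, ← C_eq_natCast, ← C_mul, ← C_mul]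
          exact congrArg C hc
        rw [hev, Nat.cast_succ, C_mul]
        unfold bernsteinPolynomial
        rw [he]
        generalize (C (p.divX.eval ((j : ℝ) + 1)) : ℝ[X]) = c
        generalize (C ((j : ℝ) + 1) : ℝ[X]) = j' at hc' ⊢
        generalize (C ((N : ℝ) + 1) : ℝ[X]) = N' at hc' ⊢
        generalize (((N + 1).choose (j + 1) : ℕ) : ℝ[X]) = a at hc' ⊢
        generalize ((N.choose j : ℕ) : ℝ[X]) = b at hc' ⊢
        linear_combination (c * X ^ (j + 1) * (1 - X) ^ (N - j)) * hc'
      rw [hstep]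
      have hcomp : (p.divX.comp (X + 1)).natDegree ≤ d := by
        rw [natDegree_comp]
        have : (X + 1 : ℝ[X]).natDegree = 1 := natDegree_X_add_C 1
        rw [this]; omega
      refine (natDegree_add_le _ _).trans (max_le (by simp) ?_)
      refine (natDegree_mul_le).trans ?_
      have h1 : (C ((N : ℝ) + 1) * X : ℝ[X]).natDegree ≤ 1 := (natDegree_C_mul_le _ _).trans natDegree_X_le
      have := ih N _ hcomp
      omega

-- Consecutive Bernstein polynomials differ by a multiple of the derivative of one of order N + 1
-- that vanishes at both endpoints. All N + 1 integrals are thus equal, and they sum to 1.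
open Polynomial in
theorem integral_bernstein (N : ℕ) : ∀ j ≤ N,
    ∫ x in (0 : ℝ)..1, (bernsteinPolynomial ℝ N j).eval x = 1 / ((N : ℝ) + 1) := by
  have hii : ∀ p : ℝ[X], IntervalIntegrable (fun x => p.eval x) volume 0 1 := fun p => by
    apply Continuous.intervalIntegrable; fun_prop
  have hstep : ∀ j, j + 1 ≤ N → ∫ x in (0 : ℝ)..1, (bernsteinPolynomial ℝ N j).eval x =
      ∫ x in (0 : ℝ)..1, (bernsteinPolynomial ℝ N (j + 1)).eval x := by
    intro j hj
    have hder := bernsteinPolynomial.derivative_succ ℝ (N + 1) j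
    have hFTC : ∫ x in (0 : ℝ)..1, (derivative (bernsteinPolynomial ℝ (N + 1) (j + 1))).eval x =
        (bernsteinPolynomial ℝ (N + 1) (j + 1)).eval 1 -
          (bernsteinPolynomial ℝ (N + 1) (j + 1)).eval 0 :=
      intervalIntegral.integral_eq_sub_of_hasDerivAt (fun x _ => Polynomial.hasDerivAt _ x) (hii _)
    rw [bernsteinPolynomial.eval_at_1, bernsteinPolynomial.eval_at_0, if_neg (by omega),
      if_neg (by omega), hder] at hFTC
    simp only [Nat.add_sub_cancel, eval_mul, eval_natCast, eval_sub] at hFTC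
    rw [intervalIntegral.integral_const_mul, intervalIntegral.integral_sub (hii _) (hii _)] at hFTC
    have : ((N + 1 : ℕ) : ℝ) ≠ 0 := by positivity
    have := (mul_eq_zero.1 (hFTC.trans (by simp))).resolve_left this
    linarith
  have hconst : ∀ j ≤ N, ∫ x in (0 : ℝ)..1, (bernsteinPolynomial ℝ N j).eval x =
      ∫ x in (0 : ℝ)..1, (bernsteinPolynomial ℝ N 0).eval x := by
    intro j
    induction j with
    | zero => intro _; rfl
    | succ j ih => intro hj; rw [← hstep j hj, ih (by omega)]
  have hsum : ∑ j ∈ Finset.range (N + 1), ∫ x in (0 : ℝ)..1, (bernsteinPolynomial ℝ N j).eval x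
      = 1 := by
    rw [← intervalIntegral.integral_finsetSum (fun j _ => hii _)]
    have : ∀ x : ℝ, ∑ j ∈ Finset.range (N + 1), (bernsteinPolynomial ℝ N j).eval x = 1 := by
      intro x
      rw [← eval_finsetSum, bernsteinPolynomial.sum, eval_one]
    simp [this]
  rw [Finset.sum_congr rfl (fun j hj => hconst j (by simp at hj; omega))] at hsum
  intro j hj
  rw [hconst j hj]
  simp at hsum
  field_simp
  linarith

open Polynomial in
/-- A polynomial of degree at most `d` at the endpoint of a grid of `N + 1` points. -/
theorem sq_eval_zero_le_sum (d N : ℕ) (p : ℝ[X]) (hp : p.natDegree ≤ d) :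
    p.eval 0 ^ 2 ≤ ((d : ℝ) + 1) ^ 2 / ((N : ℝ) + 1) *
      ∑ j ∈ Finset.range (N + 1), p.eval (j : ℝ) ^ 2 := by
  -- The Bernstein transform keeps the degree bound and the value at 0. By Jensen, its square is at
  -- most the Bernstein average of the p(j)², and every weight integrates to 1/(N + 1).
  set q : ℝ[X] := ∑ j ∈ Finset.range (N + 1), C (p.eval (j : ℝ)) * bernsteinPolynomial ℝ N j with hq
  have hq0 : q.eval 0 = p.eval 0 := by
    rw [hq, eval_finsetSum, Finset.sum_range_succ']
    simp [bernsteinPolynomial.eval_at_0]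
  have h1 := sq_eval_zero_le_integral d q (natDegree_bernstein_le d N p hp)
  rw [hq0] at h1
  refine h1.trans ?_
  have h2 : ∫ x in (0 : ℝ)..1, q.eval x ^ 2 ≤ ∫ x in (0 : ℝ)..1,
      ∑ j ∈ Finset.range (N + 1), p.eval (j : ℝ) ^ 2 * (bernsteinPolynomial ℝ N j).eval x := by
    refine intervalIntegral.integral_mono_on (by norm_num) ?_ ?_ ?_
    · apply Continuous.intervalIntegrable; fun_prop
    · apply Continuous.intervalIntegrable; fun_prop
    · intro x hx
      have hb : ∀ j, 0 ≤ (bernsteinPolynomial ℝ N j).eval x := by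
        intro j
        simp only [bernsteinPolynomial, eval_mul, eval_natCast, eval_pow, eval_X, eval_sub, eval_one]
        have := hx.1
        have : 0 ≤ 1 - x := by linarith [hx.2]
        positivity
      have hs : ∑ j ∈ Finset.range (N + 1), (bernsteinPolynomial ℝ N j).eval x = 1 := by
        rw [← eval_finsetSum, bernsteinPolynomial.sum, eval_one]
      have := Finset.sum_sq_le_sum_mul_sum_of_sq_le_mul (Finset.range (N + 1))
        (f := fun j => (bernsteinPolynomial ℝ N j).eval x)
        (g := fun j => p.eval (j : ℝ) ^ 2 * (bernsteinPolynomial ℝ N j).eval x)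
        (r := fun j => p.eval (j : ℝ) * (bernsteinPolynomial ℝ N j).eval x)
        (fun j _ => hb j) (fun j _ => mul_nonneg (sq_nonneg _) (hb j)) (fun j _ => le_of_eq (by ring))
      rw [hs, one_mul] at this
      refine le_trans (le_of_eq ?_) this
      rw [hq, eval_finsetSum]
      simp
  have h3 : ∫ x in (0 : ℝ)..1,
      ∑ j ∈ Finset.range (N + 1), p.eval (j : ℝ) ^ 2 * (bernsteinPolynomial ℝ N j).eval x =
      ∑ j ∈ Finset.range (N + 1), p.eval (j : ℝ) ^ 2 * (1 / ((N : ℝ) + 1)) := by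
    rw [intervalIntegral.integral_finsetSum (fun i _ => by
      apply Continuous.intervalIntegrable; fun_prop)]
    refine Finset.sum_congr rfl fun j hj => ?_
    rw [intervalIntegral.integral_const_mul, integral_bernstein N j (by simp at hj; omega)]
  rw [h3, ← Finset.sum_mul] at h2
  calc _ ≤ ((d : ℝ) + 1) ^ 2 * ((∑ j ∈ Finset.range (N + 1), p.eval (j : ℝ) ^ 2) *
        (1 / ((N : ℝ) + 1))) := mul_le_mul_of_nonneg_left h2 (by positivity)
    _ = _ := by ring

open Polynomial in
/-- A polynomial of degree at most `d` at a point of a grid of consecutive integers. -/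
theorem sq_eval_le_sum_Icc (d : ℕ) (p : ℝ[X]) (hp : p.natDegree ≤ d) (a b i : ℕ)
    (hai : a ≤ i) (hib : i ≤ b) :
    p.eval (i : ℝ) ^ 2 ≤ 2 * ((d : ℝ) + 1) ^ 2 / ((b : ℝ) - a + 1) *
      ∑ j ∈ Finset.Icc a b, p.eval (j : ℝ) ^ 2 := by
  have hai' : (a : ℝ) ≤ i := by exact_mod_cast hai
  have hib' : (i : ℝ) ≤ b := by exact_mod_cast hib
  have hS : 0 ≤ ∑ j ∈ Finset.Icc a b, p.eval (j : ℝ) ^ 2 := Finset.sum_nonneg fun _ _ => sq_nonneg _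
  have hR : p.eval (i : ℝ) ^ 2 ≤ ((d : ℝ) + 1) ^ 2 / (((b - i : ℕ) : ℝ) + 1) *
      ∑ j ∈ Finset.Icc a b, p.eval (j : ℝ) ^ 2 := by
    have h := sq_eval_zero_le_sum d (b - i) (p.comp (X + C (i : ℝ))) (by
      rw [natDegree_comp, natDegree_X_add_C]; omega)
    simp only [eval_comp, eval_add, eval_X, eval_C, zero_add] at h
    refine h.trans (mul_le_mul_of_nonneg_left ?_ (by positivity))
    refine sum_le_sum_of_injOn (fun j => j + i) (fun j _ => sq_nonneg _) ?_ ?_ ?_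
    · intro j hj; simp at hj ⊢; omega
    · intro x _ y _ h; simpa using h
    · intro j _; push_cast; exact le_rfl
  have hL : p.eval (i : ℝ) ^ 2 ≤ ((d : ℝ) + 1) ^ 2 / (((i - a : ℕ) : ℝ) + 1) *
      ∑ j ∈ Finset.Icc a b, p.eval (j : ℝ) ^ 2 := by
    have h := sq_eval_zero_le_sum d (i - a) (p.comp (C (i : ℝ) - X)) (by
      rw [natDegree_comp]
      have : (C (i : ℝ) - X : ℝ[X]).natDegree ≤ 1 := by
        refine (natDegree_sub_le _ _).trans (by simp)
      nlinarith)
    simp only [eval_comp, eval_sub, eval_X, eval_C, sub_zero] at h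
    refine h.trans (mul_le_mul_of_nonneg_left ?_ (by positivity))
    refine sum_le_sum_of_injOn (fun j => i - j) (fun j _ => sq_nonneg _) ?_ ?_ ?_
    · intro j hj; simp at hj ⊢; omega
    · intro x hx y hy h; simp at hx hy h; omega
    · intro j hj
      have : j ≤ i := by simp at hj; omega
      rw [Nat.cast_sub this]
  rw [Nat.cast_sub hib] at hR
  rw [Nat.cast_sub hai] at hL
  -- The longer of the two half-grids starting at i has at least half of the points; hence the
  -- factor 2.
  rcases le_total ((b : ℝ) - i) ((i : ℝ) - a) with h | h
  · refine hL.trans (mul_le_mul_of_nonneg_right ?_ hS)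
    rw [div_le_div_iff₀ (by linarith) (by linarith)]
    nlinarith [sq_nonneg ((d : ℝ) + 1)]
  · refine hR.trans (mul_le_mul_of_nonneg_right ?_ hS)
    rw [div_le_div_iff₀ (by linarith) (by linarith)]
    nlinarith [sq_nonneg ((d : ℝ) + 1)]

end

/-! ### Residuals of local polynomial regression. -/

section

variable {n : ℕ}

/-- The vectors supported on `A` that are polynomial of degree at most `d` there. -/
def polyOn (d : ℕ) (A : Finset (Fin n)) : Submodule ℝ (EuclideanSpace ℝ (Fin n)) where
  carrier := {v | (∀ i ∉ A, v i = 0) ∧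
    ∃ q : Polynomial ℝ, q.natDegree ≤ d ∧ ∀ i ∈ A, v i = q.eval ((i : ℕ) : ℝ)}
  zero_mem' := ⟨fun _ _ => rfl, 0, by simp, by simp⟩
  add_mem' := by
    rintro v w ⟨hv, q, hq, hvq⟩ ⟨hw, p, hp, hwp⟩
    refine ⟨fun i hi => by simp [hv i hi, hw i hi], q + p,
      (Polynomial.natDegree_add_le _ _).trans (max_le hq hp), fun i hi => ?_⟩
    simp [hvq i hi, hwp i hi]
  smul_mem' := by
    rintro a v ⟨hv, q, hq, hvq⟩
    refine ⟨fun i hi => by simp [hv i hi], Polynomial.C a * q,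
      (Polynomial.natDegree_C_mul_le _ _).trans hq, fun i hi => ?_⟩
    simp [hvq i hi]

/-- The restriction of a vector to `A`, extended by zero. -/
def cut (A : Finset (Fin n)) (v : EuclideanSpace ℝ (Fin n)) : EuclideanSpace ℝ (Fin n) :=
  WithLp.toLp 2 fun i => if i ∈ A then v i else 0

/-- The projection onto the polynomial vectors supported on `A`. -/
def polyProj (d : ℕ) (A : Finset (Fin n)) (v : EuclideanSpace ℝ (Fin n)) :
    EuclideanSpace ℝ (Fin n) := (polyOn d A).starProjection v

/-- The residual on `A` of the polynomial regression of `v`. -/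
def res (d : ℕ) (A : Finset (Fin n)) (v : EuclideanSpace ℝ (Fin n)) :
    EuclideanSpace ℝ (Fin n) := cut A v - polyProj d A v

/-- The vector of values of a polynomial. -/
def polyVec (q : Polynomial ℝ) : EuclideanSpace ℝ (Fin n) :=
  WithLp.toLp 2 fun i => q.eval ((i : ℕ) : ℝ)

@[simp] theorem polyVec_apply (q : Polynomial ℝ) (i : Fin n) :
    (polyVec q : EuclideanSpace ℝ (Fin n)) i = q.eval ((i : ℕ) : ℝ) := rfl

@[simp] theorem cut_apply (A : Finset (Fin n)) (v : EuclideanSpace ℝ (Fin n)) (i : Fin n) :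
    cut A v i = if i ∈ A then v i else 0 := rfl

theorem cut_add (A : Finset (Fin n)) (v w : EuclideanSpace ℝ (Fin n)) :
    cut A (v + w) = cut A v + cut A w := by
  ext i; by_cases h : i ∈ A <;> simp [h]

theorem cut_sub (A : Finset (Fin n)) (v w : EuclideanSpace ℝ (Fin n)) :
    cut A (v - w) = cut A v - cut A w := by
  ext i; by_cases h : i ∈ A <;> simp [h]

theorem inner_eq_sum (v w : EuclideanSpace ℝ (Fin n)) : inner ℝ v w = ∑ i, v i * w i := by
  rw [PiLp.inner_apply]
  exact Finset.sum_congr rfl fun i _ => by simp [mul_comm]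

theorem norm_sq_eq_sum (v : EuclideanSpace ℝ (Fin n)) : ‖v‖ ^ 2 = ∑ i, v i ^ 2 := by
  rw [EuclideanSpace.real_norm_sq_eq]

theorem norm_sq_cut (A : Finset (Fin n)) (v : EuclideanSpace ℝ (Fin n)) :
    ‖cut A v‖ ^ 2 = ∑ i ∈ A, v i ^ 2 := by
  rw [norm_sq_eq_sum]
  simp [Finset.sum_ite_mem, ite_pow]

theorem norm_cut_le (A : Finset (Fin n)) (v : EuclideanSpace ℝ (Fin n)) : ‖cut A v‖ ≤ ‖v‖ := by
  rw [← sq_le_sq₀ (norm_nonneg _) (norm_nonneg _)]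
  rw [norm_sq_cut, norm_sq_eq_sum]
  exact Finset.sum_le_sum_of_subset_of_nonneg (Finset.subset_univ _) fun i _ _ => sq_nonneg _

theorem cut_polyVec_mem {d : ℕ} (A : Finset (Fin n)) {q : Polynomial ℝ} (hq : q.natDegree ≤ d) :
    cut A (polyVec q) ∈ polyOn d A :=
  ⟨fun i hi => by simp [hi], q, hq, fun i hi => by simp [hi]⟩

theorem inner_cut_of_support {A : Finset (Fin n)} {w : EuclideanSpace ℝ (Fin n)}
    (hw : ∀ i ∉ A, w i = 0) (v : EuclideanSpace ℝ (Fin n)) : inner ℝ (cut A v) w = inner ℝ v w := by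
  rw [inner_eq_sum, inner_eq_sum]
  refine Finset.sum_congr rfl fun i _ => ?_
  by_cases h : i ∈ A
  · simp [h]
  · simp [hw i h]

theorem inner_res_of_mem {d : ℕ} {A : Finset (Fin n)} {w : EuclideanSpace ℝ (Fin n)}
    (hw : w ∈ polyOn d A) (v : EuclideanSpace ℝ (Fin n)) : inner ℝ (res d A v) w = 0 := by
  rw [res, inner_sub_left, inner_cut_of_support hw.1, polyProj]
  have := Submodule.starProjection_inner_eq_zero (K := polyOn d A) v w hw
  rw [inner_sub_left] at this
  linarith

theorem polyProj_mem (d : ℕ) (A : Finset (Fin n)) (v : EuclideanSpace ℝ (Fin n)) :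
    polyProj d A v ∈ polyOn d A := Submodule.starProjection_apply_mem _ _

theorem res_apply_of_notMem {d : ℕ} {A : Finset (Fin n)} {i : Fin n} (hi : i ∉ A)
    (v : EuclideanSpace ℝ (Fin n)) : res d A v i = 0 := by
  simp [res, hi, (polyProj_mem d A v).1 i hi]

theorem res_eq_iff_of_mem {d : ℕ} {A : Finset (Fin n)} {v r : EuclideanSpace ℝ (Fin n)}
    (hmem : cut A v - r ∈ polyOn d A) (hr : ∀ w ∈ polyOn d A, inner ℝ r w = 0) :
    res d A v = r := by
  have h1 : (cut A v - r) - polyProj d A v ∈ polyOn d A :=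
    Submodule.sub_mem _ hmem (polyProj_mem d A v)
  have h2 : res d A v - r = (cut A v - r) - polyProj d A v := by rw [res]; abel
  rw [← h2] at h1
  have h3 : inner ℝ (res d A v - r) (res d A v - r) = 0 := by
    rw [inner_sub_left, inner_res_of_mem h1, hr _ h1, sub_zero]
  exact sub_eq_zero.1 (inner_self_eq_zero.1 h3)

theorem exists_res_eq (d : ℕ) (A : Finset (Fin n)) (v : EuclideanSpace ℝ (Fin n)) :
    ∃ q : Polynomial ℝ, q.natDegree ≤ d ∧ ∀ i ∈ A, res d A v i = v i - q.eval ((i : ℕ) : ℝ) := by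
  obtain ⟨q, hq, h⟩ := (polyProj_mem d A v).2
  exact ⟨q, hq, fun i hi => by simp [res, hi, h i hi]⟩

theorem norm_sq_res_eq_sum (d : ℕ) (A : Finset (Fin n)) (v : EuclideanSpace ℝ (Fin n)) :
    ‖res d A v‖ ^ 2 = ∑ i ∈ A, res d A v i ^ 2 := by
  rw [norm_sq_eq_sum]
  refine (Finset.sum_subset (Finset.subset_univ _) fun i _ hi => ?_).symm
  simp [res_apply_of_notMem hi]

/-- The residual sum of squares on `A`. -/
def rss (d : ℕ) (f : EuclideanSpace ℝ (Fin n)) (A : Finset (Fin n)) : ℝ := ‖res d A f‖ ^ 2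

theorem rss_nonneg (d : ℕ) (f : EuclideanSpace ℝ (Fin n)) (A : Finset (Fin n)) : 0 ≤ rss d f A :=
  sq_nonneg _

theorem rss_le {d : ℕ} (f : EuclideanSpace ℝ (Fin n)) (A : Finset (Fin n)) {q : Polynomial ℝ}
    (hq : q.natDegree ≤ d) : rss d f A ≤ ∑ i ∈ A, (f i - q.eval ((i : ℕ) : ℝ)) ^ 2 := by
  have h1 : ∑ i ∈ A, (f i - q.eval ((i : ℕ) : ℝ)) ^ 2 = ‖cut A (f - polyVec q)‖ ^ 2 := by
    rw [norm_sq_cut]; simp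
  have h2 : cut A (f - polyVec q) = res d A f + (polyProj d A f - cut A (polyVec q)) := by
    rw [cut_sub, res]; abel
  have h3 := Submodule.sub_mem _ (polyProj_mem d A f) (cut_polyVec_mem A hq)
  rw [h1, h2, rss, norm_add_sq_real, inner_res_of_mem h3]
  nlinarith [sq_nonneg ‖polyProj d A f - cut A (polyVec q)‖]

theorem exists_rss_eq (d : ℕ) (f : EuclideanSpace ℝ (Fin n)) (A : Finset (Fin n)) :
    ∃ q : Polynomial ℝ, q.natDegree ≤ d ∧
      rss d f A = ∑ i ∈ A, (f i - q.eval ((i : ℕ) : ℝ)) ^ 2 := by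
  obtain ⟨q, hq, h⟩ := exists_res_eq d A f
  exact ⟨q, hq, by rw [rss, norm_sq_res_eq_sum]; exact Finset.sum_congr rfl fun i hi => by rw [h i hi]⟩

theorem rss_mono {d : ℕ} {f : EuclideanSpace ℝ (Fin n)} {A B : Finset (Fin n)} (h : A ⊆ B) :
    rss d f A ≤ rss d f B := by
  obtain ⟨q, hq, hB⟩ := exists_rss_eq d f B
  rw [hB]
  exact (rss_le f A hq).trans (Finset.sum_le_sum_of_subset_of_nonneg h fun _ _ _ => sq_nonneg _)

/-- The best polynomial on C competes on A and on B. -/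
theorem rss_add_le {d : ℕ} {f : EuclideanSpace ℝ (Fin n)} {A B C : Finset (Fin n)}
    (hAB : Disjoint A B) (hA : A ⊆ C) (hB : B ⊆ C) : rss d f A + rss d f B ≤ rss d f C := by
  obtain ⟨q, hq, h⟩ := exists_rss_eq d f C
  rw [h]
  calc _ ≤ _ := add_le_add (rss_le f A hq) (rss_le f B hq)
    _ = ∑ i ∈ A ∪ B, (f i - q.eval ((i : ℕ) : ℝ)) ^ 2 := (Finset.sum_union hAB).symm
    _ ≤ _ := Finset.sum_le_sum_of_subset_of_nonneg (Finset.union_subset hA hB)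
      fun _ _ _ => sq_nonneg _

/-- The residuals on a smaller set only depend on the residuals on a larger one. -/
theorem res_res {d : ℕ} {f : EuclideanSpace ℝ (Fin n)} {A B : Finset (Fin n)} (h : A ⊆ B) :
    res d A (res d B f) = res d A f := by
  obtain ⟨q, hq, hB⟩ := exists_res_eq d B f
  symm
  refine res_eq_iff_of_mem ?_ fun w hw => inner_res_of_mem hw _
  have : cut A f - res d A (res d B f) = cut A (polyVec q) + polyProj d A (res d B f) := by
    ext i
    by_cases hi : i ∈ A
    · simp [res, hi]
      have := hB i (h hi)
      simp [res, h hi] at this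
      simp [h hi]; linarith
    · simp [hi, res_apply_of_notMem hi, (polyProj_mem d A _).1 i hi]
  rw [this]
  exact Submodule.add_mem _ (cut_polyVec_mem A hq) (polyProj_mem _ _ _)

theorem mem_of_ordConnected {A : Finset (Fin n)} (hA : (A : Set (Fin n)).OrdConnected)
    {i j k : Fin n} (hi : i ∈ A) (hk : k ∈ A) (hij : i ≤ j) (hjk : j ≤ k) : j ∈ A :=
  hA.out hi hk ⟨hij, hjk⟩

/-- Pointwise bound for polynomial vectors on an interval. -/
theorem sq_le_of_mem_polyOn {d : ℕ} {A : Finset (Fin n)} (hA : (A : Set (Fin n)).OrdConnected)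
    {v : EuclideanSpace ℝ (Fin n)} (hv : v ∈ polyOn d A) (i : Fin n) :
    v i ^ 2 ≤ 2 * ((d : ℝ) + 1) ^ 2 / A.card * ‖v‖ ^ 2 := by
  by_cases hi : i ∈ A
  swap
  · rw [hv.1 i hi, zero_pow two_ne_zero]; positivity
  obtain ⟨hs, q, hq, hvq⟩ := hv
  have hne : A.Nonempty := ⟨i, hi⟩
  set s := A.min' hne
  set t := A.max' hne
  have hA' : A = Finset.Icc s t := by
    ext j
    simp only [Finset.mem_Icc]
    exact ⟨fun hj => ⟨A.min'_le j hj, A.le_max' j hj⟩,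
      fun hj => mem_of_ordConnected hA (A.min'_mem hne) (A.max'_mem hne) hj.1 hj.2⟩
  have hst : s ≤ t := A.min'_le _ (A.max'_mem hne)
  have h := sq_eval_le_sum_Icc d q hq (s : ℕ) (t : ℕ) (i : ℕ)
    (Fin.le_def.1 (A.min'_le i hi)) (Fin.le_def.1 (A.le_max' i hi))
  have hcard : (A.card : ℝ) = ((t : ℕ) : ℝ) - (s : ℕ) + 1 := by
    rw [hA', Fin.card_Icc, Nat.cast_sub (by have := Fin.le_def.1 hst; omega)]; push_cast; ring
  have hsum : ‖v‖ ^ 2 = ∑ j ∈ Finset.Icc (s : ℕ) (t : ℕ), q.eval (j : ℝ) ^ 2 := by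
    have h1 : Finset.Icc (s : ℕ) (t : ℕ) = A.map Fin.valEmbedding := by
      rw [hA', Fin.map_valEmbedding_Icc]
    rw [h1, Finset.sum_map, norm_sq_eq_sum,
      ← Finset.sum_subset (Finset.subset_univ A) (fun j _ hj => by simp [hs j hj])]
    exact Finset.sum_congr rfl fun j hj => by rw [hvq j hj]; rfl
  rw [hvq i hi, hcard, hsum]
  exact h

/-- The projection w of a basis vector satisfies |w|² = w_i. The pointwise bound at i then gives
|w|² ≤ κ, and at j it gives w_j² ≤ κ². -/
theorem abs_polyProj_single_le {d : ℕ} {A : Finset (Fin n)} (hA : (A : Set (Fin n)).OrdConnected)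
    (i j : Fin n) :
    |polyProj d A (EuclideanSpace.single i 1) j| ≤ 2 * ((d : ℝ) + 1) ^ 2 / A.card := by
  set w := polyProj d A (EuclideanSpace.single i 1) with hw
  set κ : ℝ := 2 * ((d : ℝ) + 1) ^ 2 / A.card with hκ
  have hκ0 : 0 ≤ κ := by positivity
  have hmem := polyProj_mem d A (EuclideanSpace.single i 1)
  have h1 : ‖w‖ ^ 2 = w i := by
    have := Submodule.inner_starProjection_left_eq_right (polyOn d A) (EuclideanSpace.single i 1) w
    rw [Submodule.starProjection_eq_self_iff.2 hmem] at this
    have h2 : inner ℝ (EuclideanSpace.single i (1 : ℝ)) w = w i := by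
      rw [EuclideanSpace.inner_single_left]; simp
    rw [← h2, ← this, ← real_inner_self_eq_norm_sq]; rfl
  have h2 := sq_le_of_mem_polyOn hA hmem i
  have h3 := sq_le_of_mem_polyOn hA hmem j
  rw [← hw, ← hκ] at h2 h3
  have h4 : ‖w‖ ^ 2 ≤ κ := by
    by_cases h0 : ‖w‖ = 0
    · rw [h0]; simpa using hκ0
    · have : 0 < ‖w‖ ^ 2 := by positivity
      rw [← h1] at h2
      nlinarith
  rw [← sq_le_sq₀ (abs_nonneg _) hκ0, sq_abs]
  nlinarith

theorem abs_polyProj_le {d : ℕ} {A : Finset (Fin n)} (hA : (A : Set (Fin n)).OrdConnected)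
    (v : EuclideanSpace ℝ (Fin n)) (i : Fin n) :
    |polyProj d A v i| ≤ 2 * ((d : ℝ) + 1) ^ 2 / A.card * ∑ j ∈ A, |v j| := by
  have h1 : polyProj d A v i = ∑ j ∈ A, v j * polyProj d A (EuclideanSpace.single i 1) j := by
    have h := Submodule.inner_starProjection_left_eq_right (polyOn d A) v
      (EuclideanSpace.single i (1 : ℝ))
    rw [EuclideanSpace.inner_single_right] at h
    simp only [conj_trivial, one_mul] at h
    change polyProj d A v i = _ at h
    rw [h, inner_eq_sum]
    refine (Finset.sum_subset (Finset.subset_univ _) fun j _ hj => ?_).symm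
    have := (polyProj_mem d A (EuclideanSpace.single i 1)).1 j hj
    rw [polyProj] at this
    rw [this, mul_zero]
  rw [h1, Finset.mul_sum]
  refine (Finset.abs_sum_le_sum_abs _ _).trans (Finset.sum_le_sum fun j _ => ?_)
  rw [abs_mul, mul_comm]
  exact mul_le_mul_of_nonneg_right (abs_polyProj_single_le hA i j) (abs_nonneg _)

theorem finrank_polyOn_le (d : ℕ) (A : Finset (Fin n)) :
    Module.finrank ℝ (polyOn d A) ≤ d + 1 := by
  let φ : Polynomial.degreeLT ℝ (d + 1) →ₗ[ℝ] EuclideanSpace ℝ (Fin n) :=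
    { toFun := fun q => cut A (polyVec q.1)
      map_add' := fun p q => by ext i; by_cases h : i ∈ A <;> simp [h]
      map_smul' := fun a q => by ext i; by_cases h : i ∈ A <;> simp [h] }
  have hle : polyOn d A ≤ LinearMap.range φ := by
    rintro v ⟨hv, q, hq, hvq⟩
    refine ⟨⟨q, ?_⟩, ?_⟩
    · rw [Polynomial.mem_degreeLT]
      exact lt_of_le_of_lt (Polynomial.degree_le_of_natDegree_le hq) (by exact_mod_cast Nat.lt_succ_self d)
    · ext i
      by_cases h : i ∈ A
      · simp [φ, h, hvq i h]
      · simp [φ, h, hv i h]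
  have : FiniteDimensional ℝ (Polynomial.degreeLT ℝ (d + 1)) :=
    (Polynomial.degreeLTEquiv ℝ (d + 1)).symm.finiteDimensional
  calc _ ≤ Module.finrank ℝ (LinearMap.range φ) := Submodule.finrank_mono hle
    _ ≤ Module.finrank ℝ (Polynomial.degreeLT ℝ (d + 1)) := LinearMap.finrank_range_le φ
    _ = d + 1 := by
      rw [(Polynomial.degreeLTEquiv ℝ (d + 1)).finrank_eq]; simp

end

/-! ### Interval partitions and their piecewise polynomial models. -/

section

variable {n : ℕ}

/-- `C` is a partition of `Fin n` into intervals with at least `d + 1` points. -/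
structure IsCellFamily (d : ℕ) (C : Finset (Finset (Fin n))) : Prop where
  ordConnected : ∀ A ∈ C, (A : Set (Fin n)).OrdConnected
  le_card : ∀ A ∈ C, d + 1 ≤ A.card
  eq_of_mem : ∀ A ∈ C, ∀ B ∈ C, ∀ i, i ∈ A → i ∈ B → A = B
  cover : ∀ i, ∃ A ∈ C, i ∈ A

/-- The vectors that are polynomial of degree at most `d` on each member of `C`. -/
def pw (d : ℕ) (C : Finset (Finset (Fin n))) : Submodule ℝ (EuclideanSpace ℝ (Fin n)) where
  carrier := {v | ∀ A ∈ C, ∃ q : Polynomial ℝ, q.natDegree ≤ d ∧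
    ∀ i ∈ A, v i = q.eval ((i : ℕ) : ℝ)}
  zero_mem' := fun _ _ => ⟨0, by simp, by simp⟩
  add_mem' := by
    intro v w hv hw A hA
    obtain ⟨q, hq, hvq⟩ := hv A hA
    obtain ⟨p, hp, hwp⟩ := hw A hA
    refine ⟨q + p, (Polynomial.natDegree_add_le _ _).trans (max_le hq hp), fun i hi => ?_⟩
    simp [hvq i hi, hwp i hi]
  smul_mem' := by
    intro a v hv A hA
    obtain ⟨q, hq, hvq⟩ := hv A hA
    refine ⟨Polynomial.C a * q, (Polynomial.natDegree_C_mul_le _ _).trans hq, fun i hi => ?_⟩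
    simp [hvq i hi]

theorem mem_pw_iff {d : ℕ} {C : Finset (Finset (Fin n))} {v : EuclideanSpace ℝ (Fin n)} :
    v ∈ pw d C ↔ ∀ A ∈ C, cut A v ∈ polyOn d A := by
  refine forall₂_congr fun A _ => ⟨?_, ?_⟩
  · rintro ⟨q, hq, h⟩
    exact ⟨fun i hi => by simp [hi], q, hq, fun i hi => by simp [hi, h i hi]⟩
  · rintro ⟨_, q, hq, h⟩
    exact ⟨q, hq, fun i hi => by simpa [hi] using h i hi⟩

theorem euclidean_sum_apply {ι : Type*} (s : Finset ι) (v : ι → EuclideanSpace ℝ (Fin n))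
    (i : Fin n) : (∑ a ∈ s, v a) i = ∑ a ∈ s, v a i := by
  simp

namespace IsCellFamily

variable {d : ℕ} {C : Finset (Finset (Fin n))}

theorem sum_apply (hC : IsCellFamily d C) {v : Finset (Fin n) → EuclideanSpace ℝ (Fin n)}
    (hv : ∀ A ∈ C, ∀ i ∉ A, v A i = 0) {A : Finset (Fin n)} (hA : A ∈ C) {i : Fin n} (hi : i ∈ A) :
    (∑ B ∈ C, v B) i = v A i := by
  rw [euclidean_sum_apply]
  refine Finset.sum_eq_single_of_mem A hA fun B hB hne => hv B hB i fun hiB => hne ?_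
  exact hC.eq_of_mem B hB A hA i hiB hi

theorem sum_cut (hC : IsCellFamily d C) (v : EuclideanSpace ℝ (Fin n)) : ∑ A ∈ C, cut A v = v := by
  ext i
  obtain ⟨A, hA, hi⟩ := hC.cover i
  rw [hC.sum_apply (fun B _ j hj => by simp [hj]) hA hi]
  simp [hi]

theorem polyOn_le_pw (hC : IsCellFamily d C) {A : Finset (Fin n)} (hA : A ∈ C) :
    polyOn d A ≤ pw d C := by
  rintro v ⟨hv, q, hq, h⟩ B hB
  by_cases hAB : A = B
  · subst hAB; exact ⟨q, hq, h⟩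
  · refine ⟨0, by simp, fun i hi => ?_⟩
    rw [hv i fun hiA => hAB (hC.eq_of_mem A hA B hB i hiA hi)]; simp

theorem starProjection_pw (hC : IsCellFamily d C) (v : EuclideanSpace ℝ (Fin n)) :
    (pw d C).starProjection v = ∑ A ∈ C, polyProj d A v := by
  refine Submodule.eq_starProjection_of_mem_of_inner_eq_zero (K := pw d C) ?_ fun w hw => ?_
  · exact Submodule.sum_mem _ fun A hA => hC.polyOn_le_pw hA (polyProj_mem d A v)
  · have h1 : v - ∑ A ∈ C, polyProj d A v = ∑ A ∈ C, res d A v := by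
      conv_lhs => rw [← hC.sum_cut v]
      rw [← Finset.sum_sub_distrib]
      refine Finset.sum_congr rfl fun A hA => ?_
      rw [res]
      congr 2
      rw [hC.sum_cut]
    rw [h1, sum_inner]
    refine Finset.sum_eq_zero fun A hA => ?_
    rw [real_inner_comm, ← inner_cut_of_support (A := A) (fun i hi => res_apply_of_notMem hi v),
      real_inner_comm]
    exact inner_res_of_mem (mem_pw_iff.1 hw A hA) v

theorem sub_starProjection_pw (hC : IsCellFamily d C) (v : EuclideanSpace ℝ (Fin n)) :
    v - (pw d C).starProjection v = ∑ A ∈ C, res d A v := by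
  rw [hC.starProjection_pw]
  conv_lhs => rw [← hC.sum_cut v]
  rw [← Finset.sum_sub_distrib]
  refine Finset.sum_congr rfl fun A hA => ?_
  rw [res]
  congr 2
  rw [hC.sum_cut]

theorem norm_sq_sum (hC : IsCellFamily d C) {v : Finset (Fin n) → EuclideanSpace ℝ (Fin n)}
    (hv : ∀ A ∈ C, ∀ i ∉ A, v A i = 0) : ‖∑ A ∈ C, v A‖ ^ 2 = ∑ A ∈ C, ‖v A‖ ^ 2 := by
  rw [← real_inner_self_eq_norm_sq, sum_inner]
  refine Finset.sum_congr rfl fun A hA => ?_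
  rw [inner_sum, Finset.sum_eq_single_of_mem A hA, real_inner_self_eq_norm_sq]
  intro B hB hne
  rw [inner_eq_sum]
  refine Finset.sum_eq_zero fun i _ => ?_
  by_cases hi : i ∈ A
  · rw [hv B hB i fun hiB => hne (hC.eq_of_mem B hB A hA i hiB hi), mul_zero]
  · rw [hv A hA i hi, zero_mul]

theorem norm_sq_sub_starProjection_pw (hC : IsCellFamily d C) (v : EuclideanSpace ℝ (Fin n)) :
    ‖v - (pw d C).starProjection v‖ ^ 2 = ∑ A ∈ C, rss d v A := by
  rw [hC.sub_starProjection_pw, hC.norm_sq_sum fun A _ i hi => res_apply_of_notMem hi v]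
  rfl

theorem nonempty (hC : IsCellFamily d C) (hn : 0 < n) : C.Nonempty := by
  obtain ⟨A, hA, -⟩ := hC.cover ⟨0, hn⟩
  exact ⟨A, hA⟩

/-- A polynomial of degree at most d is determined by its values on a cell, which has more than d
points, so polynomials can be chosen independently on the cells. -/
theorem card_mul_le_finrank (hC : IsCellFamily d C) :
    (d + 1) * C.card ≤ Module.finrank ℝ (pw d C) := by
  have : FiniteDimensional ℝ (Polynomial.degreeLT ℝ (d + 1)) :=
    (Polynomial.degreeLTEquiv ℝ (d + 1)).symm.finiteDimensional
  let φ : (C → Polynomial.degreeLT ℝ (d + 1)) →ₗ[ℝ] EuclideanSpace ℝ (Fin n) :=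
    { toFun := fun q => ∑ A : C, cut A.1 (polyVec (q A).1)
      map_add' := fun p q => by
        rw [← Finset.sum_add_distrib]
        refine Finset.sum_congr rfl fun A _ => ?_
        ext i; by_cases h : i ∈ A.1 <;> simp [h]
      map_smul' := fun a q => by
        rw [Finset.smul_sum]
        refine Finset.sum_congr rfl fun A _ => ?_
        ext i; by_cases h : i ∈ A.1 <;> simp [h] }
  have hφ : ∀ q (A : C) (i : Fin n), i ∈ A.1 → φ q i = (q A).1.eval ((i : ℕ) : ℝ) := by
    intro q A i hi
    change (∑ A : C, cut A.1 (polyVec (q A).1)) i = _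
    rw [euclidean_sum_apply, Finset.sum_eq_single A]
    · simp [hi]
    · intro B _ hne
      have : i ∉ B.1 := fun hiB => hne (Subtype.ext (hC.eq_of_mem B.1 B.2 A.1 A.2 i hiB hi))
      simp [this]
    · simp
  have hdeg : ∀ q : Polynomial.degreeLT ℝ (d + 1), q.1.natDegree ≤ d := fun q => by
    have := Polynomial.mem_degreeLT.1 q.2
    by_cases h0 : q.1 = 0
    · simp [h0]
    · exact Nat.lt_succ_iff.1 ((Polynomial.natDegree_lt_iff_degree_lt h0).2 this)
  have hinj : Function.Injective φ := by
    rw [← LinearMap.ker_eq_bot, LinearMap.ker_eq_bot']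
    intro q hq
    funext A
    apply Subtype.ext
    refine Polynomial.eq_zero_of_natDegree_lt_card_of_eval_eq_zero' (q A).1
      (A.1.image fun i : Fin n => ((i : ℕ) : ℝ)) ?_ ?_
    · intro x hx
      obtain ⟨i, hi, rfl⟩ := Finset.mem_image.1 hx
      rw [← hφ q A i hi, hq]; rfl
    · rw [Finset.card_image_of_injective _ fun i j h => Fin.ext (by exact_mod_cast h)]
      exact lt_of_le_of_lt (hdeg _) (hC.le_card _ A.2)
  have hle : LinearMap.range φ ≤ pw d C := by
    rintro _ ⟨q, rfl⟩ A hA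
    exact ⟨(q ⟨A, hA⟩).1, hdeg _, fun i hi => hφ q ⟨A, hA⟩ i hi⟩
  calc (d + 1) * C.card = Module.finrank ℝ (C → Polynomial.degreeLT ℝ (d + 1)) := by
        rw [Module.finrank_pi_fintype]
        simp [(Polynomial.degreeLTEquiv ℝ (d + 1)).finrank_eq, mul_comm]
    _ = Module.finrank ℝ (LinearMap.range φ) := (LinearMap.finrank_range_of_inj hinj).symm
    _ ≤ _ := Submodule.finrank_mono hle

/-- The cells of a coarser model do not split the cells of the finer one. -/
theorem cut_mem_pw {C₀ : Finset (Finset (Fin n))} (hC : IsCellFamily d C)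
    (hle : pw d C ≤ pw d C₀) {A : Finset (Fin n)} (hA : A ∈ C) {v : EuclideanSpace ℝ (Fin n)}
    (hv : v ∈ pw d C₀) : cut A v ∈ pw d C₀ := by
  classical
  intro J hJ
  by_cases h1 : ∀ i ∈ J, i ∉ A
  · exact ⟨0, by simp, fun i hi => by simp [h1 i hi]⟩
  by_cases h2 : J ⊆ A
  · obtain ⟨q, hq, h⟩ := hv J hJ
    exact ⟨q, hq, fun i hi => by simp [h2 hi, h i hi]⟩
  -- On at most d + 1 points any vector is interpolated by a polynomial of degree at most d, so a
  -- split cell of this size is harmless.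
  by_cases h3 : J.card ≤ d + 1
  · have hinj : Set.InjOn (fun i : Fin n => ((i : ℕ) : ℝ)) J :=
      fun i _ j _ h => Fin.ext (by simpa using h)
    refine ⟨Lagrange.interpolate J (fun i : Fin n => ((i : ℕ) : ℝ)) fun i => cut A v i, ?_, ?_⟩
    · refine Polynomial.natDegree_le_of_degree_le ((Lagrange.degree_interpolate_le _ hinj).trans ?_)
      exact_mod_cast (by omega : J.card - 1 ≤ d)
    · intro i hi
      exact (Lagrange.eval_interpolate_at_node _ hinj hi).symm
  -- J has at least d + 2 points and straddles the boundary of A. Cut to A a polynomial of degree at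
  -- most d with zero set Z inside (J ∩ A) \ {x}: the result vanishes on J \ A and on Z, at least d
  -- + 1 points of J, but not at x, so it cannot be polynomial on J.
  exfalso
  push Not at h1
  obtain ⟨x, hxJ, hxA⟩ := h1
  obtain ⟨y, hyJ, hyA⟩ := Finset.not_subset.1 h2
  obtain ⟨Z, hZ, hZc⟩ := Finset.exists_subset_card_eq
    (s := (J ∩ A).erase x) (n := min ((J ∩ A).card - 1) d) (by
      rw [Finset.card_erase_of_mem (by simp [hxJ, hxA])]; exact min_le_left _ _)
  set q : Polynomial ℝ := ∏ z ∈ Z, (Polynomial.X - Polynomial.C ((z : ℕ) : ℝ)) with hq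
  have hqd : q.natDegree ≤ d := by
    rw [hq, Polynomial.natDegree_prod_of_monic _ _ fun z _ => Polynomial.monic_X_sub_C _]
    simp only [Polynomial.natDegree_X_sub_C, Finset.sum_const, smul_eq_mul, mul_one]
    rw [hZc]; exact min_le_right _ _
  obtain ⟨p, hp, h⟩ := hle (hC.polyOn_le_pw hA (cut_polyVec_mem A hqd)) J hJ
  have hcard : (J \ A).card + Z.card ≥ d + 1 := by
    have h4 := Finset.card_sdiff_add_card_inter J A
    have h5 : 0 < (J \ A).card := Finset.card_pos.2 ⟨y, by simp [hyJ, hyA]⟩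
    have h6 : 0 < (J ∩ A).card := Finset.card_pos.2 ⟨x, by simp [hxJ, hxA]⟩
    rw [hZc]
    rcases le_total ((J ∩ A).card - 1) d with h7 | h7
    · rw [min_eq_left h7]; omega
    · rw [min_eq_right h7]; omega
  have hZsub : ∀ z ∈ Z, z ∈ J ∧ z ∈ A ∧ z ≠ x := fun z hz => by
    have := hZ hz
    simp only [Finset.mem_erase, Finset.mem_inter] at this
    exact ⟨this.2.1, this.2.2, this.1⟩
  have hp0 : p = 0 := by
    refine Polynomial.eq_zero_of_natDegree_lt_card_of_eval_eq_zero' p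
      (((J \ A) ∪ Z).image fun i : Fin n => ((i : ℕ) : ℝ)) ?_ ?_
    · intro t ht
      obtain ⟨i, hi, rfl⟩ := Finset.mem_image.1 ht
      rcases Finset.mem_union.1 hi with hi | hi
      · obtain ⟨hiJ, hiA⟩ := Finset.mem_sdiff.1 hi
        rw [← h i hiJ]; simp [hiA]
      · obtain ⟨hiJ, hiA, -⟩ := hZsub i hi
        rw [← h i hiJ, cut_apply, if_pos hiA, polyVec_apply, hq, Polynomial.eval_prod]
        exact Finset.prod_eq_zero hi (by simp)
    · rw [Finset.card_image_of_injective _ fun i j h => Fin.ext (by exact_mod_cast h),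
        Finset.card_union_of_disjoint]
      · omega
      · rw [Finset.disjoint_left]
        intro i hi hi'
        exact (Finset.mem_sdiff.1 hi).2 (hZsub i hi').2.1
  have hx := h x hxJ
  rw [hp0, cut_apply, if_pos hxA, polyVec_apply, hq, Polynomial.eval_prod] at hx
  simp only [Polynomial.eval_zero] at hx
  obtain ⟨z, hz, hz0⟩ := Finset.prod_eq_zero_iff.1 hx
  simp only [Polynomial.eval_sub, Polynomial.eval_X, Polynomial.eval_C] at hz0
  exact (hZsub z hz).2.2 (Fin.ext (by have : ((x : ℕ) : ℝ) = (z : ℕ) := by linarith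
                                      exact_mod_cast this.symm))

theorem res_mem_pw {C₀ : Finset (Finset (Fin n))} (hC : IsCellFamily d C)
    (hle : pw d C ≤ pw d C₀) {A : Finset (Fin n)} (hA : A ∈ C) {v : EuclideanSpace ℝ (Fin n)}
    (hv : v ∈ pw d C₀) : res d A v ∈ pw d C₀ :=
  Submodule.sub_mem _ (hC.cut_mem_pw hle hA hv)
    (hle (hC.polyOn_le_pw hA (polyProj_mem d A v)))

theorem sq_le_of_mem_pw (hC : IsCellFamily d C) {ν : ℝ} (hν : 0 < ν)
    (hcard : ∀ A ∈ C, ν ≤ A.card) {v : EuclideanSpace ℝ (Fin n)} (hv : v ∈ pw d C) (i : Fin n) :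
    v i ^ 2 ≤ 2 * ((d : ℝ) + 1) ^ 2 / ν * ‖v‖ ^ 2 := by
  obtain ⟨A, hA, hi⟩ := hC.cover i
  have h := sq_le_of_mem_polyOn (hC.ordConnected A hA) (mem_pw_iff.1 hv A hA) i
  rw [cut_apply, if_pos hi] at h
  have h2 : ‖cut A v‖ ^ 2 ≤ ‖v‖ ^ 2 := pow_le_pow_left₀ (norm_nonneg _) (norm_cut_le A v) 2
  have h3 := hcard A hA
  calc _ ≤ _ := h
    _ ≤ _ := by gcongr

end IsCellFamily

/-- The set of (zero-based) positions attached to a set of indices in `{1, …, n}`. -/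
def positions (I : Finset ℕ) : Finset (Fin n) := Finset.univ.filter fun i => (i : ℕ) + 1 ∈ I

@[simp] theorem mem_positions {I : Finset ℕ} {i : Fin n} :
    i ∈ (positions I : Finset (Fin n)) ↔ (i : ℕ) + 1 ∈ I := by simp [positions]

/-- The cells of a partition of `{1, …, n}`. -/
def cells (m : Finpartition (Finset.Icc 1 n)) : Finset (Finset (Fin n)) := m.parts.image positions

theorem card_positions {I : Finset ℕ} (hI : I ⊆ Finset.Icc 1 n) :
    (positions I : Finset (Fin n)).card = I.card := by
  refine Finset.card_bij (fun i _ => (i : ℕ) + 1) (fun i hi => mem_positions.1 hi)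
    (fun i _ j _ h => Fin.ext (by omega)) fun k hk => ?_
  have := Finset.mem_Icc.1 (hI hk)
  exact ⟨⟨k - 1, by omega⟩, mem_positions.2 (by simpa [Nat.sub_add_cancel this.1] using hk),
    by simp; omega⟩

theorem isCellFamily_cells {d : ℕ} {m : Finpartition (Finset.Icc 1 n)} (hm : IsAdmissible d m) :
    IsCellFamily d (cells m) where
  ordConnected := by
    intro A hA
    obtain ⟨I, hI, rfl⟩ := Finset.mem_image.1 hA
    refine ⟨fun i hi j hj k hk => ?_⟩
    have hi' := mem_positions.1 hi
    have hj' := mem_positions.1 hj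
    refine mem_positions.2 ((hm I hI).1.out hi' hj' ⟨?_, ?_⟩)
    · have := Fin.le_def.1 hk.1; omega
    · have := Fin.le_def.1 hk.2; omega
  le_card := by
    intro A hA
    obtain ⟨I, hI, rfl⟩ := Finset.mem_image.1 hA
    rw [card_positions (m.le hI)]
    exact (hm I hI).2
  eq_of_mem := by
    intro A hA B hB i hiA hiB
    obtain ⟨I, hI, rfl⟩ := Finset.mem_image.1 hA
    obtain ⟨J, hJ, rfl⟩ := Finset.mem_image.1 hB
    rw [m.eq_of_mem_parts hI hJ (mem_positions.1 hiA) (mem_positions.1 hiB)]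
  cover := by
    intro i
    have hi : (i : ℕ) + 1 ∈ Finset.Icc 1 n := Finset.mem_Icc.2 ⟨by omega, by have := i.2; omega⟩
    obtain ⟨I, hI, h⟩ := m.exists_mem hi
    exact ⟨positions I, Finset.mem_image_of_mem _ hI, mem_positions.2 h⟩

/-- Rounding n x up turns the half-open real interval, open at (min I - 1)/n, into a closed range of
integers. -/
theorem mem_cell_iff {I : Finset ℕ} (hI : I.Nonempty) (hpos : ∀ k ∈ I, 1 ≤ k)
    (hn : 0 < n) (x : ℝ) :
    x ∈ cell n I ↔ (I.min' hI ≤ ⌈(n : ℝ) * x⌉₊) ∧ (⌈(n : ℝ) * x⌉₊ ≤ I.max' hI) := by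
  have h1 : sInf (I : Set ℕ) = I.min' hI := by
    rw [Finset.min'_eq_inf', Finset.inf'_eq_csInf_image]; simp
  have h2 : I.sup id = I.max' hI := by
    rw [Finset.max'_eq_sup', Finset.sup'_eq_sup]
  have hn' : (0 : ℝ) < n := by exact_mod_cast hn
  have h3 : 1 ≤ I.min' hI := hpos _ (I.min'_mem hI)
  rw [cell, Set.mem_Ioc, h1, h2, div_lt_iff₀ hn', le_div_iff₀ hn', mul_comm x]
  refine and_congr ?_ Nat.ceil_le.symm
  rw [← Nat.cast_one, ← Nat.cast_sub h3, ← Nat.lt_ceil]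
  omega

theorem model_eq_pw (hn : 0 < n) {d : ℕ} {m : Finpartition (Finset.Icc 1 n)}
    (hm : IsAdmissible d m) : model d m = pw d (cells m) := by
  classical
  have hn' : (0 : ℝ) < n := by exact_mod_cast hn
  have hne : ∀ I ∈ m.parts, I.Nonempty := fun I hI => m.nonempty_of_mem_parts hI
  have hpos : ∀ I ∈ m.parts, ∀ k ∈ I, 1 ≤ k := fun I hI k hk =>
    (Finset.mem_Icc.1 (m.le hI hk)).1
  have hceil : ∀ i : Fin n, ⌈(n : ℝ) * ((((i : ℕ) : ℝ) + 1) / n)⌉₊ = (i : ℕ) + 1 := fun i => by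
    rw [mul_div_cancel₀ _ hn'.ne']
    exact_mod_cast Nat.ceil_natCast ((i : ℕ) + 1)
  apply le_antisymm
  · refine Submodule.span_le.2 ?_
    rintro v ⟨P, hP, rfl⟩ A hA
    obtain ⟨I, hI, rfl⟩ := Finset.mem_image.1 hA
    obtain ⟨q, hq, h⟩ := hP I hI
    refine ⟨q.comp (Polynomial.C ((n : ℝ)⁻¹) * (Polynomial.X + 1)), ?_, fun i hi => ?_⟩
    · refine Polynomial.natDegree_comp_le.trans ?_
      refine (Nat.mul_le_mul hq (Polynomial.natDegree_C_mul_le _ _)).trans ?_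
      have : (Polynomial.X + 1 : Polynomial ℝ).natDegree ≤ 1 := by
        refine (Polynomial.natDegree_add_le _ _).trans ?_
        simp
      nlinarith
    · have hi' := mem_positions.1 hi
      have := h ((((i : ℕ) : ℝ) + 1) / n) ((mem_cell_iff (hne I hI) (hpos I hI) hn _).2 (by
        rw [hceil]; exact ⟨I.min'_le _ hi', I.le_max' _ hi'⟩))
      change P ((((i : ℕ) : ℝ) + 1) / n) = _
      rw [this]
      simp [Polynomial.eval_comp, div_eq_inv_mul]
  · intro v hv
    have hv' : ∀ I : Finset ℕ, ∃ q : Polynomial ℝ, I ∈ m.parts → q.natDegree ≤ d ∧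
        ∀ i : Fin n, (i : ℕ) + 1 ∈ I → v i = q.eval ((i : ℕ) : ℝ) := by
      intro I
      by_cases hI : I ∈ m.parts
      · obtain ⟨q, hq, h⟩ := hv (positions I) (Finset.mem_image_of_mem _ hI)
        exact ⟨q, fun _ => ⟨hq, fun i hi => h i (mem_positions.2 hi)⟩⟩
      · exact ⟨0, fun h => absurd h hI⟩
    choose Q hQ using hv'
    -- The polynomial used at x is that of the cell containing ⌈n x⌉; the shift by 1 passes from
    -- indices to zero-based positions.
    refine Submodule.subset_span ⟨fun x => (Q (m.part ⌈(n : ℝ) * x⌉₊)).eval ((n : ℝ) * x - 1),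
      ?_, ?_⟩
    · intro I hI
      refine ⟨(Q I).comp (Polynomial.C (n : ℝ) * Polynomial.X - 1), ?_, fun x hx => ?_⟩
      · refine Polynomial.natDegree_comp_le.trans ?_
        have : (Polynomial.C (n : ℝ) * Polynomial.X - 1 : Polynomial ℝ).natDegree ≤ 1 := by
          refine (Polynomial.natDegree_sub_le _ _).trans ?_
          simpa using (Polynomial.natDegree_C_mul_le (n : ℝ) Polynomial.X).trans Polynomial.natDegree_X_le
        have h2 := (hQ I hI).1
        nlinarith
      · obtain ⟨h1, h2⟩ := (mem_cell_iff (hne I hI) (hpos I hI) hn x).1 hx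
        have h3 : ⌈(n : ℝ) * x⌉₊ ∈ I :=
          (hm I hI).1.out (I.min'_mem _) (I.max'_mem _) ⟨h1, h2⟩
        change (Q (m.part ⌈(n : ℝ) * x⌉₊)).eval _ = _
        rw [m.part_eq_of_mem hI h3]
        simp [Polynomial.eval_comp]
    · ext i
      change v i = (Q (m.part ⌈(n : ℝ) * ((((i : ℕ) : ℝ) + 1) / n)⌉₊)).eval _
      have hi : (i : ℕ) + 1 ∈ Finset.Icc 1 n := Finset.mem_Icc.2 ⟨by omega, by have := i.2; omega⟩
      rw [hceil, mul_div_cancel₀ _ hn'.ne', add_sub_cancel_right]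
      exact (hQ _ (m.part_mem.2 hi)).2 i (m.mem_part hi)

end

/-! ### Packing numbers and finite nets. -/

section

/-- Volume comparison: the balls of radius ε/2 around the points are disjoint and lie in the ball of
radius R + ε/2. -/
theorem card_le_of_separated {V : Type*} [NormedAddCommGroup V] [NormedSpace ℝ V]
    [FiniteDimensional ℝ V] (s : Finset V) {R ε : ℝ} (hε : 0 < ε) (hR : 0 ≤ R)
    (hs : ∀ t ∈ s, ‖t‖ ≤ R) (hsep : ∀ t ∈ s, ∀ u ∈ s, t ≠ u → ε ≤ ‖t - u‖) :
    (s.card : ℝ) ≤ (1 + 2 * R / ε) ^ Module.finrank ℝ V := by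
  let _ : MeasurableSpace V := borel V
  have : BorelSpace V := ⟨rfl⟩
  let μ : Measure V := Measure.addHaar
  set D := Module.finrank ℝ V
  set δ : ℝ := ε / 2 with hδ
  have hδ0 : 0 < δ := by positivity
  set ρ : ℝ := R + δ with hρ
  have hρ0 : 0 < ρ := by positivity
  set A := ⋃ c ∈ s, Metric.ball (c : V) δ with hA
  have D_disj : Set.Pairwise (s : Set V) (Function.onFun Disjoint fun c => Metric.ball (c : V) δ) := by
    rintro c hc d hd hcd
    apply Metric.ball_disjoint_ball
    rw [dist_eq_norm]
    have := hsep c hc d hd hcd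
    rw [hδ]; linarith
  have A_subset : A ⊆ Metric.ball (0 : V) ρ := by
    refine Set.iUnion₂_subset fun x hx => ?_
    apply Metric.ball_subset_ball'
    rw [dist_zero_right]
    have := hs x hx
    linarith
  have I : (s.card : ENNReal) * ENNReal.ofReal (δ ^ D) * μ (Metric.ball 0 1) ≤
      ENNReal.ofReal (ρ ^ D) * μ (Metric.ball 0 1) :=
    calc
      (s.card : ENNReal) * ENNReal.ofReal (δ ^ D) * μ (Metric.ball 0 1) = μ A := by
        rw [hA, measure_biUnion_finset D_disj fun c _ => measurableSet_ball]
        have J : ∀ c : V, μ (Metric.ball c δ) = ENNReal.ofReal (δ ^ D) * μ (Metric.ball 0 1) :=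
          fun x => μ.addHaar_ball_of_pos _ hδ0
        simp only [J, Finset.sum_const, nsmul_eq_mul, mul_assoc]
      _ ≤ μ (Metric.ball (0 : V) ρ) := measure_mono A_subset
      _ = ENNReal.ofReal (ρ ^ D) * μ (Metric.ball 0 1) := μ.addHaar_ball_of_pos _ hρ0
  have J : (s.card : ENNReal) * ENNReal.ofReal (δ ^ D) ≤ ENNReal.ofReal (ρ ^ D) :=
    (ENNReal.mul_le_mul_iff_left (Metric.measure_ball_pos _ _ zero_lt_one).ne'
      measure_ball_lt_top.ne).1 I
  rw [← ENNReal.ofReal_natCast, ← ENNReal.ofReal_mul (by positivity),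
    ENNReal.ofReal_le_ofReal_iff (by positivity)] at J
  have h1 : 1 + 2 * R / ε = ρ / δ := by rw [hρ, hδ]; field_simp; ring
  rw [h1, div_pow, le_div_iff₀ (by positivity)]
  exact J

theorem card_le_of_separated' {ι V : Type*} [NormedAddCommGroup V] [NormedSpace ℝ V]
    (S : Submodule ℝ V) [FiniteDimensional ℝ S] (s : Finset ι) (v : ι → V) {R ε : ℝ} (hε : 0 < ε)
    (hR : 0 ≤ R) (hmem : ∀ t ∈ s, v t ∈ S)
    (hs : ∀ t ∈ s, ‖v t‖ ≤ R) (hsep : ∀ t ∈ s, ∀ u ∈ s, t ≠ u → ε ≤ ‖v t - v u‖) :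
    (s.card : ℝ) ≤ (1 + 2 * R / ε) ^ Module.finrank ℝ S := by
  classical
  let w : s → S := fun t => ⟨v t, hmem t t.2⟩
  have hw : Function.Injective w := by
    intro t u h
    by_contra hne
    have h1 := hsep t t.2 u u.2 fun h' => hne (Subtype.ext h')
    have h2 : v t = v u := congrArg Subtype.val h
    rw [h2, sub_self, norm_zero] at h1
    linarith
  have h := card_le_of_separated (Finset.univ.image w) hε hR (by
    intro x hx
    obtain ⟨t, -, rfl⟩ := Finset.mem_image.1 hx
    exact hs t t.2) (by
    intro x hx y hy hxy
    obtain ⟨t, -, rfl⟩ := Finset.mem_image.1 hx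
    obtain ⟨u, -, rfl⟩ := Finset.mem_image.1 hy
    exact hsep t t.2 u u.2 fun h' => hxy (by rw [Subtype.ext h']))
  rw [Finset.card_image_of_injective _ hw] at h
  simpa using h

/-- A finite net of a bounded subset of a finite-dimensional space. -/
theorem exists_finite_net {V : Type*} [NormedAddCommGroup V] [NormedSpace ℝ V]
    (S : Submodule ℝ V) [FiniteDimensional ℝ S] {R ε : ℝ} (hε : 0 < ε) (hR : 0 ≤ R) :
    ∃ T : Finset V, (∀ t ∈ T, t ∈ S ∧ ‖t‖ ≤ R) ∧
      (T.card : ℝ) ≤ (1 + 2 * R / ε) ^ Module.finrank ℝ S ∧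
      ∀ x ∈ S, ‖x‖ ≤ R → ∃ t ∈ T, ‖x - t‖ < ε := by
  classical
  let good : Finset V → Prop := fun T => (∀ t ∈ T, t ∈ S ∧ ‖t‖ ≤ R) ∧
    ∀ t ∈ T, ∀ u ∈ T, t ≠ u → ε ≤ ‖t - u‖
  have hbd : ∀ T, good T → (T.card : ℝ) ≤ (1 + 2 * R / ε) ^ Module.finrank ℝ S := fun T hT =>
    card_le_of_separated' S T id hε hR (fun t ht => (hT.1 t ht).1) (fun t ht => (hT.1 t ht).2) hT.2
  -- The packing bound makes the cardinalities of separated sets bounded; a separated set of maximal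
  -- cardinality is a net.
  let N : Set ℕ := {k | ∃ T, good T ∧ T.card = k}
  have hN : N.Nonempty := ⟨0, ∅, ⟨by simp, by simp⟩, rfl⟩
  have hNb : BddAbove N := ⟨⌈(1 + 2 * R / ε) ^ Module.finrank ℝ S⌉₊, by
    rintro _ ⟨T, hT, rfl⟩
    exact_mod_cast (hbd T hT).trans (Nat.le_ceil _)⟩
  obtain ⟨T, hT, hcard⟩ := Nat.sSup_mem hN hNb
  refine ⟨T, hT.1, hbd T hT, fun x hx hxR => ?_⟩
  by_contra hcon
  push Not at hcon
  have hxT : x ∉ T := fun h => by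
    have := hcon x h
    rw [sub_self, norm_zero] at this
    linarith
  have hgood : good (insert x T) := by
    refine ⟨fun t ht => ?_, fun t ht u hu hne => ?_⟩
    · rcases Finset.mem_insert.1 ht with rfl | ht
      · exact ⟨hx, hxR⟩
      · exact hT.1 t ht
    · rcases Finset.mem_insert.1 ht with rfl | ht' <;> rcases Finset.mem_insert.1 hu with rfl | hu'
      · exact absurd rfl hne
      · exact hcon u hu'
      · rw [norm_sub_rev]; exact hcon t ht'
      · exact hT.2 t ht' u hu' hne
  have := le_csSup hNb ⟨insert x T, hgood, rfl⟩
  rw [Finset.card_insert_of_notMem hxT, ← hcard] at this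
  omega

/-- A maximal separated subset of a finite family is a net. -/
theorem exists_separated_net {ι V : Type*} [NormedAddCommGroup V] (T : Finset ι) (v : ι → V)
    (ε : ℝ) (hε : 0 < ε) : ∃ N ⊆ T, (∀ t ∈ N, ∀ u ∈ N, t ≠ u → ε ≤ ‖v t - v u‖) ∧
      ∀ t ∈ T, ∃ u ∈ N, ‖v t - v u‖ < ε := by
  classical
  let good : Finset ι → Prop := fun N => ∀ t ∈ N, ∀ u ∈ N, t ≠ u → ε ≤ ‖v t - v u‖
  obtain ⟨N, hN, hmax⟩ := Finset.exists_max_image (T.powerset.filter good) Finset.card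
    ⟨∅, by simp [good]⟩
  rw [Finset.mem_filter, Finset.mem_powerset] at hN
  refine ⟨N, hN.1, hN.2, fun t ht => ?_⟩
  by_contra hcon
  push Not at hcon
  have htN : t ∉ N := fun h => by
    have := hcon t h
    rw [sub_self, norm_zero] at this
    linarith
  have := hmax (insert t N) (by
    rw [Finset.mem_filter, Finset.mem_powerset]
    refine ⟨Finset.insert_subset ht hN.1, fun a ha u hu hne => ?_⟩
    rcases Finset.mem_insert.1 ha with rfl | ha' <;> rcases Finset.mem_insert.1 hu with rfl | hu'
    · exact absurd rfl hne
    · exact hcon u hu'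
    · rw [norm_sub_rev]; exact hcon a ha'
    · exact hN.2 a ha' u hu' hne)
  rw [Finset.card_insert_of_notMem htN] at this
  omega

end

/-! ### Deviations and moments of noise with Bernstein exponential moments. -/

section

variable {n : ℕ} {Ω : Type*} [MeasurableSpace Ω]

/-- Centred noise with Bernstein-type deviations. -/
structure IsNoise (μ : Measure Ω) (σ c : ℝ) (ξ : Ω → EuclideanSpace ℝ (Fin n)) : Prop where
  measurable : Measurable ξ
  tail : ∀ (t : EuclideanSpace ℝ (Fin n)) (s β y : ℝ), 0 < s → 0 ≤ β → 0 ≤ y → ‖t‖ ≤ s →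
    (∀ i, |t i| ≤ β) →
    μ.real {ω | s * σ * √(2 * y) + c * β * y ≤ inner ℝ (ξ ω) t} ≤ Real.exp (-y)
  integrable_inner : ∀ t : EuclideanSpace ℝ (Fin n), Integrable (fun ω => inner ℝ (ξ ω) t) μ
  integral_inner : ∀ t : EuclideanSpace ℝ (Fin n), ∫ ω, inner ℝ (ξ ω) t ∂μ = 0
  integrable_norm_pow : Integrable (fun ω => ‖ξ ω‖ ^ 4) μ
  integral_norm_pow_le : ∫ ω, ‖ξ ω‖ ^ 4 ∂μ ≤ 40 * (n : ℝ) ^ 2 * (σ + c) ^ 4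

theorem pow_four_le_cosh (x : ℝ) : x ^ 4 ≤ 24 * Real.cosh x := by
  have h := le_hasSum (Real.hasSum_cosh x) 2 fun k _ => by
    rw [pow_mul]; positivity
  norm_num [Nat.factorial] at h
  linarith

variable {μ : Measure Ω} [IsProbabilityMeasure μ] {σ c : ℝ}

theorem BernsteinCondition.mgf_le {X : Ω → ℝ} (h : BernsteinCondition μ σ c X) {t : ℝ}
    (ht : t ∈ Set.Ioo (-(1 / c)) (1 / c)) :
    mgf X μ t ≤ Real.exp (t ^ 2 * σ ^ 2 / (2 * (1 - |t| * c))) := by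
  have hpos : 0 < mgf X μ t := mgf_pos (h t ht).1
  rw [← Real.log_le_iff_le_exp hpos]
  exact (h t ht).2

theorem BernsteinCondition.pow_four {X : Ω → ℝ} (hσ : 0 < σ) (hc : 0 < c)
    (hX : Measurable X) (h : BernsteinCondition μ σ c X) :
    Integrable (fun ω => X ω ^ 4) μ ∧ ∫ ω, X ω ^ 4 ∂μ ≤ 40 * (σ + c) ^ 4 := by
  -- Here the Bernstein exponent equals σ/(2(σ + c)) ≤ 1/2, so the moment generating function at ±l
  -- is at most √e ≤ 5/3, and 40 = 12 (5/3 + 5/3).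
  set l : ℝ := 1 / (σ + c) with hl
  have hl0 : 0 < l := by positivity
  have hlc : l < 1 / c := one_div_lt_one_div_of_lt hc (by linarith)
  have hp : l ∈ Set.Ioo (-(1 / c)) (1 / c) := ⟨by linarith, hlc⟩
  have hm : -l ∈ Set.Ioo (-(1 / c)) (1 / c) := ⟨by linarith, by linarith⟩
  have hexp : l ^ 2 * σ ^ 2 / (2 * (1 - l * c)) ≤ 1 / 2 := by
    have : l ^ 2 * σ ^ 2 / (2 * (1 - l * c)) = (1 / 2) * (σ / (σ + c)) := by
      rw [hl]
      have h1 : 1 - 1 / (σ + c) * c = σ / (σ + c) := by field_simp; ring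
      rw [h1]; field_simp
    rw [this]
    have : σ / (σ + c) ≤ 1 := (div_le_one (by positivity)).2 (by linarith)
    linarith
  have h1 := h.mgf_le hp
  have h2 := h.mgf_le hm
  rw [abs_of_pos hl0] at h1
  rw [abs_neg, abs_of_pos hl0, neg_sq] at h2
  have he : Real.exp (l ^ 2 * σ ^ 2 / (2 * (1 - l * c))) ≤ 5 / 3 := by
    refine (Real.exp_le_exp.2 hexp).trans ?_
    have h3 : Real.exp (1 / 2) ^ 2 = Real.exp 1 := by rw [← Real.exp_nat_mul]; norm_num
    have h4 := Real.exp_one_lt_d9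
    nlinarith [Real.exp_pos (1 / 2)]
  have hpt : ∀ ω, X ω ^ 4 ≤ 12 * (σ + c) ^ 4 * (Real.exp (l * X ω) + Real.exp (-l * X ω)) := by
    intro ω
    have h3 := pow_four_le_cosh (l * X ω)
    rw [Real.cosh_eq, ← neg_mul] at h3
    have h4 : X ω ^ 4 = (σ + c) ^ 4 * (l * X ω) ^ 4 := by
      rw [hl]; field_simp
    rw [h4]
    have : 0 ≤ (σ + c) ^ 4 := by positivity
    nlinarith
  have hint : Integrable (fun ω => 12 * (σ + c) ^ 4 *
      (Real.exp (l * X ω) + Real.exp (-l * X ω))) μ :=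
    ((h l hp).1.add (h (-l) hm).1).const_mul _
  have hint4 : Integrable (fun ω => X ω ^ 4) μ := by
    refine hint.mono' (by fun_prop) (Filter.Eventually.of_forall fun ω => ?_)
    rw [Real.norm_of_nonneg (by positivity)]
    exact hpt ω
  refine ⟨hint4, (integral_mono hint4 hint hpt).trans ?_⟩
  rw [integral_const_mul, integral_add (h l hp).1 (h (-l) hm).1]
  change 12 * (σ + c) ^ 4 * (mgf X μ l + mgf X μ (-l)) ≤ _
  have : 0 ≤ (σ + c) ^ 4 := by positivity
  nlinarith

theorem isNoise_of_bernstein (hσ : 0 < σ) (hc : 0 < c) {ξ : Ω → EuclideanSpace ℝ (Fin n)}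
    (hξ : Measurable ξ) (hindep : iIndepFun (fun (i : Fin n) (ω : Ω) => ξ ω i) μ)
    (hmean : ∀ i : Fin n, Integrable (fun ω => ξ ω i) μ ∧ ∫ ω, ξ ω i ∂μ = 0)
    (hnoise : ∀ i : Fin n, BernsteinCondition μ σ c fun ω => ξ ω i) : IsNoise μ σ c ξ := by
  have hmeas : ∀ i : Fin n, Measurable fun ω => ξ ω i := fun i => by fun_prop
  have hint : ∀ t : EuclideanSpace ℝ (Fin n), Integrable (fun ω => inner ℝ (ξ ω) t) μ := by
    intro t
    simp_rw [inner_eq_sum]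
    exact integrable_finsetSum _ fun i _ => (hmean i).1.mul_const _
  have h4 := fun i => (hnoise i).pow_four hσ hc (hmeas i)
  have hpt : ∀ ω, ‖ξ ω‖ ^ 4 ≤ n * ∑ i, ξ ω i ^ 4 := by
    intro ω
    have : ‖ξ ω‖ ^ 4 = (‖ξ ω‖ ^ 2) ^ 2 := by ring
    rw [this, norm_sq_eq_sum]
    have := sq_sum_le_card_mul_sum_sq (s := (Finset.univ : Finset (Fin n))) (f := fun i => ξ ω i ^ 2)
    simpa [← pow_mul] using this
  have hint4 : Integrable (fun ω => (n : ℝ) * ∑ i, ξ ω i ^ 4) μ :=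
    (integrable_finsetSum _ fun i _ => (h4 i).1).const_mul _
  have hint4' : Integrable (fun ω => ‖ξ ω‖ ^ 4) μ := by
    refine hint4.mono' (by fun_prop) (Filter.Eventually.of_forall fun ω => ?_)
    rw [Real.norm_of_nonneg (by positivity)]
    exact hpt ω
  refine ⟨hξ, ?_, hint, ?_, hint4', ?_⟩
  · intro t s β y hs hβ hy hts htβ
    set w := √(2 * y) with hw
    have hw0 : 0 ≤ w := Real.sqrt_nonneg _
    have hwy : w ^ 2 = 2 * y := Real.sq_sqrt (by positivity)
    set A := s * σ with hA
    set B := c * β with hB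
    have hA0 : 0 < A := by positivity
    have hB0 : 0 ≤ B := by positivity
    -- The Chernoff parameter for which the exponent -l(Aw + By) + A²l²/(2(1 - lB)) is exactly -y.
    set l := w / (A + B * w) with hl
    have hden : 0 < A + B * w := by positivity
    have hl0 : 0 ≤ l := by positivity
    have hlB : 1 - l * B = A / (A + B * w) := by rw [hl]; field_simp; ring
    have hlB' : 0 < 1 - l * B := by rw [hlB]; positivity
    set X : Fin n → Ω → ℝ := fun i ω => t i * ξ ω i with hX
    have hXi : iIndepFun X μ :=
      hindep.comp (fun i x => t i * x) fun i => measurable_const_mul _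
    have hXm : ∀ i, Measurable (X i) := fun i => (hmeas i).const_mul _
    have hmem : ∀ i, t i * l ∈ Set.Ioo (-(1 / c)) (1 / c) := by
      intro i
      rw [Set.mem_Ioo, ← abs_lt, abs_mul, abs_of_nonneg hl0, lt_div_iff₀ hc]
      have : |t i| * l * c ≤ β * l * c := by gcongr; exact htβ i
      have : β * l * c = l * B := by rw [hB]; ring
      linarith
    have hexp : ∀ i, Integrable (fun ω => Real.exp (l * X i ω)) μ := by
      intro i
      have := (hnoise i (t i * l) (hmem i)).1
      refine this.congr (Filter.Eventually.of_forall fun ω => ?_)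
      simp only [hX]; congr 1; ring
    have hmgf : ∀ i, mgf (X i) μ l ≤ Real.exp (t i ^ 2 * (l ^ 2 * σ ^ 2 / (2 * (1 - l * B)))) := by
      intro i
      rw [hX, mgf_const_mul]
      refine ((hnoise i).mgf_le (hmem i)).trans (Real.exp_le_exp.2 ?_)
      have h5 : 1 - l * B ≤ 1 - |t i * l| * c := by
        rw [abs_mul, abs_of_nonneg hl0, hB]
        have : |t i| * l * c ≤ β * l * c := by gcongr; exact htβ i
        linarith
      calc (t i * l) ^ 2 * σ ^ 2 / (2 * (1 - |t i * l| * c))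
          ≤ (t i * l) ^ 2 * σ ^ 2 / (2 * (1 - l * B)) := by gcongr
        _ = _ := by ring
    have hinner : ∀ ω, inner ℝ (ξ ω) t = (∑ i, X i) ω := by
      intro ω
      rw [inner_eq_sum, Finset.sum_apply]
      exact Finset.sum_congr rfl fun i _ => mul_comm _ _
    have hsum : mgf (∑ i, X i) μ l ≤ Real.exp (A ^ 2 * (l ^ 2 / (2 * (1 - l * B)))) := by
      rw [hXi.mgf_sum hXm]
      calc _ ≤ ∏ i, Real.exp (t i ^ 2 * (l ^ 2 * σ ^ 2 / (2 * (1 - l * B)))) :=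
            Finset.prod_le_prod (fun i _ => mgf_nonneg) fun i _ => hmgf i
        _ = Real.exp (‖t‖ ^ 2 * (l ^ 2 * σ ^ 2 / (2 * (1 - l * B)))) := by
            rw [← Real.exp_sum, ← Finset.sum_mul, norm_sq_eq_sum]
        _ ≤ Real.exp (s ^ 2 * (l ^ 2 * σ ^ 2 / (2 * (1 - l * B)))) := by
            refine Real.exp_le_exp.2 (mul_le_mul_of_nonneg_right ?_ (by positivity))
            exact pow_le_pow_left₀ (norm_nonneg _) hts 2
        _ = _ := by rw [hA]; congr 1; ring
    have hint' : Integrable (fun ω => Real.exp (l * (∑ i, X i) ω)) μ :=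
      hXi.integrable_exp_mul_sum hXm fun i _ => hexp i
    have h6 := measure_ge_le_exp_mul_mgf (X := ∑ i, X i) (μ := μ) (A * w + B * y) hl0 hint'
    have h7 : {ω | s * σ * w + c * β * y ≤ inner ℝ (ξ ω) t} =
        {ω | A * w + B * y ≤ (∑ i, X i) ω} := by
      ext ω; simp only [Set.mem_ofPred_eq, hinner]; rfl
    rw [h7]
    refine h6.trans ?_
    calc _ ≤ Real.exp (-l * (A * w + B * y)) * Real.exp (A ^ 2 * (l ^ 2 / (2 * (1 - l * B)))) := by
          gcongr
      _ = Real.exp (-y) := by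
          rw [← Real.exp_add]
          congr 1
          have hy' : y = w ^ 2 / 2 := by linarith
          rw [hlB, hy', hl]
          field_simp
          ring
  · intro t
    simp_rw [inner_eq_sum]
    rw [integral_finsetSum _ fun i _ => (hmean i).1.mul_const _]
    refine Finset.sum_eq_zero fun i _ => ?_
    rw [integral_mul_const, (hmean i).2, zero_mul]
  · refine (integral_mono hint4' hint4 hpt).trans ?_
    rw [integral_const_mul, integral_finsetSum _ fun i _ => (h4 i).1]
    calc (n : ℝ) * ∑ i, ∫ ω, ξ ω i ^ 4 ∂μ ≤ n * ∑ _i : Fin n, 40 * (σ + c) ^ 4 := by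
          gcongr with i; exact (h4 i).2
      _ = _ := by simp; ring

namespace IsNoise

variable {ξ : Ω → EuclideanSpace ℝ (Fin n)}

theorem integrable_norm_sq (h : IsNoise μ σ c ξ) : Integrable (fun ω => ‖ξ ω‖ ^ 2) μ := by
  have hm := h.measurable
  refine ((integrable_const (1 : ℝ)).add h.integrable_norm_pow).mono' (by fun_prop)
    (Filter.Eventually.of_forall fun ω => ?_)
  rw [Real.norm_of_nonneg (by positivity)]
  simp only [Pi.add_apply]
  nlinarith [sq_nonneg (‖ξ ω‖ ^ 2 - 1)]

theorem integrable_norm_sq_clm (h : IsNoise μ σ c ξ)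
    (S : Submodule ℝ (EuclideanSpace ℝ (Fin n))) :
    Integrable (fun ω => ‖S.starProjection (ξ ω)‖ ^ 2) μ := by
  have hm := h.measurable
  refine h.integrable_norm_sq.mono' (by fun_prop) (Filter.Eventually.of_forall fun ω => ?_)
  rw [Real.norm_of_nonneg (by positivity)]
  exact pow_le_pow_left₀ (norm_nonneg _) (S.norm_starProjection_apply_le _) 2

theorem tail_abs (h : IsNoise μ σ c ξ) {t : EuclideanSpace ℝ (Fin n)} {s β y : ℝ} (hs : 0 < s)
    (hβ : 0 ≤ β) (hy : 0 ≤ y) (hts : ‖t‖ ≤ s) (htβ : ∀ i, |t i| ≤ β) :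
    μ.real {ω | s * σ * √(2 * y) + c * β * y ≤ |inner ℝ (ξ ω) t|} ≤ 2 * Real.exp (-y) := by
  have h1 := h.tail t s β y hs hβ hy hts htβ
  have h2 := h.tail (-t) s β y hs hβ hy (by rwa [norm_neg]) fun i => by simpa using htβ i
  have h3 : {ω | s * σ * √(2 * y) + c * β * y ≤ |inner ℝ (ξ ω) t|} ⊆
      {ω | s * σ * √(2 * y) + c * β * y ≤ inner ℝ (ξ ω) t} ∪
      {ω | s * σ * √(2 * y) + c * β * y ≤ inner ℝ (ξ ω) (-t)} := by
    intro ω hω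
    simp only [Set.mem_union, Set.mem_ofPred_eq, inner_neg_right] at hω ⊢
    exact le_abs.1 hω
  calc _ ≤ _ := measureReal_mono h3
    _ ≤ _ := measureReal_union_le _ _
    _ ≤ _ := by linarith

end IsNoise

end

/-! ### From tails to expectations, and a localized tail bound. -/

section

variable {n : ℕ} {Ω : Type*} [MeasurableSpace Ω] {μ : Measure Ω} [IsProbabilityMeasure μ]
  {σ c : ℝ} {ξ : Ω → EuclideanSpace ℝ (Fin n)}

/-- Layer-cake formula; G is an antiderivative of the tail bound vanishing at infinity, so -G(0) is
the integral of that bound over (0, ∞). -/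
theorem integral_posPart_le {X : Ω → ℝ} (hX : Integrable X μ) {G g : ℝ → ℝ}
    (hG : ∀ z ∈ Set.Ici (0 : ℝ), HasDerivAt G (g z) z) (hg : ∀ z ∈ Set.Ioi (0 : ℝ), 0 ≤ g z)
    (hlim : Filter.Tendsto G Filter.atTop (nhds 0))
    (htail : ∀ z > 0, μ.real {ω | z ≤ X ω} ≤ g z) : ∫ ω, max (X ω) 0 ∂μ ≤ -G 0 := by
  have hint : IntegrableOn g (Set.Ioi 0) := integrableOn_Ioi_deriv_of_nonneg' hG hg hlim
  have h1 := Integrable.integral_eq_integral_meas_le hX.pos_part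
    (Filter.Eventually.of_forall fun ω => le_max_right _ _)
  rw [h1]
  have h2 := integral_Ioi_of_hasDerivAt_of_tendsto' hG hint hlim
  rw [zero_sub] at h2
  rw [← h2]
  have h3 : ∀ z ∈ Set.Ioi (0 : ℝ), μ.real {ω | z ≤ max (X ω) 0} ≤ g z := by
    intro z hz
    refine le_trans (measureReal_mono ?_) (htail z hz)
    intro ω hω
    rcases le_max_iff.1 (show z ≤ max (X ω) 0 from hω) with h | h
    · exact h
    · exact absurd h (not_le.2 hz)
  refine integral_mono_of_nonneg (Filter.Eventually.of_forall fun z => measureReal_nonneg) hint ?_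
  exact (ae_restrict_iff' measurableSet_Ioi).2 (Filter.Eventually.of_forall h3)

theorem integral_posPart_le_of_exp {X : Ω → ℝ} (hX : Integrable X μ) {q B : ℝ} (hq : 0 < q)
    (hB : 0 ≤ B) (htail : ∀ z > 0, μ.real {ω | z ≤ X ω} ≤ B * Real.exp (-(z / q))) :
    ∫ ω, max (X ω) 0 ∂μ ≤ q * B := by
  have h := integral_posPart_le (μ := μ) hX (G := fun z => -(q * B) * Real.exp (-(z / q)))
    (g := fun z => B * Real.exp (-(z / q))) (fun z _ => ?_) (fun z _ => by positivity) ?_ htail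
  · simpa using h
  · have h1 : HasDerivAt (fun z : ℝ => -(z / q)) (-(1 / q)) z :=
      ((hasDerivAt_id z).div_const q).neg
    refine (h1.exp.const_mul (-(q * B))).congr_deriv ?_
    field_simp
  · have h1 : Filter.Tendsto (fun z : ℝ => Real.exp (-(z / q))) Filter.atTop (nhds 0) :=
      Real.tendsto_exp_neg_atTop_nhds_zero.comp (Filter.tendsto_id.atTop_div_const hq)
    simpa using h1.const_mul (-(q * B))

/-- Put z = (u² - 1)M. For y ≥ 4 one has exp(-y(u - 1)) ≤ u⁻⁴ = (1 + z/M)⁻², whose integral in z is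
M. -/
theorem integral_posPart_le_of_sqrt {X : Ω → ℝ} (hX : Integrable X μ) {M y : ℝ} (hM : 0 < M)
    (hy : 4 ≤ y) (htail : ∀ u > 1, μ.real {ω | (u ^ 2 - 1) * M ≤ X ω} ≤ Real.exp (-(y * u))) :
    ∫ ω, max (X ω) 0 ∂μ ≤ M * Real.exp (-y) := by
  have h := integral_posPart_le (μ := μ) hX (G := fun z => -(M * Real.exp (-y)) * (1 + z / M)⁻¹)
    (g := fun z => Real.exp (-y) * ((1 + z / M) ^ 2)⁻¹) (fun z hz => ?_) (fun z _ => by positivity)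
    ?_ ?_
  · simpa using h
  · have hz' : (0 : ℝ) ≤ z := hz
    have h0 : 1 + z / M ≠ 0 := by positivity
    have h1 : HasDerivAt (fun z : ℝ => 1 + z / M) (1 / M) z :=
      ((hasDerivAt_id z).div_const M).const_add 1
    refine ((h1.inv h0).const_mul (-(M * Real.exp (-y)))).congr_deriv ?_
    field_simp
  · have h1 : Filter.Tendsto (fun z : ℝ => (1 + z / M)⁻¹) Filter.atTop (nhds 0) :=
      (Filter.tendsto_atTop_add_const_left _ _
        (Filter.tendsto_id.atTop_div_const hM)).inv_tendsto_atTop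
    simpa using h1.const_mul (-(M * Real.exp (-y)))
  · intro z hz
    set u := √(1 + z / M) with hu
    have hu2 : u ^ 2 = 1 + z / M := Real.sq_sqrt (by positivity)
    have hzM : 0 < z / M := by positivity
    have hu1 : 1 < u := by
      rw [hu, Real.lt_sqrt (by norm_num)]; linarith
    have h1 := htail u hu1
    have h2 : (u ^ 2 - 1) * M = z := by rw [hu2]; field_simp; ring
    rw [h2] at h1
    refine h1.trans ?_
    have h3 : Real.exp (-(y * u)) = Real.exp (-y) * Real.exp (-(y * (u - 1))) := by
      rw [← Real.exp_add]; ring_nf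
    rw [h3]
    refine mul_le_mul_of_nonneg_left ?_ (Real.exp_pos _).le
    rw [Real.exp_neg, ← hu2, ← pow_mul]
    refine inv_anti₀ (by positivity) ?_
    calc u ^ (2 * 2) ≤ Real.exp (u - 1) ^ 4 := by
          refine pow_le_pow_left₀ (by linarith) ?_ 4
          have := Real.add_one_le_exp (u - 1); linarith
      _ = Real.exp (4 * (u - 1)) := by rw [← Real.exp_nat_mul]; norm_num
      _ ≤ _ := Real.exp_le_exp.2 (by nlinarith)

/-- The restriction to `A`, as a linear map. -/
def cutₗ (A : Finset (Fin n)) : EuclideanSpace ℝ (Fin n) →ₗ[ℝ] EuclideanSpace ℝ (Fin n) where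
  toFun := cut A
  map_add' := cut_add A
  map_smul' a v := by ext i; by_cases h : i ∈ A <;> simp [h]

/-- Deviations of a projection of the noise on the event where it is small in sup norm. -/
theorem IsNoise.local_tail (h : IsNoise μ σ c ξ) (hσ : 0 < σ) (hc : 0 < c)
    (S : Submodule ℝ (EuclideanSpace ℝ (Fin n))) {U y z : ℝ} (hU : 0 < U) (hy : 0 < y)
    (hz : c * U * y + 10 * σ ^ 2 * y < 9 / 20 * z) :
    μ.real {ω | z ≤ ‖S.starProjection (ξ ω)‖ ^ 2 ∧ ∀ i, |S.starProjection (ξ ω) i| ≤ U} ≤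
      5 ^ Module.finrank ℝ S * Real.exp (-y) := by
  have hz0 : 0 < z := by
    have : 0 < c * U * y + 10 * σ ^ 2 * y := by positivity
    linarith
  -- On the event in question the normalized projection p/|p| has Euclidean norm 1 and sup norm at
  -- most r. The map L encodes both constraints in a single norm, so that the net consists of flat
  -- vectors.
  set r := U / √z with hr
  have hsz : 0 < √z := Real.sqrt_pos.2 hz0
  have hr0 : 0 < r := by positivity
  let L : EuclideanSpace ℝ (Fin n) →ₗ[ℝ] EuclideanSpace ℝ (Fin n) × (Fin n → ℝ) :=
    LinearMap.prod LinearMap.id (r⁻¹ • (WithLp.linearEquiv 2 ℝ (Fin n → ℝ)).toLinearMap)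
  have hL1 : ∀ t, (L t).1 = t := fun t => rfl
  have hL2 : ∀ t i, (L t).2 i = r⁻¹ * t i := fun t i => rfl
  have hLn : ∀ t (ρ : ℝ), 0 ≤ ρ → (‖L t‖ ≤ ρ ↔ ‖t‖ ≤ ρ ∧ ∀ i, |t i| ≤ r * ρ) := by
    intro t ρ hρ
    rw [Prod.norm_def, max_le_iff, hL1, pi_norm_le_iff_of_nonneg hρ]
    refine and_congr Iff.rfl (forall_congr' fun i => ?_)
    rw [hL2, Real.norm_eq_abs, abs_mul, abs_of_pos (inv_pos.2 hr0), inv_mul_le_iff₀ hr0]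
  obtain ⟨T, hT, hTc, hTn⟩ := exists_finite_net (S.map L) (R := 1) (ε := 1 / 2) (by norm_num)
    (by norm_num)
  set b := 1 * σ * √(2 * y) + c * r * y with hb
  have hb0 : 0 ≤ b := by positivity
  have hsub : {ω | z ≤ ‖S.starProjection (ξ ω)‖ ^ 2 ∧ ∀ i, |S.starProjection (ξ ω) i| ≤ U} ⊆
      ⋃ t ∈ T, {ω | b ≤ inner ℝ (ξ ω) t.1} := by
    rintro ω ⟨hω1, hω2⟩
    by_contra hcon
    simp only [Set.mem_iUnion, not_exists, exists_prop, not_and] at hcon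
    have hcon' : ∀ t ∈ T, inner ℝ (ξ ω) t.1 ≤ b := fun t ht => (not_le.1 (hcon t ht)).le
    -- Write x = t + ½ · 2(x - t) with t in the net: 2(x - t) is again in the unit ball, so
    -- iterating bounds the supremum by twice the bound on the net.
    have key : ∀ k : ℕ, ∀ x ∈ S, ‖L x‖ ≤ 1 → inner ℝ (ξ ω) x ≤ 2 * b + (1 / 2) ^ k * ‖ξ ω‖ := by
      intro k
      induction k with
      | zero =>
        intro x hx hx1
        have h1 := ((hLn x 1 zero_le_one).1 hx1).1
        have h2 := real_inner_le_norm (ξ ω) x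
        have h3 : ‖ξ ω‖ * ‖x‖ ≤ ‖ξ ω‖ * 1 := by gcongr
        simp only [pow_zero]
        linarith
      | succ k ih =>
        intro x hx hx1
        obtain ⟨t, ht, htx⟩ := hTn (L x) (Submodule.mem_map_of_mem hx) hx1
        obtain ⟨t', ht', rfl⟩ := Submodule.mem_map.1 (hT _ ht).1
        have h1 := ih ((2 : ℝ) • (x - t')) (S.smul_mem _ (S.sub_mem hx ht')) (by
          rw [map_smul, map_sub, norm_smul]
          norm_num
          linarith)
        rw [inner_smul_right, inner_sub_right] at h1
        have h2 := hcon' _ ht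
        rw [hL1] at h2
        rw [pow_succ]
        linarith
    have hlim : ∀ x ∈ S, ‖L x‖ ≤ 1 → inner ℝ (ξ ω) x ≤ 2 * b := by
      intro x hx hx1
      have := ((tendsto_pow_atTop_nhds_zero_of_lt_one (r := (1 / 2 : ℝ)) (by norm_num)
        (by norm_num)).mul_const ‖ξ ω‖).const_add (2 * b)
      simp only [zero_mul, add_zero] at this
      exact ge_of_tendsto' this fun k => key k x hx hx1
    set p := S.starProjection (ξ ω) with hp
    have hpS : p ∈ S := Submodule.starProjection_apply_mem _ _
    have hpn : √z ≤ ‖p‖ := by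
      rw [← Real.sqrt_sq (norm_nonneg p)]; exact Real.sqrt_le_sqrt hω1
    have hp0 : 0 < ‖p‖ := lt_of_lt_of_le hsz hpn
    have hpp : inner ℝ (ξ ω) p = ‖p‖ ^ 2 := by
      have := Submodule.inner_starProjection_left_eq_right S (ξ ω) p
      rw [Submodule.starProjection_eq_self_iff.2 hpS] at this
      rw [← this, ← hp, real_inner_self_eq_norm_sq]
    have h1 := hlim (‖p‖⁻¹ • p) (S.smul_mem _ hpS) ((hLn _ 1 zero_le_one).2 ⟨by
      rw [norm_smul, norm_inv, norm_norm, inv_mul_cancel₀ hp0.ne'], fun i => by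
      rw [PiLp.smul_apply, smul_eq_mul, abs_mul, abs_of_pos (inv_pos.2 hp0), mul_one, hr,
        inv_mul_eq_div]
      exact div_le_div₀ hU.le (hω2 i) hsz hpn⟩)
    rw [inner_smul_right, hpp] at h1
    have h2 : ‖p‖⁻¹ * ‖p‖ ^ 2 = ‖p‖ := by field_simp
    rw [h2] at h1
    have h3 : √z ≤ 2 * b := hpn.trans h1
    have h4 : √z * √z = z := Real.mul_self_sqrt hz0.le
    have h5 : c * r * y * √z = c * U * y := by rw [hr]; field_simp
    have h6 : √(2 * y) ^ 2 = 2 * y := Real.sq_sqrt (by positivity)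
    have h7 : z ≤ 2 * (σ * √(2 * y) * √z) + 2 * (c * U * y) := by
      calc z = √z * √z := h4.symm
        _ ≤ 2 * b * √z := by gcongr
        _ = _ := by rw [hb, ← h5]; ring
    -- Young's inequality 2σ√(2y)√z ≤ z/10 + 20σ²y contradicts `hz`.
    nlinarith [sq_nonneg (√z - 10 * (σ * √(2 * y)))]
  calc _ ≤ μ.real (⋃ t ∈ T, {ω | b ≤ inner ℝ (ξ ω) t.1}) :=
        measureReal_mono hsub (measure_ne_top _ _)
    _ ≤ ∑ t ∈ T, μ.real {ω | b ≤ inner ℝ (ξ ω) t.1} := measureReal_biUnion_finset_le _ _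
    _ ≤ ∑ _t ∈ T, Real.exp (-y) := by
        refine Finset.sum_le_sum fun t ht => ?_
        obtain ⟨t', -, rfl⟩ := Submodule.mem_map.1 (hT _ ht).1
        have h1 := (hLn t' 1 zero_le_one).1 (hT _ ht).2
        exact h.tail t' 1 r y one_pos hr0.le hy.le h1.1 fun i => by simpa using h1.2 i
    _ = T.card * Real.exp (-y) := by rw [Finset.sum_const, nsmul_eq_mul]
    _ ≤ _ := by
        refine mul_le_mul_of_nonneg_right (hTc.trans ?_) (Real.exp_pos _).le
        norm_num
        exact pow_le_pow_right₀ (by norm_num) (Submodule.finrank_map_le L S)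

end

/-! ### Uniform control of the noise projected on the augmented models. -/

section

variable {n : ℕ} {Ω : Type*} [MeasurableSpace Ω] {μ : Measure Ω} [IsProbabilityMeasure μ]
  {σ c : ℝ} {ξ : Ω → EuclideanSpace ℝ (Fin n)}

/-- There are at most `n²` nonempty intervals. -/
theorem card_intervals_le (𝒜 : Finset (Finset (Fin n)))
    (h : ∀ A ∈ 𝒜, (A : Set (Fin n)).OrdConnected ∧ A.Nonempty) : 𝒜.card ≤ n ^ 2 := by
  classical
  have hsub : 𝒜 ⊆ (Finset.univ : Finset (Fin n × Fin n)).image fun p => Finset.Icc p.1 p.2 := by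
    intro A hA
    obtain ⟨ho, hne⟩ := h A hA
    refine Finset.mem_image.2 ⟨(A.min' hne, A.max' hne), Finset.mem_univ _, ?_⟩
    ext j
    simp only [Finset.mem_Icc]
    exact ⟨fun hj => mem_of_ordConnected ho (A.min'_mem hne) (A.max'_mem hne) hj.1 hj.2,
      fun hj => ⟨A.min'_le j hj, A.le_max' j hj⟩⟩
  refine (Finset.card_le_card hsub).trans (Finset.card_image_le.trans ?_)
  simp [sq]

/-- Polynomials on `A` and the residual of `f` on `A`. -/
def augOn (d : ℕ) (f : EuclideanSpace ℝ (Fin n)) (A : Finset (Fin n)) :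
    Submodule ℝ (EuclideanSpace ℝ (Fin n)) := polyOn d A ⊔ Submodule.span ℝ {res d A f}

/-- The model attached to `C` and the residuals of `f` on the members of `C`. -/
def augPw (d : ℕ) (f : EuclideanSpace ℝ (Fin n)) (C : Finset (Finset (Fin n))) :
    Submodule ℝ (EuclideanSpace ℝ (Fin n)) :=
  pw d C ⊔ Submodule.span ℝ ((fun A => res d A f) '' (C : Set (Finset (Fin n))))

theorem support_of_mem_augOn {d : ℕ} {f : EuclideanSpace ℝ (Fin n)} {A : Finset (Fin n)}
    {v : EuclideanSpace ℝ (Fin n)} (hv : v ∈ augOn d f A) : ∀ i ∉ A, v i = 0 := by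
  intro i hi
  obtain ⟨p, hp, r, hr, rfl⟩ := Submodule.mem_sup.1 hv
  obtain ⟨a, rfl⟩ := Submodule.mem_span_singleton.1 hr
  simp [hp.1 i hi, res_apply_of_notMem hi]

theorem finrank_augPw_le (d : ℕ) (f : EuclideanSpace ℝ (Fin n)) (C : Finset (Finset (Fin n))) :
    Module.finrank ℝ (augPw d f C) ≤ Module.finrank ℝ (pw d C) + C.card := by
  classical
  refine (Submodule.finrank_add_le_finrank_add_finrank _ _).trans ?_
  gcongr
  rw [← Finset.coe_image]
  exact (finrank_span_finset_le_card _).trans Finset.card_image_le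

namespace IsCellFamily

variable {d : ℕ} {C : Finset (Finset (Fin n))} {f : EuclideanSpace ℝ (Fin n)}

theorem augOn_le_augPw (hC : IsCellFamily d C) {A : Finset (Fin n)} (hA : A ∈ C) :
    augOn d f A ≤ augPw d f C := by
  refine sup_le_sup (hC.polyOn_le_pw hA) (Submodule.span_mono ?_)
  rintro _ rfl
  exact ⟨A, hA, rfl⟩

theorem cut_mem_augOn (hC : IsCellFamily d C) {A : Finset (Fin n)} (hA : A ∈ C)
    {v : EuclideanSpace ℝ (Fin n)} (hv : v ∈ augPw d f C) : cut A v ∈ augOn d f A := by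
  have hle : augPw d f C ≤ (augOn d f A).comap (cutₗ A) := by
    refine sup_le ?_ (Submodule.span_le.2 ?_)
    · intro w hw
      exact Submodule.mem_sup_left (mem_pw_iff.1 hw A hA)
    · rintro _ ⟨B, hB, rfl⟩
      change cut A (res d B f) ∈ augOn d f A
      by_cases hAB : A = B
      · subst hAB
        have : cut A (res d A f) = res d A f := by
          ext i
          by_cases hi : i ∈ A
          · simp [hi]
          · simp [hi, res_apply_of_notMem hi]
        rw [this]
        exact Submodule.mem_sup_right (Submodule.mem_span_singleton_self _)
      · have : cut A (res d B f) = 0 := by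
          ext i
          by_cases hi : i ∈ A
          · have : i ∉ B := fun hiB => hAB (hC.eq_of_mem A hA B hB i hi hiB)
            simp [res_apply_of_notMem this]
          · simp [hi]
        rw [this]
        exact Submodule.zero_mem _
  exact hle hv

/-- The augmented model splits over cells with disjoint supports, so a coordinate of the projection
only sees its own cell. Hence the coordinates needed for all models together are indexed by
intervals and points, however large the collection is. -/
theorem starProjection_augPw_single (hC : IsCellFamily d C) {A : Finset (Fin n)} (hA : A ∈ C)
    {i : Fin n} (hi : i ∈ A) : (augPw d f C).starProjection (EuclideanSpace.single i (1 : ℝ)) =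
      (augOn d f A).starProjection (EuclideanSpace.single i (1 : ℝ)) := by
  set w := (augOn d f A).starProjection (EuclideanSpace.single i (1 : ℝ)) with hw
  have hwA : w ∈ augOn d f A := Submodule.starProjection_apply_mem _ _
  refine Submodule.eq_starProjection_of_mem_of_inner_eq_zero (hC.augOn_le_augPw hA hwA)
    fun v hv => ?_
  have hsupp : ∀ j ∉ A, (EuclideanSpace.single i (1 : ℝ) - w) j = 0 := by
    intro j hj
    have : j ≠ i := fun h => hj (h ▸ hi)
    simp [support_of_mem_augOn hwA j hj, this]
  rw [real_inner_comm, ← inner_cut_of_support hsupp, real_inner_comm]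
  exact Submodule.starProjection_inner_eq_zero _ _ (hC.cut_mem_augOn hA hv)

theorem starProjection_augPw_apply (hC : IsCellFamily d C) {A : Finset (Fin n)} (hA : A ∈ C)
    {i : Fin n} (hi : i ∈ A) (v : EuclideanSpace ℝ (Fin n)) :
    (augPw d f C).starProjection v i =
      inner ℝ v ((augOn d f A).starProjection (EuclideanSpace.single i (1 : ℝ))) := by
  rw [← hC.starProjection_augPw_single hA hi, ← Submodule.inner_starProjection_left_eq_right,
    EuclideanSpace.inner_single_right]
  simp

end IsCellFamily

/-- Since w is the projection of a basis vector, |w|² = w_i ≤ Λ|w|, so |w| ≤ Λ; the sup norm bound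
then gives Λ². -/
theorem norm_starProjection_single_le {S : Submodule ℝ (EuclideanSpace ℝ (Fin n))} {Λ : ℝ}
    (hΛ : 0 ≤ Λ) (hS : ∀ v ∈ S, ∀ i, |v i| ≤ Λ * ‖v‖) (i j : Fin n) :
    ‖S.starProjection (EuclideanSpace.single i (1 : ℝ))‖ ≤ Λ ∧
      |S.starProjection (EuclideanSpace.single i (1 : ℝ)) j| ≤ Λ ^ 2 := by
  set w := S.starProjection (EuclideanSpace.single i (1 : ℝ)) with hw
  have hmem : w ∈ S := Submodule.starProjection_apply_mem _ _
  have h1 : ‖w‖ ^ 2 = w i := by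
    have := Submodule.inner_starProjection_left_eq_right S (EuclideanSpace.single i (1 : ℝ)) w
    rw [Submodule.starProjection_eq_self_iff.2 hmem, ← hw, real_inner_self_eq_norm_sq] at this
    rw [this, EuclideanSpace.inner_single_left]; simp
  have h2 := hS w hmem i
  have h3 : ‖w‖ ≤ Λ := by
    by_cases h0 : ‖w‖ = 0
    · rw [h0]; exact hΛ
    · have h4 : 0 < ‖w‖ := lt_of_le_of_ne (norm_nonneg _) (Ne.symm h0)
      have h5 := le_abs_self (w i)
      nlinarith
  refine ⟨h3, (hS w hmem j).trans ?_⟩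
  rw [sq]
  gcongr

theorem exp_neg_bound : Real.exp (-(19 / 10)) ≤ 4 / 25 := by
  have h0 : (6.25 : ℝ) ≤ Real.exp (19 / 10) := by
    refine le_of_pow_le_pow_left₀ (n := 10) (by norm_num) (Real.exp_pos _).le ?_
    rw [← Real.exp_nat_mul]
    have h1 : ((10 : ℕ) : ℝ) * (19 / 10) = ((19 : ℕ) : ℝ) * 1 := by norm_num
    rw [h1, Real.exp_nat_mul]
    have h2 := Real.exp_one_gt_d9
    calc (6.25 : ℝ) ^ 10 ≤ 2.7182818283 ^ 19 := by norm_num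
      _ ≤ _ := by gcongr
  rw [Real.exp_neg]
  calc (Real.exp (19 / 10))⁻¹ ≤ (6.25 : ℝ)⁻¹ := inv_anti₀ (by norm_num) h0
    _ = 4 / 25 := by norm_num

theorem twentyfive_le_exp : (25 : ℝ) ≤ Real.exp (13 / 4) := by
  refine le_of_pow_le_pow_left₀ (n := 4) (by norm_num) (Real.exp_pos _).le ?_
  rw [← Real.exp_nat_mul]
  have h1 : ((4 : ℕ) : ℝ) * (13 / 4) = ((13 : ℕ) : ℝ) * 1 := by norm_num
  rw [h1, Real.exp_nat_mul]
  have h2 := Real.exp_one_gt_d9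
  calc (25 : ℝ) ^ 4 ≤ 2.7182818283 ^ 13 := by norm_num
    _ ≤ _ := by gcongr

/-- Uniform control of the projections of the noise onto the augmented models. -/
theorem IsNoise.exists_dev_bound {ι : Type*} (h : IsNoise μ σ c ξ) (hσ : 0 < σ) (hc : 0 < c)
    (hn : 0 < n) {d : ℕ} {f : EuclideanSpace ℝ (Fin n)}
    {S₀ : Submodule ℝ (EuclideanSpace ℝ (Fin n))} {Λ : ℝ} (hΛ : 0 < Λ)
    (hS₀ : ∀ v ∈ S₀, ∀ i, |v i| ≤ Λ * ‖v‖) (M : Finset ι) (C : ι → Finset (Finset (Fin n)))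
    (hC : ∀ m ∈ M, IsCellFamily d (C m)) (haug : ∀ m ∈ M, augPw d f (C m) ≤ S₀)
    {Δ : ι → ℝ} (hΔ : ∀ m ∈ M, 0 ≤ Δ m) {V U y t : ℝ} (hV : 0 < V) (hU0 : 0 < U) (hy : 0 < y)
    (ht : 0 < t) (hU : Λ * σ * √(2 * y) + c * Λ ^ 2 * y ≤ U)
    (hq : 5.15 * ((c * U + 10.1 * σ ^ 2) * (20 / 9)) ≤ 291.6 * V)
    (hbad : (t * (40 * (n : ℝ) ^ 2 * (σ + c) ^ 4) + 2 * (n : ℝ) ^ 3 * Real.exp (-y) / t) / 2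
      ≤ 32.4 * V) :
    ∃ W : Ω → ℝ, Integrable W μ ∧ ∫ ω, W ω ∂μ ≤ 0.03 * (324 * V) * ∑ m ∈ M, Real.exp (-Δ m) ∧
      ∀ ω, ∀ m ∈ M, ‖(augPw d f (C m)).starProjection (ξ ω)‖ ^ 2 -
        324 * V * (Module.finrank ℝ (pw d (C m)) + Δ m) ≤ W ω := by
  classical
  have hξ := h.measurable
  set 𝒜 := M.biUnion C with h𝒜
  have h𝒜mem : ∀ A ∈ 𝒜, ∃ m ∈ M, A ∈ C m := fun A hA => Finset.mem_biUnion.1 hA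
  have h𝒜card : 𝒜.card ≤ n ^ 2 := card_intervals_le 𝒜 fun A hA => by
    obtain ⟨m, hm, hAm⟩ := h𝒜mem A hA
    refine ⟨(hC m hm).ordConnected A hAm, Finset.card_pos.1 ?_⟩
    have := (hC m hm).le_card A hAm
    omega
  let τ : Finset (Fin n) × Fin n → EuclideanSpace ℝ (Fin n) := fun p =>
    (augOn d f p.1).starProjection (EuclideanSpace.single p.2 (1 : ℝ))
  let b : ℝ := Λ * σ * √(2 * y) + c * Λ ^ 2 * y
  -- A single event serves all models: at most n² intervals times n points, along directions of norm
  -- at most Λ and sup norm at most Λ².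
  let bad : Set Ω := ⋃ p ∈ 𝒜 ×ˢ (Finset.univ : Finset (Fin n)), {ω | b ≤ |inner ℝ (ξ ω) (τ p)|}
  have hbadm : MeasurableSet bad := by
    refine Finset.measurableSet_biUnion _ fun p _ => ?_
    exact measurableSet_le measurable_const (by fun_prop)
  have hbadμ : μ.real bad ≤ 2 * (n : ℝ) ^ 3 * Real.exp (-y) := by
    calc μ.real bad ≤ ∑ p ∈ 𝒜 ×ˢ (Finset.univ : Finset (Fin n)),
          μ.real {ω | b ≤ |inner ℝ (ξ ω) (τ p)|} := measureReal_biUnion_finset_le _ _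
      _ ≤ ∑ _p ∈ 𝒜 ×ˢ (Finset.univ : Finset (Fin n)), 2 * Real.exp (-y) := by
          refine Finset.sum_le_sum fun p hp => ?_
          obtain ⟨m, hm, hAm⟩ := h𝒜mem p.1 (Finset.mem_product.1 hp).1
          have hS : ∀ v ∈ augOn d f p.1, ∀ i, |v i| ≤ Λ * ‖v‖ := fun v hv =>
            hS₀ v (haug m hm ((hC m hm).augOn_le_augPw hAm hv))
          refine h.tail_abs hΛ (by positivity) hy.le
            (norm_starProjection_single_le hΛ.le hS p.2 p.2).1 fun j =>
            (norm_starProjection_single_le hΛ.le hS p.2 j).2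
      _ = 𝒜.card * n * (2 * Real.exp (-y)) := by
          rw [Finset.sum_const, Finset.card_product, nsmul_eq_mul]; simp
      _ ≤ (n : ℝ) ^ 2 * n * (2 * Real.exp (-y)) := by
          gcongr; exact_mod_cast h𝒜card
      _ = _ := by ring
  set D : ι → ℝ := fun m => (Module.finrank ℝ (pw d (C m)) : ℝ) with hD
  have hDC : ∀ m ∈ M, ((C m).card : ℝ) ≤ D m ∧ 1 ≤ D m := by
    intro m hm
    have h1 := (hC m hm).card_mul_le_finrank
    have h2 := Finset.card_pos.2 ((hC m hm).nonempty hn)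
    have h3 : (C m).card ≤ Module.finrank ℝ (pw d (C m)) := by nlinarith
    exact ⟨by simp only [hD]; exact_mod_cast h3, by simp only [hD]; exact_mod_cast (by omega :
      1 ≤ Module.finrank ℝ (pw d (C m)))⟩
  set X : ι → Ω → ℝ := fun m ω => ‖(augPw d f (C m)).starProjection (ξ ω)‖ ^ 2 with hX
  have hXint : ∀ m, Integrable (X m) μ := fun m => h.integrable_norm_sq_clm _
  -- 291.6 is nine tenths of 324. The remaining tenth is at least 32.4 V, because the dimension is
  -- at least 1, and pays for the bad event.
  set T : ι → ℝ := fun m => 291.6 * V * (D m + Δ m) with hT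
  let Z : ι → Ω → ℝ := fun m => badᶜ.indicator fun ω => X m ω - T m
  have hZint : ∀ m, Integrable (Z m) μ := fun m =>
    ((hXint m).sub (integrable_const _)).indicator hbadm.compl
  have hgood : ∀ m ∈ M, ∀ ω ∉ bad, ∀ i, |(augPw d f (C m)).starProjection (ξ ω) i| ≤ U := by
    intro m hm ω hω i
    obtain ⟨A, hA, hi⟩ := (hC m hm).cover i
    rw [(hC m hm).starProjection_augPw_apply hA hi]
    have h1 : ω ∉ {ω | b ≤ |inner ℝ (ξ ω) (τ (A, i))|} := fun hcon => hω
      (Set.mem_biUnion (x := (A, i)) (by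
        simp only [Finset.coe_product, Set.mem_prod]
        exact ⟨Finset.mem_biUnion.2 ⟨m, hm, hA⟩, Finset.mem_coe.2 (Finset.mem_univ i)⟩) hcon)
    exact (not_le.1 h1).le.trans hU
  -- Chosen so that `IsNoise.local_tail` applies with exponent (z + T m)/q; 10.1 instead of 10 makes
  -- its hypothesis strict.
  set q : ℝ := (c * U + 10.1 * σ ^ 2) * (20 / 9) with hqdef
  have hq0 : 0 < q := by positivity
  have hZ : ∀ m ∈ M, ∫ ω, max (Z m ω) 0 ∂μ ≤ 0.03 * (324 * V) * Real.exp (-Δ m) := by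
    intro m hm
    obtain ⟨hD1, hD2⟩ := hDC m hm
    have hΔm := hΔ m hm
    have hTm : 0 ≤ T m := by simp only [hT]; positivity
    have htail : ∀ z > 0, μ.real {ω | z ≤ Z m ω} ≤
        (4 / 25 * Real.exp (-Δ m)) * Real.exp (-(z / q)) := by
      intro z hz
      have hsub : {ω | z ≤ Z m ω} ⊆ {ω | z + T m ≤ ‖(augPw d f (C m)).starProjection (ξ ω)‖ ^ 2 ∧
          ∀ i, |(augPw d f (C m)).starProjection (ξ ω) i| ≤ U} := by
        intro ω hω
        by_cases hb : ω ∈ bad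
        · have : Z m ω = 0 := Set.indicator_of_notMem (s := badᶜ) (by simpa using hb) _
          have h2 : z ≤ Z m ω := hω
          linarith
        · have : Z m ω = X m ω - T m := Set.indicator_of_mem hb _
          have h2 : z ≤ Z m ω := hω
          refine ⟨?_, hgood m hm ω hb⟩
          simp only [hX] at this
          linarith
      have hloc := h.local_tail hσ hc (augPw d f (C m)) (U := U) (y := (z + T m) / q)
        (z := z + T m) hU0 (by positivity) (by
          have h1 : z + T m = q * ((z + T m) / q) := by field_simp
          have h2 : 0 < (z + T m) / q := by positivity
          set y' := (z + T m) / q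
          rw [h1, hqdef]
          have : 0 < σ ^ 2 * y' := by positivity
          nlinarith)
      refine (measureReal_mono hsub (measure_ne_top _ _)).trans (hloc.trans ?_)
      have hfin : Module.finrank ℝ (augPw d f (C m)) ≤ 2 * Module.finrank ℝ (pw d (C m)) := by
        have h1 := finrank_augPw_le d f (C m)
        have h2 : (C m).card ≤ Module.finrank ℝ (pw d (C m)) := by
          simp only [hD] at hD1; exact_mod_cast hD1
        omega
      have h5 : (5 : ℝ) ^ Module.finrank ℝ (augPw d f (C m)) ≤ Real.exp (13 / 4 * D m) := by
        calc (5 : ℝ) ^ Module.finrank ℝ (augPw d f (C m))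
            ≤ 5 ^ (2 * Module.finrank ℝ (pw d (C m))) := pow_le_pow_right₀ (by norm_num) hfin
          _ = 25 ^ Module.finrank ℝ (pw d (C m)) := by rw [pow_mul]; norm_num
          _ ≤ Real.exp (13 / 4) ^ Module.finrank ℝ (pw d (C m)) := by
              gcongr; exact twentyfive_le_exp
          _ = _ := by rw [← Real.exp_nat_mul, mul_comm]
      -- Of the 5.15 D, the part 13/4 D offsets the net cardinality 25^D; what remains is at least
      -- 1.9, which produces the factor 4/25.
      have hTq : 5.15 * (D m + Δ m) ≤ T m / q := by
        rw [le_div_iff₀ hq0]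
        simp only [hT]
        have : 0 ≤ D m + Δ m := by linarith
        nlinarith
      calc _ ≤ Real.exp (13 / 4 * D m) * Real.exp (-((z + T m) / q)) := by gcongr
        _ = Real.exp (13 / 4 * D m - T m / q) * Real.exp (-(z / q)) := by
            rw [← Real.exp_add, ← Real.exp_add, add_div]; ring_nf
        _ ≤ Real.exp (-(19 / 10) + -Δ m) * Real.exp (-(z / q)) := by
            gcongr; linarith
        _ ≤ _ := by
            rw [Real.exp_add]
            gcongr
            exact exp_neg_bound
    have := integral_posPart_le_of_exp (hZint m) hq0 (by positivity) htail
    refine this.trans ?_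
    have h6 : q * (4 / 25) ≤ 0.03 * (324 * V) := by linarith
    calc q * (4 / 25 * Real.exp (-Δ m)) = q * (4 / 25) * Real.exp (-Δ m) := by ring
      _ ≤ _ := by gcongr
  let W₂ : Ω → ℝ := bad.indicator fun ω => ‖ξ ω‖ ^ 2
  have hW₂int : Integrable W₂ μ := h.integrable_norm_sq.indicator hbadm
  have hW₂ : ∫ ω, W₂ ω ∂μ ≤ 32.4 * V := by
    have hint1 : Integrable (fun ω => t / 2 * ‖ξ ω‖ ^ 4) μ := h.integrable_norm_pow.const_mul _
    have hint2 : Integrable (bad.indicator fun _ => 1 / (2 * t)) μ :=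
      (integrable_const _).indicator hbadm
    -- The inequality x ≤ t x²/2 + 1/(2t), with x = |ξ|², trades the fourth moment against the
    -- probability of the bad event.
    have hle : ∀ ω, W₂ ω ≤ t / 2 * ‖ξ ω‖ ^ 4 + bad.indicator (fun _ => 1 / (2 * t)) ω := by
      intro ω
      by_cases hb : ω ∈ bad
      · simp only [W₂, Set.indicator_of_mem hb]
        have h1 : t / 2 * ‖ξ ω‖ ^ 4 + 1 / (2 * t) - ‖ξ ω‖ ^ 2 = (t * ‖ξ ω‖ ^ 2 - 1) ^ 2 / (2 * t) := by
          field_simp; ring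
        have h2 : 0 ≤ (t * ‖ξ ω‖ ^ 2 - 1) ^ 2 / (2 * t) := by positivity
        linarith
      · simp only [W₂, Set.indicator_of_notMem hb]
        positivity
    refine (integral_mono hW₂int (hint1.add hint2) hle).trans ?_
    simp only [Pi.add_apply]
    rw [integral_add hint1 hint2, integral_const_mul, integral_indicator hbadm, setIntegral_const,
      smul_eq_mul]
    refine le_trans ?_ hbad
    have h1 := h.integral_norm_pow_le
    have h2 : μ.real bad * (1 / (2 * t)) ≤ 2 * (n : ℝ) ^ 3 * Real.exp (-y) * (1 / (2 * t)) := by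
      gcongr
    have h3 : t / 2 * ∫ ω, ‖ξ ω‖ ^ 4 ∂μ ≤ t / 2 * (40 * (n : ℝ) ^ 2 * (σ + c) ^ 4) := by gcongr
    have h4 : (t * (40 * (n : ℝ) ^ 2 * (σ + c) ^ 4) + 2 * (n : ℝ) ^ 3 * Real.exp (-y) / t) / 2 =
        t / 2 * (40 * (n : ℝ) ^ 2 * (σ + c) ^ 4) +
          2 * (n : ℝ) ^ 3 * Real.exp (-y) * (1 / (2 * t)) := by field_simp
    linarith
  have hsumint : Integrable (fun ω => ∑ m ∈ M, max (Z m ω) 0) μ :=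
    integrable_finsetSum _ fun m _ => (hZint m).pos_part
  have hW₃int : Integrable (fun ω => W₂ ω - 32.4 * V) μ := hW₂int.sub (integrable_const _)
  refine ⟨fun ω => ∑ m ∈ M, max (Z m ω) 0 + (W₂ ω - 32.4 * V), hsumint.add hW₃int, ?_, ?_⟩
  · rw [integral_add hsumint hW₃int,
      integral_finsetSum _ fun m _ => (hZint m).pos_part, integral_sub hW₂int (integrable_const _)]
    simp only [integral_const, probReal_univ, one_smul]
    rw [Finset.mul_sum]
    have := Finset.sum_le_sum hZ
    linarith
  · intro ω m hm
    have h1 : max (Z m ω) 0 ≤ ∑ m ∈ M, max (Z m ω) 0 :=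
      Finset.single_le_sum (f := fun m => max (Z m ω) 0) (fun _ _ => le_max_right _ _) hm
    obtain ⟨-, hD2⟩ := hDC m hm
    have hΔm := hΔ m hm
    have hX' : X m ω - T m ≤ max (Z m ω) 0 + W₂ ω := by
      by_cases hb : ω ∈ bad
      · have hW : W₂ ω = ‖ξ ω‖ ^ 2 := Set.indicator_of_mem hb _
        have h2 : X m ω ≤ ‖ξ ω‖ ^ 2 := pow_le_pow_left₀ (norm_nonneg _)
          ((augPw d f (C m)).norm_starProjection_apply_le _) 2
        have h3 : 0 ≤ T m := by simp only [hT]; positivity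
        have := le_max_right (Z m ω) 0
        linarith
      · have hW : W₂ ω = 0 := Set.indicator_of_notMem hb _
        have : Z m ω = X m ω - T m := Set.indicator_of_mem hb _
        have := le_max_left (Z m ω) 0
        linarith
    have h4 : 324 * V * (D m + Δ m) - T m ≥ 32.4 * V := by
      simp only [hT]
      nlinarith
    change X m ω - 324 * V * (D m + Δ m) ≤ _
    linarith

end

/-! ### Chaining, and expected gains over classes of cells. -/

section

variable {n : ℕ} {Ω : Type*} [MeasurableSpace Ω] {μ : Measure Ω} [IsProbabilityMeasure μ]
  {σ c Λ : ℝ} {ξ : Ω → EuclideanSpace ℝ (Fin n)}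

/-- The deviation function of the noise along unit vectors of sup norm at most `Λ`. -/
def dev (σ c Λ y : ℝ) : ℝ := σ * √(2 * y) + c * Λ * y

theorem dev_mono (hσ : 0 ≤ σ) (hc : 0 ≤ c) (hΛ : 0 ≤ Λ) {x y : ℝ} (hxy : x ≤ y) :
    dev σ c Λ x ≤ dev σ c Λ y := by
  rw [dev, dev]
  have : √(2 * x) ≤ √(2 * y) := Real.sqrt_le_sqrt (by linarith)
  gcongr

theorem dev_mul_le (hσ : 0 ≤ σ) {u y : ℝ} (hu : 1 ≤ u) :
    dev σ c Λ (u * y) ≤ u * dev σ c Λ y := by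
  have h1 : √(2 * (u * y)) ≤ u * √(2 * y) := by
    rw [show 2 * (u * y) = u * (2 * y) by ring, Real.sqrt_mul (by linarith)]
    refine mul_le_mul_of_nonneg_right ?_ (Real.sqrt_nonneg _)
    rw [Real.sqrt_le_left (by linarith)]
    nlinarith
  rw [dev, dev, mul_add]
  have : σ * √(2 * (u * y)) ≤ σ * (u * √(2 * y)) := by gcongr
  linarith

/-- In effect Cauchy–Schwarz for the vectors (σ, √(V - σ²)) and (√(2y), √κ y). -/
theorem sq_dev_le {V κ y : ℝ} (hV : σ ^ 2 ≤ V) (hκ : 0 ≤ κ)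
    (h : (c * Λ) ^ 2 ≤ κ * (V - σ ^ 2)) (hy : 0 ≤ y) :
    dev σ c Λ y ^ 2 ≤ V * (2 * y + κ * y ^ 2) := by
  have h1 : √(2 * y) ^ 2 = 2 * y := Real.sq_sqrt (by linarith)
  set w := √(2 * y)
  set e := V - σ ^ 2 with he
  have he0 : 0 ≤ e := by linarith
  have hcross : 2 * (σ * w) * (c * Λ * y) ≤ σ ^ 2 * (κ * y ^ 2) + e * w ^ 2 := by
    have h3 : 0 ≤ σ ^ 2 * (κ * y ^ 2) + e * w ^ 2 := by positivity
    refine (le_abs_self _).trans (abs_le_of_sq_le_sq ?_ h3)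
    have h4 : (σ * w) ^ 2 * y ^ 2 * (c * Λ) ^ 2 ≤ (σ * w) ^ 2 * y ^ 2 * (κ * e) := by gcongr
    nlinarith [sq_nonneg (σ ^ 2 * (κ * y ^ 2) - e * w ^ 2)]
  have hVe : V = σ ^ 2 + e := by rw [he]; ring
  have h2 : (c * Λ * y) ^ 2 ≤ κ * e * y ^ 2 := by
    rw [mul_pow]; gcongr
  rw [dev, hVe]
  calc (σ * w + c * Λ * y) ^ 2 = σ ^ 2 * w ^ 2 + 2 * (σ * w) * (c * Λ * y) + (c * Λ * y) ^ 2 := by ring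
    _ ≤ σ ^ 2 * w ^ 2 + (σ ^ 2 * (κ * y ^ 2) + e * w ^ 2) + κ * e * y ^ 2 := by gcongr
    _ = _ := by rw [h1]; ring

/-- The price of chaining with ratio 8 when the deviation at step k is inflated by 1 + 0.3 k. The
subtracted remainder makes the induction close. -/
theorem sum_geom_weights_le (J : ℕ) : ∑ i ∈ Finset.range J, (1 + 0.3 * (i : ℝ)) / 8 ^ i ≤
    1.2 - (1.2 + 0.35 * (J : ℝ)) / 8 ^ J := by
  induction J with
  | zero => norm_num
  | succ J ih =>
    rw [Finset.sum_range_succ]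
    have h8 : (0 : ℝ) < 8 ^ J := by positivity
    have : (1.2 + 0.35 * (J : ℝ)) / 8 ^ J - (1.2 + 0.35 * ((J + 1 : ℕ) : ℝ)) / 8 ^ (J + 1) -
        (1 + 0.3 * (J : ℝ)) / 8 ^ J = (0.05 + 0.05 * J) / (8 * 8 ^ J) := by
      rw [pow_succ]; push_cast; field_simp; ring
    have h2 : 0 ≤ (0.05 + 0.05 * (J : ℝ)) / (8 * 8 ^ J) := by positivity
    linarith

/-- Chaining bound for a finite family of directions with controlled separation numbers. -/
theorem IsNoise.chaining {ι : Type*} (h : IsNoise μ σ c ξ) (hσ : 0 < σ) (hc : 0 < c) (hΛ : 0 < Λ)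
    {S₀ : Submodule ℝ (EuclideanSpace ℝ (Fin n))} (hS₀ : ∀ v ∈ S₀, ∀ i, |v i| ≤ Λ * ‖v‖)
    (T : Finset ι) (v : ι → EuclideanSpace ℝ (Fin n)) (hv : ∀ t ∈ T, v t ∈ S₀) {R H y : ℝ}
    (hR : 0 < R) (hvR : ∀ t ∈ T, ‖v t‖ ≤ R) (hH : 0 ≤ H) (hy : 0 < y)
    (hsep : ∀ k : ℕ, ∀ N ⊆ T, (∀ t ∈ N, ∀ u ∈ N, t ≠ u → R / 8 ^ (k + 1) ≤ ‖v t - v u‖) →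
      (N.card : ℝ) ≤ Real.exp (H * (1 + 0.3 * k) - (k + 1))) :
    μ.real {ω | ∃ t ∈ T, 1.2 * R * dev σ c Λ (H + y) ≤ inner ℝ (ξ ω) (v t)} ≤ Real.exp (-y) := by
  classical
  choose N hNT hNsep hNcov using fun k : ℕ =>
    exists_separated_net T v (R / 8 ^ (k + 1)) (by positivity)
  have hN : ∀ k t, ∃ u, t ∈ T → u ∈ N k ∧ ‖v t - v u‖ < R / 8 ^ (k + 1) := by
    intro k t
    by_cases ht : t ∈ T
    · obtain ⟨u, hu, htu⟩ := hNcov k t ht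
      exact ⟨u, fun _ => ⟨hu, htu⟩⟩
    · exact ⟨t, fun h => absurd h ht⟩
  choose π hπ using hN
  -- The family is finite, so at a fine enough scale the nearest net point carries the same vector
  -- and the chain ends exactly.
  have hJ : ∃ J : ℕ, ∀ t ∈ T, ∀ u ∈ T, ‖v t - v u‖ < R / 8 ^ (J + 1) → v t = v u := by
    have hev : ∀ᶠ J : ℕ in Filter.atTop, ∀ t ∈ T, ∀ u ∈ T,
        ‖v t - v u‖ < R / 8 ^ (J + 1) → v t = v u := by
      refine (Filter.eventually_all_finset T).2 fun t _ => (Filter.eventually_all_finset T).2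
        fun u _ => ?_
      by_cases htu : v t = v u
      · exact Filter.Eventually.of_forall fun _ _ => htu
      · have hpos : 0 < ‖v t - v u‖ := norm_pos_iff.2 (sub_ne_zero.2 htu)
        have hlim : Filter.Tendsto (fun J : ℕ => R / 8 ^ (J + 1)) Filter.atTop (nhds 0) := by
          have h1 := (tendsto_pow_atTop_nhds_zero_of_lt_one (r := (1 / 8 : ℝ)) (by norm_num)
            (by norm_num)).const_mul R
          rw [mul_zero] at h1
          refine ((Filter.tendsto_add_atTop_iff_nat 1).2 h1).congr fun J => ?_
          rw [one_div, inv_pow]; rfl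
        filter_upwards [hlim.eventually (gt_mem_nhds hpos)] with J hJ hcon
        linarith
    exact hev.exists
  obtain ⟨J, hJ⟩ := hJ
  -- Links of the chains from each net to the next coarser one. The net of index 0 already has mesh
  -- R/8; its links are the vectors themselves, of norm at most R.
  let ρ : ℕ → ι → EuclideanSpace ℝ (Fin n) := fun k u =>
    match k with
    | 0 => v u
    | k + 1 => v u - v (π k u)
  have hρn : ∀ k, ∀ u ∈ N k, ‖ρ k u‖ ≤ R / 8 ^ k := by
    intro k u hu
    cases k with
    | zero => simpa [ρ] using hvR u (hNT 0 hu)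
    | succ k => exact (hπ k u (hNT _ hu)).2.le
  have hρS : ∀ k, ∀ u ∈ N k, ρ k u ∈ S₀ := by
    intro k u hu
    cases k with
    | zero => exact hv u (hNT 0 hu)
    | succ k => exact S₀.sub_mem (hv u (hNT _ hu)) (hv _ (hNT k (hπ k u (hNT _ hu)).1))
  -- In these exponents the part proportional to H cancels the cardinality bound of the net, leaving
  -- at most exp(-y) exp(-(k + 1)) at level k; these sum to at most exp(-y).
  let x : ℕ → ℝ := fun k => (1 + 0.3 * k) * (H + y)
  have hx0 : ∀ k, 0 ≤ x k := fun k => by positivity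
  let bad : Set Ω := ⋃ k ∈ Finset.range (J + 1), ⋃ u ∈ N k,
    {ω | R / 8 ^ k * dev σ c Λ (x k) ≤ inner ℝ (ξ ω) (ρ k u)}
  have hsub : {ω | ∃ t ∈ T, 1.2 * R * dev σ c Λ (H + y) ≤ inner ℝ (ξ ω) (v t)} ⊆ bad := by
    rintro ω ⟨t, ht, hωt⟩
    by_contra hcon
    simp only [bad, Set.mem_iUnion, not_exists, exists_prop, not_and, Finset.mem_range] at hcon
    have hcon' : ∀ k < J + 1, ∀ u ∈ N k,
        inner ℝ (ξ ω) (ρ k u) ≤ R / 8 ^ k * dev σ c Λ (x k) := fun k hk u hu =>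
      (not_le.1 (hcon k hk u hu)).le
    have key : ∀ k < J + 1, ∀ u ∈ N k, inner ℝ (ξ ω) (v u) ≤
        ∑ i ∈ Finset.range (k + 1), R / 8 ^ i * dev σ c Λ (x i) := by
      intro k
      induction k with
      | zero =>
        intro hk u hu
        simpa [ρ] using hcon' 0 hk u hu
      | succ k ih =>
        intro hk u hu
        have h1 := hcon' (k + 1) hk u hu
        have h2 := ih (by omega) (π k u) (hπ k u (hNT _ hu)).1
        rw [Finset.sum_range_succ]
        simp only [ρ, inner_sub_right] at h1
        linarith
    have h1 := key J (by omega) (π J t) (hπ J t ht).1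
    rw [← hJ t ht _ (hNT J (hπ J t ht).1) (hπ J t ht).2] at h1
    have hdev : 0 < dev σ c Λ (H + y) := by rw [dev]; positivity
    have h2 : ∑ i ∈ Finset.range (J + 1), R / 8 ^ i * dev σ c Λ (x i) ≤
        (∑ i ∈ Finset.range (J + 1), (1 + 0.3 * (i : ℝ)) / 8 ^ i) * (R * dev σ c Λ (H + y)) := by
      rw [Finset.sum_mul]
      refine Finset.sum_le_sum fun i _ => ?_
      have h3 : dev σ c Λ (x i) ≤ (1 + 0.3 * (i : ℝ)) * dev σ c Λ (H + y) :=
        dev_mul_le hσ.le (by have : (0 : ℝ) ≤ i := by positivity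
                             linarith)
      calc R / 8 ^ i * dev σ c Λ (x i) ≤ R / 8 ^ i * ((1 + 0.3 * (i : ℝ)) * dev σ c Λ (H + y)) := by
            gcongr
        _ = _ := by ring
    have h4 := sum_geom_weights_le (J + 1)
    have h5 : 0 < (1.2 + 0.35 * ((J + 1 : ℕ) : ℝ)) / 8 ^ (J + 1) := by positivity
    have h6 : 0 < R * dev σ c Λ (H + y) := by positivity
    nlinarith
  refine (measureReal_mono hsub (measure_ne_top _ _)).trans ?_
  calc μ.real bad ≤ ∑ k ∈ Finset.range (J + 1), μ.real (⋃ u ∈ N k,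
        {ω | R / 8 ^ k * dev σ c Λ (x k) ≤ inner ℝ (ξ ω) (ρ k u)}) :=
        measureReal_biUnion_finset_le _ _
    _ ≤ ∑ k ∈ Finset.range (J + 1), ∑ u ∈ N k,
        μ.real {ω | R / 8 ^ k * dev σ c Λ (x k) ≤ inner ℝ (ξ ω) (ρ k u)} :=
        Finset.sum_le_sum fun k _ => measureReal_biUnion_finset_le _ _
    _ ≤ ∑ k ∈ Finset.range (J + 1), ∑ _u ∈ N k, Real.exp (-(x k)) := by
        refine Finset.sum_le_sum fun k _ => Finset.sum_le_sum fun u hu => ?_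
        have h1 := h.tail (ρ k u) (R / 8 ^ k) (Λ * (R / 8 ^ k)) (x k) (by positivity)
          (by positivity) (hx0 k) (hρn k u hu) fun i => (hS₀ _ (hρS k u hu) i).trans (by
            gcongr; exact hρn k u hu)
        refine le_of_eq_of_le ?_ h1
        congr 1
        ext ω
        rw [dev]
        simp only [Set.mem_ofPred_eq]
        ring_nf
    _ ≤ ∑ k ∈ Finset.range (J + 1), Real.exp (-y) * (1 / 2) ^ (k + 1) := by
        refine Finset.sum_le_sum fun k _ => ?_
        rw [Finset.sum_const, nsmul_eq_mul]
        calc ((N k).card : ℝ) * Real.exp (-(x k))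
            ≤ Real.exp (H * (1 + 0.3 * k) - (k + 1)) * Real.exp (-(x k)) := by
              gcongr; exact hsep k (N k) (hNT k) (hNsep k)
          _ = Real.exp (-((1 + 0.3 * (k : ℝ)) * y)) * Real.exp (-1) ^ (k + 1) := by
              rw [← Real.exp_nat_mul, ← Real.exp_add, ← Real.exp_add]
              simp only [x]; push_cast; ring_nf
          _ ≤ _ := by
              gcongr
              · have : 0 ≤ (k : ℝ) * y := by positivity
                linarith
              · have := Real.exp_neg_one_lt_d9; linarith
    _ ≤ Real.exp (-y) := by
        rw [← Finset.mul_sum]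
        have h1 : ∀ J : ℕ, ∑ k ∈ Finset.range J, (1 / 2 : ℝ) ^ (k + 1) = 1 - (1 / 2) ^ J := by
          intro J
          induction J with
          | zero => simp
          | succ J ih => rw [Finset.sum_range_succ, ih, pow_succ]; ring
        rw [h1]
        have h2 : (0 : ℝ) ≤ (1 / 2) ^ (J + 1) := by positivity
        nlinarith [Real.exp_pos (-y)]

/-- The positive part of the maximum of a finite family. -/
def supPos {ι : Type*} (T : Finset ι) (G : ι → Ω → ℝ) (ω : Ω) : ℝ :=
  ((T.sup fun i => (G i ω).toNNReal : NNReal) : ℝ)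

theorem supPos_nonneg {ι : Type*} (T : Finset ι) (G : ι → Ω → ℝ) (ω : Ω) : 0 ≤ supPos T G ω :=
  NNReal.coe_nonneg _

theorem le_supPos {ι : Type*} {T : Finset ι} (G : ι → Ω → ℝ) {i : ι} (hi : i ∈ T) (ω : Ω) :
    G i ω ≤ supPos T G ω := by
  refine (Real.le_coe_toNNReal _).trans (NNReal.coe_le_coe.2 ?_)
  exact Finset.le_sup (f := fun i => (G i ω).toNNReal) hi

theorem exists_le_of_le_supPos {ι : Type*} {T : Finset ι} {G : ι → Ω → ℝ} {z : ℝ} (hz : 0 < z)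
    {ω : Ω} (h : z ≤ supPos T G ω) : ∃ i ∈ T, z ≤ G i ω := by
  have h1 : z.toNNReal ≤ T.sup fun i => (G i ω).toNNReal := by
    rw [Real.toNNReal_le_iff_le_coe]; exact h
  rw [Finset.le_sup_iff (by simpa using hz)] at h1
  obtain ⟨i, hi, hle⟩ := h1
  refine ⟨i, hi, ?_⟩
  by_contra hcon
  push Not at hcon
  exact absurd ((Real.toNNReal_lt_toNNReal_iff hz).2 hcon) (not_lt.2 hle)

theorem integrable_supPos {ι : Type*} (T : Finset ι) {G : ι → Ω → ℝ}
    (hm : ∀ i, Measurable (G i)) (hG : ∀ i, Integrable (G i) μ) : Integrable (supPos T G) μ := by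
  classical
  have hmeas : Measurable (supPos T G) := by
    refine Measurable.coe_nnreal_real ?_
    induction T using Finset.induction_on with
    | empty => simp
    | insert a s ha ih =>
      simp_rw [Finset.sup_insert]
      exact (hm a).real_toNNReal.sup ih
  refine (integrable_finsetSum T fun i _ => (hG i).abs).mono' hmeas.aestronglyMeasurable
    (Filter.Eventually.of_forall fun ω => ?_)
  rw [Real.norm_of_nonneg (supPos_nonneg _ _ _)]
  by_contra hcon
  push Not at hcon
  have h0 : 0 ≤ ∑ i ∈ T, |G i ω| := Finset.sum_nonneg fun _ _ => abs_nonneg _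
  obtain ⟨i, hi, hle⟩ := exists_le_of_le_supPos (lt_of_le_of_lt h0 hcon) le_rfl
  have h1 := Finset.single_le_sum (f := fun i => |G i ω|) (fun _ _ => abs_nonneg _) hi
  have h2 := le_abs_self (G i ω)
  linarith

theorem integral_supPos_le {ι : Type*} (T : Finset ι) {G : ι → Ω → ℝ}
    (hm : ∀ i, Measurable (G i)) (hG : ∀ i, Integrable (G i) μ) {M y : ℝ} (hM : 0 < M) (hy : 4 ≤ y)
    (htail : ∀ u > 1, μ.real {ω | ∃ i ∈ T, (u ^ 2 - 1) * M ≤ G i ω} ≤ Real.exp (-(y * u))) :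
    ∫ ω, supPos T G ω ∂μ ≤ M * Real.exp (-y) := by
  have h := integral_posPart_le_of_sqrt (integrable_supPos (μ := μ) T hm hG) hM hy fun u hu => by
    refine le_trans (measureReal_mono ?_ (measure_ne_top _ _)) (htail u hu)
    intro ω hω
    exact exists_le_of_le_supPos (mul_pos (by nlinarith) hM) hω
  refine le_of_eq_of_le ?_ h
  exact integral_congr_ae (Filter.Eventually.of_forall fun ω =>
    (max_eq_left (supPos_nonneg T G ω)).symm)

/-- The gain at a cell: fluctuation minus nine tenths of the cost of the cell. -/
def gain (ξ : Ω → EuclideanSpace ℝ (Fin n)) (d : ℕ) (f : EuclideanSpace ℝ (Fin n)) (α τ : ℝ)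
    (A : Finset (Fin n)) (ω : Ω) : ℝ :=
  -2 * inner ℝ (ξ ω) (res d A f) - 0.9 * (α * rss d f A + τ)

namespace IsNoise

variable {d : ℕ} {f : EuclideanSpace ℝ (Fin n)} {α τ : ℝ}

theorem measurable_gain (h : IsNoise μ σ c ξ) (A : Finset (Fin n)) :
    Measurable (gain ξ d f α τ A) := by
  have := h.measurable
  unfold gain
  fun_prop

theorem integrable_gain (h : IsNoise μ σ c ξ) (A : Finset (Fin n)) :
    Integrable (gain ξ d f α τ A) μ :=
  ((h.integrable_inner _).const_mul _).sub (integrable_const _)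

/-- With R the norm of the residual, 2Ru√(ατ) ≤ αR² + u²τ. A gain above (u² - 1) 0.9 τ therefore
forces a fluctuation of at least R u dev(y) ≥ R dev(uy), which has probability at most exp(-yu). -/
theorem integral_supPos_singleton_le (h : IsNoise μ σ c ξ) (hσ : 0 < σ) (hΛ : 0 < Λ)
    {S₀ : Submodule ℝ (EuclideanSpace ℝ (Fin n))} (hS₀ : ∀ v ∈ S₀, ∀ i, |v i| ≤ Λ * ‖v‖)
    (hα : 0 < α) (hτ : 0 < τ) {A : Finset (Fin n)} (hA : res d A f ∈ S₀) (hpos : 0 < rss d f A)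
    {y : ℝ} (hy : 4 ≤ y) (hdev : dev σ c Λ y ^ 2 ≤ 0.81 * (α * τ)) :
    ∫ ω, supPos {A} (gain ξ d f α τ) ω ∂μ ≤ 0.9 * τ * Real.exp (-y) := by
  refine integral_supPos_le {A} h.measurable_gain h.integrable_gain (by positivity) hy fun u hu => ?_
  set R := ‖res d A f‖ with hR
  have hRF : rss d f A = R ^ 2 := rfl
  have hR0 : 0 < R := by
    refine lt_of_le_of_ne (norm_nonneg _) fun h0 => ?_
    rw [hRF, ← h0] at hpos
    simp at hpos
  have ht := h.tail (-res d A f) R (Λ * R) (y * u) hR0 (by positivity) (by nlinarith)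
    (by rw [norm_neg]) fun i => by
      rw [PiLp.neg_apply, abs_neg]; exact hS₀ _ hA i
  refine le_trans (measureReal_mono ?_ (measure_ne_top _ _)) ht
  rintro ω ⟨B, hB, hω⟩
  rw [Finset.mem_singleton] at hB
  subst hB
  rw [gain, hRF] at hω
  change R * σ * √(2 * (y * u)) + c * (Λ * R) * (y * u) ≤ inner ℝ (ξ ω) (-res d B f)
  rw [inner_neg_right]
  have h1 : R * σ * √(2 * (y * u)) + c * (Λ * R) * (y * u) = R * dev σ c Λ (u * y) := by
    rw [dev, mul_comm y u]; ring
  rw [h1]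
  have h2 : R * dev σ c Λ (u * y) ≤ R * (u * dev σ c Λ y) := by
    gcongr; exact dev_mul_le hσ.le hu.le
  have h3 : dev σ c Λ y ≤ 0.9 * √(α * τ) := by
    have h4 : √(α * τ) ^ 2 = α * τ := Real.sq_sqrt (by positivity)
    refine (le_abs_self _).trans (abs_le_of_sq_le_sq ?_ (by positivity))
    nlinarith
  have h5 : 2 * (R * u * √(α * τ)) ≤ α * R ^ 2 + u ^ 2 * τ := by
    rw [Real.sqrt_mul hα.le]
    have h6 : √α ^ 2 = α := Real.sq_sqrt hα.le
    have h7 : √τ ^ 2 = τ := Real.sq_sqrt hτ.le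
    have h8 := sq_nonneg (√α * R - u * √τ)
    nlinarith
  have h6 : R * (u * dev σ c Λ y) ≤ R * (u * (0.9 * √(α * τ))) := by gcongr
  nlinarith

/-- All costs in the class are at least αY + τ. Since 0.9(αY + τ) ≤ (u + 1)M, a gain above (u² - 1)M
forces a fluctuation of at least u · 0.9(αY + τ), which chaining at radius √(2Y) makes unlikely. -/
theorem integral_supPos_class_le (h : IsNoise μ σ c ξ) (hσ : 0 < σ) (hc : 0 < c) (hΛ : 0 < Λ)
    {S₀ : Submodule ℝ (EuclideanSpace ℝ (Fin n))} (hS₀ : ∀ v ∈ S₀, ∀ i, |v i| ≤ Λ * ‖v‖)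
    (hα : 0 < α) (hτ : 0 < τ) (T : Finset (Finset (Fin n))) (hT : ∀ A ∈ T, res d A f ∈ S₀)
    {Y H M y : ℝ} (hY : 0 < Y) (hTY : ∀ A ∈ T, Y ≤ rss d f A ∧ rss d f A ≤ 2 * Y) (hH : 0 ≤ H)
    (hy : 4 ≤ y) (hM : 0.9 * (α * Y + τ) ≤ 2 * M)
    (hdev : 2.4 * √(2 * Y) * dev σ c Λ (H + y) ≤ 0.9 * (α * Y + τ))
    (hsep : ∀ k : ℕ, ∀ N ⊆ T, (∀ A ∈ N, ∀ B ∈ N, A ≠ B →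
      √(2 * Y) / 8 ^ (k + 1) ≤ ‖res d A f - res d B f‖) →
      (N.card : ℝ) ≤ Real.exp (H * (1 + 0.3 * k) - (k + 1))) :
    ∫ ω, supPos T (gain ξ d f α τ) ω ∂μ ≤ M * Real.exp (-y) := by
  have hM0 : 0 < M := by
    have : 0 < α * Y + τ := by positivity
    linarith
  refine integral_supPos_le T h.measurable_gain h.integrable_gain hM0 hy fun u hu => ?_
  have hch := h.chaining (y := y * u) hσ hc hΛ hS₀ T (fun A => -res d A f)
    (fun A hA => S₀.neg_mem (hT A hA)) (R := √(2 * Y)) (by positivity)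
    (fun A hA => by
      rw [norm_neg]
      exact Real.le_sqrt_of_sq_le (hTY A hA).2) hH (by nlinarith)
    (fun k N hN hs => hsep k N hN fun A hA B hB hAB => by
      have := hs A hA B hB hAB
      rwa [neg_sub_neg, norm_sub_rev] at this)
  refine le_trans (measureReal_mono ?_ (measure_ne_top _ _)) hch
  rintro ω ⟨A, hA, hω⟩
  refine ⟨A, hA, ?_⟩
  rw [inner_neg_right]
  rw [gain] at hω
  have h1 : dev σ c Λ (H + y * u) ≤ u * dev σ c Λ (H + y) := by
    refine (dev_mono hσ.le hc.le hΛ.le ?_).trans (dev_mul_le hσ.le hu.le)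
    nlinarith
  have h2 : 1.2 * √(2 * Y) * dev σ c Λ (H + y * u) ≤
      1.2 * √(2 * Y) * (u * dev σ c Λ (H + y)) := by gcongr
  have h3 : α * Y ≤ α * rss d f A := by gcongr; exact (hTY A hA).1
  have h4 : u * (2.4 * √(2 * Y) * dev σ c Λ (H + y)) ≤ u * (0.9 * (α * Y + τ)) := by gcongr
  have h5 : (u - 1) * (0.9 * (α * Y + τ)) ≤ (u - 1) * ((u + 1) * M) := by
    refine mul_le_mul_of_nonneg_left (hM.trans ?_) (by linarith)
    nlinarith
  nlinarith

/-- Combination of the classes. -/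
theorem exists_gain_bound {κ : Type*} (h : IsNoise μ σ c ξ) (hτ : 0 ≤ τ)
    (𝒞 : Finset (Finset (Finset (Fin n)))) (K : Finset κ)
    (T : κ → Finset (Finset (Fin n)))
    (hcls : ∀ C ∈ 𝒞, ∃ e : Finset (Fin n) → κ, (∀ A ∈ C, 0 < rss d f A → e A ∈ K ∧ A ∈ T (e A)) ∧
      ∀ A ∈ C, ∀ B ∈ C, 0 < rss d f A → 0 < rss d f B → e A = e B → A = B)
    (hsum : ∀ C ∈ 𝒞, ∑ k ∈ K, ∫ ω, supPos (T k) (gain ξ d f α τ) ω ∂μ ≤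
      0.1 * ∑ A ∈ C, (α * rss d f A + τ)) :
    ∃ W : Ω → ℝ, Integrable W μ ∧ ∫ ω, W ω ∂μ ≤ 0 ∧ ∀ ω, ∀ C ∈ 𝒞,
      ∑ A ∈ C, (-2 * inner ℝ (ξ ω) (res d A f) - α * rss d f A - τ) ≤ W ω := by
  classical
  rcases 𝒞.eq_empty_or_nonempty with rfl | hne
  · exact ⟨0, integrable_zero _ _ _, by simp, by simp⟩
  -- The tenth of the cost left out of `gain` centres W: the smallest total cost dominates the
  -- expected suprema and is below the cost of every other family.
  obtain ⟨C₀, hC₀, hmin⟩ := 𝒞.exists_min_image (fun C => ∑ A ∈ C, (α * rss d f A + τ)) hne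
  have hint : ∀ k, Integrable (supPos (T k) (gain ξ d f α τ)) μ := fun k =>
    integrable_supPos _ h.measurable_gain h.integrable_gain
  have hint' : Integrable (fun ω => ∑ k ∈ K, supPos (T k) (gain ξ d f α τ) ω) μ :=
    integrable_finsetSum _ fun k _ => hint k
  refine ⟨fun ω => ∑ k ∈ K, supPos (T k) (gain ξ d f α τ) ω - 0.1 * ∑ A ∈ C₀, (α * rss d f A + τ),
    hint'.sub (integrable_const _), ?_, ?_⟩
  · rw [integral_sub hint' (integrable_const _), integral_finsetSum _ fun k _ => hint k]
    simp only [integral_const, probReal_univ, one_smul]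
    have := hsum C₀ hC₀
    linarith
  · intro ω C hC
    obtain ⟨e, he, hinj⟩ := hcls C hC
    -- Cells with zero residual have nonpositive gain, and the other cells of a family occupy
    -- distinct classes.
    have h1 : ∑ A ∈ C, gain ξ d f α τ A ω ≤ ∑ k ∈ K, supPos (T k) (gain ξ d f α τ) ω := by
      calc ∑ A ∈ C, gain ξ d f α τ A ω
          ≤ ∑ A ∈ C.filter fun A => 0 < rss d f A, gain ξ d f α τ A ω := by
            rw [← Finset.sum_filter_add_sum_filter_not C fun A => 0 < rss d f A]
            have : ∑ A ∈ C.filter (fun A => ¬ 0 < rss d f A), gain ξ d f α τ A ω ≤ 0 := by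
              refine Finset.sum_nonpos fun A hA => ?_
              have h0 : rss d f A = 0 :=
                le_antisymm (not_lt.1 (Finset.mem_filter.1 hA).2) (rss_nonneg _ _ _)
              have h2 : res d A f = 0 := by
                rw [rss] at h0; exact norm_eq_zero.1 (pow_eq_zero_iff two_ne_zero |>.1 h0)
              rw [gain, h0, h2, inner_zero_right]
              linarith
            linarith
        _ ≤ _ := by
            refine sum_le_sum_of_injOn e (fun k _ => supPos_nonneg _ _ _)
              (fun A hA => (he A (Finset.mem_filter.1 hA).1 (Finset.mem_filter.1 hA).2).1) ?_
              (fun A hA => le_supPos (gain ξ d f α τ)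
                (he A (Finset.mem_filter.1 hA).1 (Finset.mem_filter.1 hA).2).2 ω)
            intro A hA B hB hAB
            have hA' := Finset.mem_filter.1 (Finset.mem_coe.1 hA)
            have hB' := Finset.mem_filter.1 (Finset.mem_coe.1 hB)
            exact hinj A hA'.1 B hB'.1 hA'.2 hB'.2 hAB
    have h2 : ∑ A ∈ C, (-2 * inner ℝ (ξ ω) (res d A f) - α * rss d f A - τ) =
        ∑ A ∈ C, gain ξ d f α τ A ω - 0.1 * ∑ A ∈ C, (α * rss d f A + τ) := by
      rw [Finset.mul_sum, ← Finset.sum_sub_distrib]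
      refine Finset.sum_congr rfl fun A _ => ?_
      rw [gain]; ring
    have h3 := hmin C hC
    rw [h2]
    linarith

end IsNoise

end

/-! ### Doubling of polynomials and a discrete Hilbert inequality. -/

section

/-- A bound for the Lebesgue function of equispaced interpolation, outside the interval. -/
def lebesgueConst (d : ℕ) : ℝ := (6 * ((d : ℝ) + 1)) ^ d / d.factorial

/-- The doubling constant of polynomials of degree at most `d`. -/
def doublingConst (d : ℕ) : ℝ := 2 * ((d : ℝ) + 1) ^ 2 * lebesgueConst d ^ 2

theorem one_le_lebesgueConst (d : ℕ) : 1 ≤ lebesgueConst d := by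
  rw [lebesgueConst, one_le_div (by positivity)]
  calc (d.factorial : ℝ) ≤ (d : ℝ) ^ d := by exact_mod_cast Nat.factorial_le_pow d
    _ ≤ _ := by gcongr; linarith [(Nat.cast_nonneg d : (0 : ℝ) ≤ d)]

theorem one_le_doublingConst (d : ℕ) : 1 ≤ doublingConst d := by
  have h1 := one_le_lebesgueConst d
  have h2 : (0 : ℝ) ≤ d := Nat.cast_nonneg d
  rw [doublingConst]
  have h3 : 1 ≤ lebesgueConst d ^ 2 := one_le_pow₀ h1
  nlinarith

theorem prod_erase_abs_sub (d j : ℕ) (hj : j ≤ d) :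
    ∏ k ∈ (Finset.range (d + 1)).erase j, |(j : ℝ) - k| = j.factorial * (d - j).factorial := by
  induction d with
  | zero =>
    obtain rfl : j = 0 := by omega
    simp
  | succ d ih =>
    rcases Nat.lt_or_ge d j with h | h
    · obtain rfl : j = d + 1 := by omega
      have h1 : (Finset.range (d + 1 + 1)).erase (d + 1) = Finset.range (d + 1) := by
        ext k; simp; omega
      rw [h1, Nat.sub_self, Nat.factorial_zero, Nat.cast_one, mul_one,
        ← Finset.prod_range_add_one_eq_factorial, ← Finset.prod_range_reflect]
      push_cast
      refine Finset.prod_congr rfl fun k hk => ?_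
      have hk' : k < d + 1 := Finset.mem_range.1 hk
      have hkd : k ≤ d := Nat.lt_succ_iff.1 hk'
      have hkd' : (k : ℝ) ≤ d := by exact_mod_cast hkd
      rw [Nat.cast_sub hkd, abs_of_nonneg (by linarith)]
      ring
    · have h1 : (Finset.range (d + 1 + 1)).erase j =
          insert (d + 1) ((Finset.range (d + 1)).erase j) := by
        ext k; simp; omega
      rw [h1, Finset.prod_insert (by simp), ih h, Nat.succ_sub h, Nat.factorial_succ]
      have : (j : ℝ) ≤ d := by exact_mod_cast h
      rw [abs_sub_comm, abs_of_nonneg (by push_cast; linarith)]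
      push_cast [Nat.cast_sub h]
      ring

-- Lagrange interpolation at the nodes 0, h, …, dh with h = ⌊N/(d + 1)⌋. The pointwise grid
-- inequality bounds the node values, and t + kh ≤ 3(d + 1)h bounds the basis polynomials; summing
-- them produces a binomial sum 2^d, hence the 6 in `lebesgueConst`.
open Polynomial in
theorem sq_eval_neg_le (d : ℕ) (q : ℝ[X]) (hq : q.natDegree ≤ d) (N t : ℕ) (hN : d + 1 ≤ N)
    (ht : t ≤ N) : q.eval (-(t : ℝ)) ^ 2 ≤
      lebesgueConst d ^ 2 * (2 * ((d : ℝ) + 1) ^ 2 / N * ∑ j ∈ Finset.range N, q.eval (j : ℝ) ^ 2) := by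
  set h := N / (d + 1) with hh
  have hh1 : 1 ≤ h := Nat.div_pos hN (by omega)
  have hle : h * (d + 1) ≤ N := Nat.div_mul_le_self N (d + 1)
  have hlt : N < (h + 1) * (d + 1) := by
    rw [hh, mul_comm]; exact Nat.lt_mul_div_succ N (by omega)
  have hN2 : N ≤ 2 * (h * (d + 1)) := by nlinarith
  set E := 2 * ((d : ℝ) + 1) ^ 2 / N * ∑ j ∈ Finset.range N, q.eval (j : ℝ) ^ 2 with hE
  have hE0 : 0 ≤ E := by
    have : 0 ≤ ∑ j ∈ Finset.range N, q.eval (j : ℝ) ^ 2 := Finset.sum_nonneg fun _ _ => sq_nonneg _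
    positivity
  have hh0 : (0 : ℝ) < h := by exact_mod_cast hh1
  have hnode : ∀ j ≤ d, |q.eval ((j * h : ℕ) : ℝ)| ≤ √E := by
    intro j hj
    have h1 : j * h ≤ N - 1 := by
      have : j * h ≤ d * h := Nat.mul_le_mul_right h hj
      have : d * h + h ≤ N := by nlinarith
      omega
    have h2 := sq_eval_le_sum_Icc d q hq 0 (N - 1) (j * h) (Nat.zero_le _) h1
    have h3 : Finset.Icc 0 (N - 1) = Finset.range N := by ext k; simp; omega
    have h4 : (((N - 1 : ℕ) : ℝ) - ((0 : ℕ) : ℝ) + 1) = N := by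
      rw [Nat.cast_sub (by omega)]; simp
    rw [h3, h4] at h2
    exact Real.le_sqrt_of_sq_le (by rw [sq_abs]; exact h2)
  set v : ℕ → ℝ := fun j => ((j * h : ℕ) : ℝ) with hv
  have hinj : Set.InjOn v (Finset.range (d + 1) : Finset ℕ) := by
    intro a _ b _ hab
    simp only [hv] at hab
    have : a * h = b * h := by exact_mod_cast hab
    exact Nat.eq_of_mul_eq_mul_right hh1 this
  have hdeg : q.degree < (Finset.range (d + 1)).card := by
    refine lt_of_le_of_lt (degree_le_of_natDegree_le hq) ?_
    rw [Finset.card_range]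
    exact_mod_cast Nat.lt_succ_self d
  have hint := Lagrange.eq_interpolate hinj hdeg
  have hbasis : ∀ j ∈ Finset.range (d + 1),
      |(Lagrange.basis (Finset.range (d + 1)) v j).eval (-(t : ℝ))| ≤
        (3 * ((d : ℝ) + 1)) ^ d / (j.factorial * (d - j).factorial) := by
    intro j hj
    have hj' : j ≤ d := Nat.lt_succ_iff.1 (Finset.mem_range.1 hj)
    rw [Lagrange.basis, eval_prod, Finset.abs_prod, ← prod_erase_abs_sub d j hj']
    have hcard : ((Finset.range (d + 1)).erase j).card = d := by
      rw [Finset.card_erase_of_mem hj, Finset.card_range]; rfl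
    have h1 : (3 * ((d : ℝ) + 1)) ^ d / ∏ k ∈ (Finset.range (d + 1)).erase j, |(j : ℝ) - k| =
        ∏ k ∈ (Finset.range (d + 1)).erase j, (3 * ((d : ℝ) + 1)) / |(j : ℝ) - k| := by
      rw [Finset.prod_div_distrib, Finset.prod_const, hcard]
    rw [h1]
    refine Finset.prod_le_prod (fun _ _ => abs_nonneg _) fun k hk => ?_
    obtain ⟨hkj, hk'⟩ := Finset.mem_erase.1 hk
    have hk'' : k ≤ d := Nat.lt_succ_iff.1 (Finset.mem_range.1 hk')
    rw [Lagrange.basisDivisor, eval_mul, eval_C, eval_sub, eval_X, eval_C, abs_mul, abs_inv]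
    have h2 : |v j - v k| = |(j : ℝ) - k| * h := by
      simp only [hv]; push_cast
      rw [← sub_mul, abs_mul, abs_of_pos hh0]
    have h3 : |-(t : ℝ) - v k| ≤ 3 * ((d : ℝ) + 1) * h := by
      have h4 : t + k * h ≤ 3 * (d + 1) * h := by nlinarith
      have h5 : ((t + k * h : ℕ) : ℝ) ≤ ((3 * (d + 1) * h : ℕ) : ℝ) := by exact_mod_cast h4
      push_cast at h5
      simp only [hv]; push_cast
      rw [← neg_add', abs_neg, abs_of_nonneg (by positivity)]
      linarith
    have h6 : 0 < |(j : ℝ) - k| := abs_pos.2 (sub_ne_zero.2 fun h => hkj (by exact_mod_cast h.symm))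
    rw [h2, inv_mul_eq_div, div_le_div_iff₀ (by positivity) h6]
    nlinarith
  have habs : |q.eval (-(t : ℝ))| ≤ lebesgueConst d * √E := by
    rw [hint, Lagrange.interpolate_apply, eval_finsetSum]
    refine (Finset.abs_sum_le_sum_abs _ _).trans ?_
    calc ∑ j ∈ Finset.range (d + 1), |eval (-(t : ℝ)) (C (eval (v j) q) *
            Lagrange.basis (Finset.range (d + 1)) v j)|
        ≤ ∑ j ∈ Finset.range (d + 1),
            (d.choose j : ℝ) * ((3 * ((d : ℝ) + 1)) ^ d / d.factorial * √E) := by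
          refine Finset.sum_le_sum fun j hj => ?_
          have hj' : j ≤ d := Nat.lt_succ_iff.1 (Finset.mem_range.1 hj)
          rw [eval_mul, eval_C, abs_mul, Nat.cast_choose ℝ hj']
          have h1 := hnode j hj'
          have h2 := hbasis j hj
          have h3 : (d.factorial : ℝ) ≠ 0 := by positivity
          have h4 : (d.factorial : ℝ) / (j.factorial * (d - j).factorial) *
              ((3 * ((d : ℝ) + 1)) ^ d / d.factorial * √E) =
              √E * ((3 * ((d : ℝ) + 1)) ^ d / (j.factorial * (d - j).factorial)) := by
            field_simp
          rw [h4]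
          exact mul_le_mul h1 h2 (abs_nonneg _) (Real.sqrt_nonneg _)
      _ = lebesgueConst d * √E := by
          rw [← Finset.sum_mul, ← Nat.cast_sum, Nat.sum_range_choose, lebesgueConst]
          push_cast
          have : (6 * ((d : ℝ) + 1)) ^ d = 2 ^ d * (3 * ((d : ℝ) + 1)) ^ d := by
            rw [← mul_pow]; ring_nf
          rw [this]; ring
  rw [← sq_abs]
  calc |q.eval (-(t : ℝ))| ^ 2 ≤ (lebesgueConst d * √E) ^ 2 := by gcongr
    _ = _ := by rw [mul_pow, Real.sq_sqrt hE0]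

open Polynomial in
/-- Doubling property of polynomials. -/
theorem sum_sq_eval_neg_le (d : ℕ) (q : ℝ[X]) (hq : q.natDegree ≤ d) (N M : ℕ) (hN : d + 1 ≤ N)
    (hM : M ≤ N) : ∑ k ∈ Finset.range M, q.eval (-((k : ℝ) + 1)) ^ 2 ≤
      doublingConst d * ∑ j ∈ Finset.range N, q.eval (j : ℝ) ^ 2 := by
  have hN0 : (0 : ℝ) < N := by exact_mod_cast (by omega : 0 < N)
  have hMN : (M : ℝ) ≤ N := by exact_mod_cast hM
  set E := ∑ j ∈ Finset.range N, q.eval (j : ℝ) ^ 2 with hE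
  have hE0 : 0 ≤ E := Finset.sum_nonneg fun _ _ => sq_nonneg _
  calc ∑ k ∈ Finset.range M, q.eval (-((k : ℝ) + 1)) ^ 2
      ≤ ∑ _k ∈ Finset.range M, lebesgueConst d ^ 2 * (2 * ((d : ℝ) + 1) ^ 2 / N * E) := by
        refine Finset.sum_le_sum fun k hk => ?_
        have := sq_eval_neg_le d q hq N (k + 1) hN (by have := Finset.mem_range.1 hk; omega)
        push_cast at this
        exact this
    _ = (M / N) * (doublingConst d * E) := by
        rw [Finset.sum_const, Finset.card_range, nsmul_eq_mul, doublingConst]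
        field_simp
    _ ≤ 1 * (doublingConst d * E) := by
        have h1 := one_le_doublingConst d
        refine mul_le_mul_of_nonneg_right ((div_le_one hN0).2 hMN) (by positivity)
    _ = _ := one_mul _

/-- Comparison with the integral of 1/(√k max(x, k)): the ranges below and above x contribute 2/√x
each. -/
theorem sum_inv_sqrt_max_le (x : ℕ) (hx : 1 ≤ x) (K : ℕ) :
    ∑ k ∈ Finset.range K, 1 / (√((k : ℝ) + 1) * max (x : ℝ) ((k : ℝ) + 1)) ≤ 4 / √(x : ℝ) := by
  have hx0 : (0 : ℝ) < x := by exact_mod_cast hx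
  have hsx : 0 < √(x : ℝ) := Real.sqrt_pos.2 hx0
  have hsx2 : √(x : ℝ) ^ 2 = x := Real.sq_sqrt hx0.le
  have key1 : ∀ K ≤ x, ∑ k ∈ Finset.range K, 1 / (√((k : ℝ) + 1) * max (x : ℝ) ((k : ℝ) + 1)) ≤
      2 * √(K : ℝ) / x := by
    intro K
    induction K with
    | zero => simp
    | succ K ih =>
      intro hK
      rw [Finset.sum_range_succ]
      have h1 : max (x : ℝ) ((K : ℝ) + 1) = x := max_eq_left (by exact_mod_cast hK)
      rw [h1]
      have h2 := ih (by omega)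
      push_cast
      have ha : √((K : ℝ) + 1) ^ 2 = K + 1 := Real.sq_sqrt (by positivity)
      have hb : √(K : ℝ) ^ 2 = K := Real.sq_sqrt (by positivity)
      have ha0 : 0 < √((K : ℝ) + 1) := Real.sqrt_pos.2 (by positivity)
      set a := √((K : ℝ) + 1)
      set b := √(K : ℝ)
      have h3 : 1 / (a * x) ≤ (2 * a - 2 * b) / x := by
        rw [← div_div]
        refine div_le_div_of_nonneg_right ?_ hx0.le
        rw [div_le_iff₀ ha0]
        nlinarith [sq_nonneg (a - b)]
      have h4 : 2 * b / x + (2 * a - 2 * b) / x = 2 * a / x := by ring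
      linarith
  have key2 : ∀ j, ∑ k ∈ Finset.range (x + j),
      1 / (√((k : ℝ) + 1) * max (x : ℝ) ((k : ℝ) + 1)) ≤
        4 / √(x : ℝ) - 2 / √((x + j : ℕ) : ℝ) := by
    intro j
    induction j with
    | zero =>
      refine (key1 x le_rfl).trans (le_of_eq ?_)
      simp only [add_zero]
      have : 2 * √(x : ℝ) / x = 2 / √(x : ℝ) := by
        rw [div_eq_div_iff hx0.ne' hsx.ne']; nlinarith
      rw [this]; ring
    | succ j ih =>
      rw [← add_assoc, Finset.sum_range_succ]
      push_cast at ih ⊢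
      have h1 : max (x : ℝ) ((x : ℝ) + j + 1) = x + j + 1 := max_eq_right (by
        have : (0 : ℝ) ≤ j := by positivity
        linarith)
      rw [h1]
      set m : ℝ := (x : ℝ) + j with hm
      have hm0 : 0 < m := by positivity
      have ha : √(m + 1) ^ 2 = m + 1 := Real.sq_sqrt (by positivity)
      have hb : √m ^ 2 = m := Real.sq_sqrt hm0.le
      have ha0 : 0 < √(m + 1) := Real.sqrt_pos.2 (by positivity)
      have hb0 : 0 < √m := Real.sqrt_pos.2 hm0
      have hab : √m ≤ √(m + 1) := Real.sqrt_le_sqrt (by linarith)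
      set a := √(m + 1)
      set b := √m
      have h2 : 1 / (a * (m + 1)) ≤ 2 / b - 2 / a := by
        rw [← ha, div_sub_div _ _ hb0.ne' ha0.ne', div_le_div_iff₀ (by positivity) (by positivity)]
        have h3 : (a - b) * (a + b) = 1 := by nlinarith
        have h4 : 1 ≤ (a - b) * (2 * a) := by nlinarith
        have h5 : 0 < a * b := by positivity
        have h6 : b ≤ 2 * (a - b) * a ^ 2 := by
          nlinarith
        nlinarith
      linarith
  rcases le_total K x with hK | hK
  · refine (key1 K hK).trans ?_
    rw [div_le_div_iff₀ hx0 hsx]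
    have : √(K : ℝ) ≤ √(x : ℝ) := Real.sqrt_le_sqrt (by exact_mod_cast hK)
    nlinarith [Real.sqrt_nonneg (K : ℝ)]
  · obtain ⟨j, rfl⟩ := Nat.exists_eq_add_of_le hK
    have := key2 j
    have h1 : 0 ≤ 2 / √((x + j : ℕ) : ℝ) := by positivity
    linarith

variable {n : ℕ}

/-- One plus the distance to `g`. -/
def gap (g i : Fin n) : ℕ := ((i : ℕ) - (g : ℕ)) + ((g : ℕ) - (i : ℕ)) + 1

theorem one_le_gap (g i : Fin n) : 1 ≤ gap g i := by rw [gap]; omega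

/-- The gap is injective on each side of g, so the one-sided sum is used twice. -/
theorem sum_gap_kernel_le (g i : Fin n) :
    ∑ j, 1 / (√(gap g j : ℝ) * max (gap g i : ℝ) (gap g j)) ≤ 8 / √(gap g i : ℝ) := by
  classical
  have key : ∀ s : Finset (Fin n), Set.InjOn (fun j => gap g j) (s : Set (Fin n)) →
      ∑ j ∈ s, 1 / (√(gap g j : ℝ) * max (gap g i : ℝ) (gap g j)) ≤ 4 / √(gap g i : ℝ) := by
    intro s hs
    refine (sum_le_sum_of_injOn (t := Finset.range (n + n + 1))
      (g := fun k : ℕ => 1 / (√((k : ℝ) + 1) * max (gap g i : ℝ) ((k : ℝ) + 1)))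
      (fun j => gap g j - 1) (fun _ _ => by positivity) (fun j _ => ?_) (fun a ha b hb hab => ?_)
      fun j _ => ?_).trans (sum_inv_sqrt_max_le (gap g i) (one_le_gap g i) (n + n + 1))
    · rw [Finset.mem_range, gap]; have := g.2; have := j.2; omega
    · refine hs ha hb ?_
      have h1 := one_le_gap g a
      have h2 := one_le_gap g b
      have : gap g a - 1 = gap g b - 1 := hab
      change gap g a = gap g b
      omega
    · have : (((gap g j - 1 : ℕ) : ℝ)) + 1 = gap g j := by
        rw [Nat.cast_sub (one_le_gap g j)]; simp
      rw [this]
  have h1 := key (Finset.univ.filter fun j => j < g) (fun a ha b hb hab => by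
    simp only [Finset.coe_filter, Finset.mem_univ, true_and] at ha hb
    have ha' : (a : ℕ) < g := ha
    have hb' : (b : ℕ) < g := hb
    simp only [gap] at hab
    exact Fin.ext (by omega))
  have h2 := key (Finset.univ.filter fun j => ¬ j < g) (fun a ha b hb hab => by
    simp only [Finset.coe_filter, Finset.mem_univ, true_and] at ha hb
    have ha' : ¬ (a : ℕ) < g := ha
    have hb' : ¬ (b : ℕ) < g := hb
    simp only [gap] at hab
    exact Fin.ext (by omega))
  rw [← Finset.sum_filter_add_sum_filter_not Finset.univ fun j => j < g]
  have : 8 / √(gap g i : ℝ) = 4 / √(gap g i : ℝ) + 4 / √(gap g i : ℝ) := by ring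
  linarith

/-- A discrete Hilbert-type inequality. -/
theorem sum_sq_sum_div_max_le (g : Fin n) (ρ : Fin n → ℝ) :
    ∑ i, (∑ j, |ρ j| / max (gap g i : ℝ) (gap g j)) ^ 2 ≤ 64 * ∑ j, ρ j ^ 2 := by
  have hpos : ∀ i, (0 : ℝ) < gap g i := fun i => by exact_mod_cast one_le_gap g i
  have hs : ∀ i, 0 < √(gap g i : ℝ) := fun i => Real.sqrt_pos.2 (hpos i)
  have hmax : ∀ i j, (0 : ℝ) < max (gap g i : ℝ) (gap g j) := fun i j => lt_max_of_lt_left (hpos i)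
  -- Schur test with weights gap^(-1/2), which the kernel 1/max multiplies by at most 8.
  have h1 : ∀ i, (∑ j, |ρ j| / max (gap g i : ℝ) (gap g j)) ^ 2 ≤
      8 / √(gap g i : ℝ) * ∑ j, √(gap g j : ℝ) * ρ j ^ 2 / max (gap g i : ℝ) (gap g j) := by
    intro i
    refine (Finset.sum_sq_le_sum_mul_sum_of_sq_le_mul Finset.univ
      (f := fun j => 1 / (√(gap g j : ℝ) * max (gap g i : ℝ) (gap g j)))
      (g := fun j => √(gap g j : ℝ) * ρ j ^ 2 / max (gap g i : ℝ) (gap g j)) ?_ ?_ ?_).trans ?_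
    · intro j _; have := hs j; have := hmax i j; positivity
    · intro j _; have := hs j; have := hmax i j; positivity
    · intro j _
      have := (hs j).ne'; have := (hmax i j).ne'
      rw [div_pow, sq_abs]
      refine le_of_eq ?_
      field_simp
    · refine mul_le_mul_of_nonneg_right (sum_gap_kernel_le g i) (Finset.sum_nonneg fun j _ => ?_)
      have := hs j; have := hmax i j; positivity
  calc _ ≤ ∑ i, 8 / √(gap g i : ℝ) *
        ∑ j, √(gap g j : ℝ) * ρ j ^ 2 / max (gap g i : ℝ) (gap g j) :=
        Finset.sum_le_sum fun i _ => h1 i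
    _ = ∑ j, 8 * √(gap g j : ℝ) * ρ j ^ 2 *
        ∑ i, 1 / (√(gap g i : ℝ) * max (gap g j : ℝ) (gap g i)) := by
        simp_rw [Finset.mul_sum]
        rw [Finset.sum_comm]
        refine Finset.sum_congr rfl fun j _ => Finset.sum_congr rfl fun i _ => ?_
        have := (hs i).ne'; have := (hmax i j).ne'
        rw [max_comm (gap g j : ℝ)]
        field_simp
    _ ≤ ∑ j, 8 * √(gap g j : ℝ) * ρ j ^ 2 * (8 / √(gap g j : ℝ)) := by
        refine Finset.sum_le_sum fun j _ => mul_le_mul_of_nonneg_left (sum_gap_kernel_le g j) ?_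
        have := hs j; positivity
    _ = _ := by
        rw [Finset.mul_sum]
        refine Finset.sum_congr rfl fun j _ => ?_
        have := (hs j).ne'
        field_simp
        ring

end

/-! ### Entropy of the residuals on intervals around a point. -/

section

variable {n : ℕ}

/-- `A` is an interval containing `g`. -/
def IsIntervalAt (g : Fin n) (A : Finset (Fin n)) : Prop :=
  (A : Set (Fin n)).OrdConnected ∧ g ∈ A

/-- The points of `A` before `g`. -/
def leftPart (g : Fin n) (A : Finset (Fin n)) : Finset (Fin n) := A.filter fun i => i < g

/-- The points of `A` from `g` on. -/
def rightPart (g : Fin n) (A : Finset (Fin n)) : Finset (Fin n) := A.filter fun i => g ≤ i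

theorem leftPart_union_rightPart (g : Fin n) (A : Finset (Fin n)) :
    leftPart g A ∪ rightPart g A = A := by
  ext i
  simp only [leftPart, rightPart, Finset.mem_union, Finset.mem_filter]
  have := lt_or_ge i g
  tauto

namespace IsIntervalAt

variable {g : Fin n} {A : Finset (Fin n)}

theorem map_parts (h : IsIntervalAt g A) : ∃ s t : ℕ, s ≤ g ∧ (g : ℕ) < t ∧
    (leftPart g A).map Fin.valEmbedding = Finset.Ico s g ∧
    (rightPart g A).map Fin.valEmbedding = Finset.Ico (g : ℕ) t := by
  have hne : A.Nonempty := ⟨g, h.2⟩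
  have hmem : ∀ i, i ∈ A ↔ A.min' hne ≤ i ∧ i ≤ A.max' hne := fun i =>
    ⟨fun hi => ⟨A.min'_le i hi, A.le_max' i hi⟩,
      fun hi => mem_of_ordConnected h.1 (A.min'_mem hne) (A.max'_mem hne) hi.1 hi.2⟩
  have hs := Fin.le_def.1 (A.min'_le g h.2)
  have ht := Fin.le_def.1 (A.le_max' g h.2)
  refine ⟨A.min' hne, A.max' hne + 1, hs, by omega, ?_, ?_⟩
  · ext k
    simp only [leftPart, Finset.mem_map, Finset.mem_filter, Finset.mem_Ico, Fin.valEmbedding_apply]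
    constructor
    · rintro ⟨i, ⟨hi, hig⟩, rfl⟩
      exact ⟨((hmem i).1 hi).1, hig⟩
    · rintro ⟨h1, h2⟩
      have hk : k < n := by have := g.2; omega
      refine ⟨⟨k, hk⟩, ⟨(hmem _).2 ⟨h1, Fin.le_def.2 ?_⟩, h2⟩, rfl⟩
      exact h2.le.trans ht
  · ext k
    simp only [rightPart, Finset.mem_map, Finset.mem_filter, Finset.mem_Ico, Fin.valEmbedding_apply]
    constructor
    · rintro ⟨i, ⟨hi, hig⟩, rfl⟩
      exact ⟨hig, Nat.lt_succ_of_le ((hmem i).1 hi).2⟩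
    · rintro ⟨h1, h2⟩
      have hk : k < n := by have := (A.max' hne).2; omega
      refine ⟨⟨k, hk⟩, ⟨(hmem _).2 ⟨Fin.le_def.2 (hs.trans h1), Fin.le_def.2 ?_⟩, h1⟩, rfl⟩
      exact Nat.lt_succ_iff.1 h2

theorem mem_iff (h : IsIntervalAt g A) (i : Fin n) : i ∈ A ↔
    (g : ℕ) ≤ i + (leftPart g A).card ∧ (i : ℕ) < g + (rightPart g A).card := by
  obtain ⟨s, t, hs, ht, h1, h2⟩ := h.map_parts
  have hc1 : (leftPart g A).card = g - s := by rw [← Finset.card_map, h1, Nat.card_Ico]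
  have hc2 : (rightPart g A).card = t - g := by rw [← Finset.card_map, h2, Nat.card_Ico]
  have m1 : i ∈ leftPart g A ↔ s ≤ (i : ℕ) ∧ (i : ℕ) < g := by
    rw [← Finset.mem_Ico, ← h1]; exact (Finset.mem_map' Fin.valEmbedding).symm
  have m2 : i ∈ rightPart g A ↔ (g : ℕ) ≤ i ∧ (i : ℕ) < t := by
    rw [← Finset.mem_Ico, ← h2]; exact (Finset.mem_map' Fin.valEmbedding).symm
  rw [← leftPart_union_rightPart g A, Finset.mem_union, m1, m2, leftPart_union_rightPart, hc1, hc2]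
  omega

theorem eq_of_card {B : Finset (Fin n)} (hA : IsIntervalAt g A) (hB : IsIntervalAt g B)
    (h1 : (leftPart g A).card = (leftPart g B).card)
    (h2 : (rightPart g A).card = (rightPart g B).card) : A = B := by
  ext i
  rw [hA.mem_iff, hB.mem_iff, h1, h2]

theorem sum_leftPart (h : IsIntervalAt g A) (φ : ℝ → ℝ) :
    ∑ i ∈ leftPart g A, φ ((i : ℕ) : ℝ) =
      ∑ k ∈ Finset.range (leftPart g A).card, φ (((g : ℕ) : ℝ) - ((k : ℝ) + 1)) := by
  obtain ⟨s, t, hs, ht, h1, h2⟩ := h.map_parts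
  have hc1 : (leftPart g A).card = g - s := by rw [← Finset.card_map, h1, Nat.card_Ico]
  have h3 : ∑ i ∈ leftPart g A, φ ((i : ℕ) : ℝ) = ∑ k ∈ Finset.Ico s (g : ℕ), φ (k : ℝ) := by
    rw [← h1, Finset.sum_map]; rfl
  rw [h3, Finset.sum_Ico_eq_sum_range, hc1, ← Finset.sum_range_reflect]
  refine Finset.sum_congr rfl fun k hk => ?_
  have hk' := Finset.mem_range.1 hk
  congr 1
  have : s + ((g : ℕ) - s - 1 - k) = (g : ℕ) - (k + 1) := by omega
  rw [this, Nat.cast_sub (by omega)]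
  push_cast; ring

theorem sum_rightPart (h : IsIntervalAt g A) (φ : ℝ → ℝ) :
    ∑ i ∈ rightPart g A, φ ((i : ℕ) : ℝ) =
      ∑ k ∈ Finset.range (rightPart g A).card, φ (((g : ℕ) : ℝ) + k) := by
  obtain ⟨s, t, hs, ht, h1, h2⟩ := h.map_parts
  have hc2 : (rightPart g A).card = t - g := by rw [← Finset.card_map, h2, Nat.card_Ico]
  have h3 : ∑ i ∈ rightPart g A, φ ((i : ℕ) : ℝ) = ∑ k ∈ Finset.Ico (g : ℕ) t, φ (k : ℝ) := by
    rw [← h2, Finset.sum_map]; rfl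
  rw [h3, Finset.sum_Ico_eq_sum_range, hc2]
  exact Finset.sum_congr rfl fun k _ => by push_cast; rfl

open Polynomial in
theorem doubling_left (h : IsIntervalAt g A) {d : ℕ} (h1 : (leftPart g A).card ≤ (rightPart g A).card)
    (h2 : d + 1 ≤ (rightPart g A).card) (q : ℝ[X]) (hq : q.natDegree ≤ d) :
    ∑ i ∈ leftPart g A, q.eval ((i : ℕ) : ℝ) ^ 2 ≤
      doublingConst d * ∑ i ∈ rightPart g A, q.eval ((i : ℕ) : ℝ) ^ 2 := by
  have hdeg : (q.comp (X + C ((g : ℕ) : ℝ))).natDegree ≤ d := by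
    rw [natDegree_comp, natDegree_X_add_C, mul_one]; exact hq
  have := sum_sq_eval_neg_le d _ hdeg _ _ h2 h1
  rw [h.sum_leftPart fun x => q.eval x ^ 2, h.sum_rightPart fun x => q.eval x ^ 2]
  simp only [eval_comp, eval_add, eval_X, eval_C] at this
  have e1 : ∀ x : ℝ, -(x + 1) + ((g : ℕ) : ℝ) = ((g : ℕ) : ℝ) - (x + 1) := fun x => by ring
  have e2 : ∀ x : ℝ, x + ((g : ℕ) : ℝ) = ((g : ℕ) : ℝ) + x := fun x => by ring
  simp only [e1] at this
  simpa only [e2] using this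

open Polynomial in
theorem doubling_right (h : IsIntervalAt g A) {d : ℕ}
    (h1 : (rightPart g A).card ≤ (leftPart g A).card)
    (h2 : d + 1 ≤ (leftPart g A).card) (q : ℝ[X]) (hq : q.natDegree ≤ d) :
    ∑ i ∈ rightPart g A, q.eval ((i : ℕ) : ℝ) ^ 2 ≤
      doublingConst d * ∑ i ∈ leftPart g A, q.eval ((i : ℕ) : ℝ) ^ 2 := by
  have hdeg : (q.comp (C (((g : ℕ) : ℝ) - 1) - X)).natDegree ≤ d := by
    rw [natDegree_comp, ← neg_sub, natDegree_neg, natDegree_X_sub_C, mul_one]; exact hq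
  have := sum_sq_eval_neg_le d _ hdeg _ _ h2 h1
  rw [h.sum_leftPart fun x => q.eval x ^ 2, h.sum_rightPart fun x => q.eval x ^ 2]
  simp only [eval_comp, eval_sub, eval_X, eval_C] at this
  have e1 : ∀ x : ℝ, ((g : ℕ) : ℝ) - 1 - -(x + 1) = ((g : ℕ) : ℝ) + x := fun x => by ring
  have e2 : ∀ x : ℝ, ((g : ℕ) : ℝ) - 1 - x = ((g : ℕ) : ℝ) - (x + 1) := fun x => by ring
  simpa only [e1, e2] using this

theorem gap_le_card (h : IsIntervalAt g A) {i : Fin n} (hi : i ∈ A) : gap g i ≤ A.card := by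
  rcases le_total i g with hig | hig
  · have hsub : Finset.Icc i g ⊆ A := fun j hj =>
      mem_of_ordConnected h.1 hi h.2 (Finset.mem_Icc.1 hj).1 (Finset.mem_Icc.1 hj).2
    have := Finset.card_le_card hsub
    rw [Fin.card_Icc] at this
    have := Fin.le_def.1 hig
    rw [gap]; omega
  · have hsub : Finset.Icc g i ⊆ A := fun j hj =>
      mem_of_ordConnected h.1 h.2 hi (Finset.mem_Icc.1 hj).1 (Finset.mem_Icc.1 hj).2
    have := Finset.card_le_card hsub
    rw [Fin.card_Icc] at this
    have := Fin.le_def.1 hig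
    rw [gap]; omega

end IsIntervalAt

/-- A pointwise upper bound of all the squared residuals of `ρ` on intervals around `g`. -/
def envelope (d : ℕ) (g : Fin n) (ρ : EuclideanSpace ℝ (Fin n)) (i : Fin n) : ℝ :=
  2 * ρ i ^ 2 + 8 * ((d : ℝ) + 1) ^ 4 * (∑ j, |ρ j| / max (gap g i : ℝ) (gap g j)) ^ 2

theorem envelope_nonneg (d : ℕ) (g : Fin n) (ρ : EuclideanSpace ℝ (Fin n)) (i : Fin n) :
    0 ≤ envelope d g ρ i := by
  rw [envelope]; positivity

theorem sum_envelope_le (d : ℕ) (g : Fin n) (ρ : EuclideanSpace ℝ (Fin n)) :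
    ∑ i, envelope d g ρ i ≤ 514 * ((d : ℝ) + 1) ^ 4 * ‖ρ‖ ^ 2 := by
  have h1 : ∑ i, envelope d g ρ i = 2 * ∑ i, ρ i ^ 2 + 8 * ((d : ℝ) + 1) ^ 4 *
      ∑ i, (∑ j, |ρ j| / max (gap g i : ℝ) (gap g j)) ^ 2 := by
    rw [Finset.mul_sum, Finset.mul_sum, ← Finset.sum_add_distrib]; rfl
  have h2 := sum_sq_sum_div_max_le g fun j => ρ j
  rw [h1, norm_sq_eq_sum]
  have h3 : (1 : ℝ) ≤ ((d : ℝ) + 1) ^ 4 := one_le_pow₀ (by linarith [(Nat.cast_nonneg d : (0:ℝ) ≤ d)])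
  have h4 : 0 ≤ ∑ i, ρ i ^ 2 := Finset.sum_nonneg fun _ _ => sq_nonneg _
  calc _ ≤ 2 * ∑ i, ρ i ^ 2 + 8 * ((d : ℝ) + 1) ^ 4 * (64 * ∑ i, ρ i ^ 2) := by gcongr
    _ ≤ _ := by nlinarith

/-- By `res_res`, the residual on A is obtained from the residual on Q by removing a projection with
entries at most 2(d + 1)²/|A|. An interval containing g, i and j has at least as many points as
either gap, so 1/|A| is dominated by a kernel independent of A. -/
theorem IsIntervalAt.sq_res_le_envelope {g : Fin n} {A Q : Finset (Fin n)} (h : IsIntervalAt g A)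
    (hAQ : A ⊆ Q) (d : ℕ) (f : EuclideanSpace ℝ (Fin n)) (i : Fin n) :
    res d A f i ^ 2 ≤ envelope d g (res d Q f) i := by
  by_cases hi : i ∈ A
  swap
  · rw [res_apply_of_notMem hi, zero_pow two_ne_zero]
    exact envelope_nonneg _ _ _ _
  set ρ := res d Q f with hρ
  have h1 : res d A f i = ρ i - polyProj d A ρ i := by
    rw [← res_res hAQ, ← hρ, res]; simp [hi]
  have hcard : (0 : ℝ) < A.card := by exact_mod_cast Finset.card_pos.2 ⟨i, hi⟩
  have h2 : |polyProj d A ρ i| ≤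
      2 * ((d : ℝ) + 1) ^ 2 * ∑ j, |ρ j| / max (gap g i : ℝ) (gap g j) := by
    refine (abs_polyProj_le h.1 ρ i).trans ?_
    rw [div_mul_eq_mul_div, mul_div_assoc]
    refine mul_le_mul_of_nonneg_left ?_ (by positivity)
    rw [Finset.sum_div]
    refine (Finset.sum_le_sum fun j hj => ?_).trans
      (Finset.sum_le_sum_of_subset_of_nonneg (Finset.subset_univ A) fun j _ _ => by positivity)
    refine div_le_div_of_nonneg_left (abs_nonneg _) ?_ ?_
    · exact lt_max_of_lt_left (Nat.cast_pos.2 (one_le_gap g i))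
    · exact max_le (Nat.cast_le.2 (h.gap_le_card hi)) (Nat.cast_le.2 (h.gap_le_card hj))
  rw [h1, envelope]
  set S := ∑ j, |ρ j| / max (gap g i : ℝ) (gap g j)
  have h3 : polyProj d A ρ i ^ 2 ≤ (2 * ((d : ℝ) + 1) ^ 2 * S) ^ 2 := by
    rw [← sq_abs]; gcongr
  nlinarith [sq_nonneg (ρ i + polyProj d A ρ i)]

theorem polyProj_eq_cut {d : ℕ} {K : Finset (Fin n)} {v : EuclideanSpace ℝ (Fin n)}
    (h : cut K v ∈ polyOn d K) : polyProj d K v = cut K v := by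
  have : res d K v = 0 := res_eq_iff_of_mem (by rwa [sub_zero]) fun w _ => inner_zero_left w
  rw [res, sub_eq_zero] at this
  exact this.symm

/-- Separation numbers of the residuals on the subintervals of `Q` containing `g`. -/
theorem card_separated_le {d : ℕ} {f : EuclideanSpace ℝ (Fin n)} {g : Fin n} {Q : Finset (Fin n)}
    {T : Finset (Finset (Fin n))} (hT : ∀ A ∈ T, IsIntervalAt g A) (hTQ : ∀ A ∈ T, A ⊆ Q) {R ε : ℝ}
    (hR : 0 ≤ R) (hTR : ∀ A ∈ T, ‖res d A f‖ ≤ R) (hε : 0 < ε)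
    (hsep : ∀ A ∈ T, ∀ B ∈ T, A ≠ B → ε ≤ ‖res d A f - res d B f‖) :
    (T.card : ℝ) ≤ (1 + 514 * ((d : ℝ) + 1) ^ 4 * rss d f Q * (32 / ε ^ 2)) ^ 2 *
      (1 + 4 * R / ε) ^ (d + 1) := by
  classical
  set env := envelope d g (res d Q f) with henv
  have henv0 : ∀ i, 0 ≤ env i := envelope_nonneg _ _ _
  set tot := ∑ i, env i with htot
  have htot0 : 0 ≤ tot := Finset.sum_nonneg fun i _ => henv0 i
  have htot1 : tot ≤ 514 * ((d : ℝ) + 1) ^ 4 * rss d f Q := sum_envelope_le _ _ _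
  -- Intervals are bucketed, in steps of δ, by the envelope mass beyond their left and right ends.
  -- Within a bucket every residual has squared mass at most 2δ = ε²/16 off the common core, so two
  -- of them differ there by at most ε²/4 in squared norm.
  set δ := ε ^ 2 / 32 with hδ
  have hδ0 : 0 < δ := by positivity
  let lset : ℕ → Finset (Fin n) := fun p => Finset.univ.filter fun i => (i : ℕ) + p < g
  let hset : ℕ → Finset (Fin n) := fun q => Finset.univ.filter fun i => (g : ℕ) + q ≤ i
  let cl : Finset (Fin n) → ℕ := fun A => (leftPart g A).card
  let cr : Finset (Fin n) → ℕ := fun A => (rightPart g A).card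
  let lowE : Finset (Fin n) → ℝ := fun A => ∑ i ∈ lset (cl A), env i
  let highE : Finset (Fin n) → ℝ := fun A => ∑ i ∈ hset (cr A), env i
  have hle : ∀ s : Finset (Fin n), ∑ i ∈ s, env i ≤ tot := fun s =>
    Finset.sum_le_sum_of_subset_of_nonneg (Finset.subset_univ s) fun i _ _ => henv0 i
  have hnn : ∀ s : Finset (Fin n), 0 ≤ ∑ i ∈ s, env i := fun s =>
    Finset.sum_nonneg fun i _ => henv0 i
  let κ : Finset (Fin n) → ℕ × ℕ := fun A => (⌊lowE A / δ⌋₊, ⌊highE A / δ⌋₊)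
  set L := ⌊tot / δ⌋₊ + 1 with hL
  have hκ : ∀ A ∈ T, κ A ∈ Finset.range L ×ˢ Finset.range L := by
    intro A _
    simp only [κ, Finset.mem_product, Finset.mem_range, hL, Nat.lt_succ_iff]
    exact ⟨Nat.floor_le_floor (by gcongr; exact hle _), Nat.floor_le_floor (by gcongr; exact hle _)⟩
  have hLle : (L : ℝ) ≤ 1 + 514 * ((d : ℝ) + 1) ^ 4 * rss d f Q * (32 / ε ^ 2) := by
    rw [hL]; push_cast
    have h1 := Nat.floor_le (div_nonneg htot0 hδ0.le)
    have h2 : tot / δ ≤ 514 * ((d : ℝ) + 1) ^ 4 * rss d f Q * (32 / ε ^ 2) := by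
      rw [div_le_iff₀ hδ0, hδ]
      have : 514 * ((d : ℝ) + 1) ^ 4 * rss d f Q * (32 / ε ^ 2) * (ε ^ 2 / 32) =
        514 * ((d : ℝ) + 1) ^ 4 * rss d f Q := by field_simp
      rw [this]; exact htot1
    linarith
  set B : ℝ := (1 + 4 * R / ε) ^ (d + 1) with hB
  have hB0 : 0 ≤ B := by positivity
  have hfloor : ∀ x y : ℝ, 0 ≤ x → 0 ≤ y → ⌊x / δ⌋₊ = ⌊y / δ⌋₊ → y - x ≤ δ := by
    intro x y hx hy hxy
    have h1 := Nat.lt_floor_add_one (y / δ)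
    have h2 := Nat.floor_le (div_nonneg hx hδ0.le)
    rw [← hxy] at h1
    have h3 : y / δ - x / δ ≤ 1 := by linarith
    rw [← sub_div, div_le_one hδ0] at h3
    exact h3
  have hfib : ∀ b ∈ Finset.range L ×ˢ Finset.range L, (T.filter fun A => κ A = b).card ≤ ⌊B⌋₊ := by
    intro b _
    set S := T.filter fun A => κ A = b with hS
    refine Nat.le_floor ?_
    rcases S.eq_empty_or_nonempty with hSe | hSne
    · rw [hSe]; simpa using hB0
    have hST : ∀ A ∈ S, A ∈ T := fun A hA => (Finset.mem_filter.1 hA).1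
    have hSb : ∀ A ∈ S, κ A = b := fun A hA => (Finset.mem_filter.1 hA).2
    obtain ⟨A₁, hA₁, hmin₁⟩ := S.exists_min_image cl hSne
    obtain ⟨A₂, hA₂, hmin₂⟩ := S.exists_min_image cr hSne
    -- The common core combines the shortest left and right arms in the bucket. On it the difference
    -- of two residuals is polynomial, so their projections are ε/2-separated in dimension at most d
    -- + 1.
    let K : Finset (Fin n) := Finset.univ.filter fun i =>
      (g : ℕ) ≤ i + cl A₁ ∧ (i : ℕ) < g + cr A₂
    have hKA : ∀ A ∈ S, K ⊆ A := by
      intro A hA i hi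
      have h1 := (Finset.mem_filter.1 hi).2
      have h2 := hmin₁ A hA
      have h3 := hmin₂ A hA
      rw [(hT A (hST A hA)).mem_iff]
      exact ⟨h1.1.trans (Nat.add_le_add_left h2 _), h1.2.trans_le (Nat.add_le_add_left h3 _)⟩
    have hoff : ∀ A ∈ S, ∑ i ∈ Kᶜ, res d A f i ^ 2 ≤ 2 * δ := by
      intro A hA
      have hAT := hT A (hST A hA)
      have hκA := hSb A hA
      have h1 : lowE A₁ - lowE A ≤ δ := hfloor _ _ (hnn _) (hnn _) (by
        have := congrArg Prod.fst (hκA.trans (hSb A₁ hA₁).symm); exact this)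
      have h2 : highE A₂ - highE A ≤ δ := hfloor _ _ (hnn _) (hnn _) (by
        have := congrArg Prod.snd (hκA.trans (hSb A₂ hA₂).symm); exact this)
      have h3 : lset (cl A) ⊆ lset (cl A₁) := by
        intro i hi
        have := (Finset.mem_filter.1 hi).2
        have := hmin₁ A hA
        exact Finset.mem_filter.2 ⟨Finset.mem_univ _, by omega⟩
      have h4 : hset (cr A) ⊆ hset (cr A₂) := by
        intro i hi
        have := (Finset.mem_filter.1 hi).2
        have := hmin₂ A hA
        exact Finset.mem_filter.2 ⟨Finset.mem_univ _, by omega⟩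
      have h5 : ∑ i ∈ lset (cl A₁) \ lset (cl A), env i = lowE A₁ - lowE A :=
        eq_sub_of_add_eq (Finset.sum_sdiff h3)
      have h6 : ∑ i ∈ hset (cr A₂) \ hset (cr A), env i = highE A₂ - highE A :=
        eq_sub_of_add_eq (Finset.sum_sdiff h4)
      have h7 : ∑ i ∈ Kᶜ, res d A f i ^ 2 ≤
          ∑ i ∈ (lset (cl A₁) \ lset (cl A)) ∪ (hset (cr A₂) \ hset (cr A)), env i := by
        calc ∑ i ∈ Kᶜ, res d A f i ^ 2 = ∑ i ∈ Kᶜ ∩ A, res d A f i ^ 2 := by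
              refine (Finset.sum_subset Finset.inter_subset_left fun i hi hi' => ?_).symm
              rw [res_apply_of_notMem, zero_pow two_ne_zero]
              exact fun hiA => hi' (Finset.mem_inter.2 ⟨hi, hiA⟩)
          _ ≤ ∑ i ∈ Kᶜ ∩ A, env i := Finset.sum_le_sum fun i _ =>
              hAT.sq_res_le_envelope (hTQ A (hST A hA)) d f i
          _ ≤ _ := by
              refine Finset.sum_le_sum_of_subset_of_nonneg ?_ fun i _ _ => henv0 i
              intro i hi
              obtain ⟨hiK, hiA⟩ := Finset.mem_inter.1 hi
              have hA' := (hAT.mem_iff i).1 hiA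
              have hK' : ¬ ((g : ℕ) ≤ i + cl A₁ ∧ (i : ℕ) < g + cr A₂) := fun hcon =>
                Finset.mem_compl.1 hiK (Finset.mem_filter.2 ⟨Finset.mem_univ _, hcon⟩)
              simp only [Finset.mem_union, Finset.mem_sdiff, lset, hset, Finset.mem_filter,
                Finset.mem_univ, true_and]
              have e1 : (leftPart g A).card = cl A := rfl
              have e2 : (rightPart g A).card = cr A := rfl
              rw [e1, e2] at hA'
              omega
      have h8 := Finset.sum_union_inter (s₁ := lset (cl A₁) \ lset (cl A))
        (s₂ := hset (cr A₂) \ hset (cr A)) (f := env)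
      have h9 := hnn ((lset (cl A₁) \ lset (cl A)) ∩ (hset (cr A₂) \ hset (cr A)))
      linarith
    have hpoly : ∀ A ∈ S, ∀ A' ∈ S, cut K (res d A f - res d A' f) ∈ polyOn d K := by
      intro A hA A' hA'
      obtain ⟨q, hq, hqA⟩ := exists_res_eq d A f
      obtain ⟨q', hq', hqA'⟩ := exists_res_eq d A' f
      have : cut K (res d A f - res d A' f) = cut K (polyVec (q' - q)) := by
        ext i
        by_cases hi : i ∈ K
        · simp [hi, hqA i (hKA A hA hi), hqA' i (hKA A' hA' hi)]
        · simp [hi]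
      rw [this]
      exact cut_polyVec_mem K ((Polynomial.natDegree_sub_le _ _).trans (max_le hq' hq))
    have hpack := card_le_of_separated' (polyOn d K) S (fun A => polyProj d K (res d A f))
      (R := R) (ε := ε / 2) (by positivity) hR (fun A _ => polyProj_mem d K _)
      (fun A hA => ((polyOn d K).norm_starProjection_apply_le _).trans (hTR A (hST A hA)))
      (fun A hA A' hA' hne => by
        have h1 : polyProj d K (res d A f) - polyProj d K (res d A' f) =
            cut K (res d A f - res d A' f) := by
          rw [← polyProj_eq_cut (hpoly A hA A' hA'), polyProj, polyProj, polyProj, map_sub]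
        rw [h1]
        have h2 := hsep A (hST A hA) A' (hST A' hA') hne
        have h3 : ‖res d A f - res d A' f‖ ^ 2 = ‖cut K (res d A f - res d A' f)‖ ^ 2 +
            ∑ i ∈ Kᶜ, (res d A f - res d A' f) i ^ 2 := by
          rw [norm_sq_cut, norm_sq_eq_sum, Finset.sum_add_sum_compl]
        have h4 : ∑ i ∈ Kᶜ, (res d A f - res d A' f) i ^ 2 ≤
            2 * ∑ i ∈ Kᶜ, res d A f i ^ 2 + 2 * ∑ i ∈ Kᶜ, res d A' f i ^ 2 := by
          rw [Finset.mul_sum, Finset.mul_sum, ← Finset.sum_add_distrib]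
          refine Finset.sum_le_sum fun i _ => ?_
          rw [PiLp.sub_apply]
          nlinarith [sq_nonneg (res d A f i + res d A' f i)]
        have h5 := hoff A hA
        have h6 := hoff A' hA'
        have h7 : ε ^ 2 ≤ ‖res d A f - res d A' f‖ ^ 2 := by gcongr
        rw [← sq_le_sq₀ (by positivity) (norm_nonneg _)]
        nlinarith)
    refine hpack.trans ?_
    have h1 : 1 + 2 * R / (ε / 2) = 1 + 4 * R / ε := by field_simp; ring
    rw [h1, hB]
    exact pow_le_pow_right₀ (by
      have : 0 ≤ 4 * R / ε := by positivity
      linarith) (finrank_polyOn_le d K)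
  have hcard := Finset.card_le_mul_card_image_of_maps_to hκ ⌊B⌋₊ hfib
  rw [Finset.card_product, Finset.card_range] at hcard
  calc (T.card : ℝ) ≤ ((⌊B⌋₊ * (L * L) : ℕ) : ℝ) := by exact_mod_cast hcard
    _ = (⌊B⌋₊ : ℝ) * (L * L) := by push_cast; ring
    _ ≤ B * (L * L) := by gcongr; exact Nat.floor_le hB0
    _ = (L : ℝ) ^ 2 * B := by ring
    _ ≤ _ := by gcongr

/-- The best polynomials p on A and q on J are both close to f on the overlap N, so p - q has
squared mass at most 8Y there. Doubling carries this to P, where q is then within 4Y + 16CY of f,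
with C the doubling constant; adding 2Y for J gives 22CY. -/
theorem rss_union_le {d : ℕ} {f : EuclideanSpace ℝ (Fin n)} {A J N P : Finset (Fin n)} {Y : ℝ}
    (hNA : N ⊆ A) (hNJ : N ⊆ J) (hPA : P ⊆ A) (hAJ : A \ J ⊆ P)
    (hdbl : ∀ q : Polynomial ℝ, q.natDegree ≤ d → ∑ i ∈ P, q.eval ((i : ℕ) : ℝ) ^ 2 ≤
      doublingConst d * ∑ i ∈ N, q.eval ((i : ℕ) : ℝ) ^ 2)
    (hA : rss d f A ≤ 2 * Y) (hJ : rss d f J ≤ 2 * Y) :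
    rss d f (A ∪ J) ≤ 22 * doublingConst d * Y := by
  classical
  obtain ⟨p, hp, hpA⟩ := exists_rss_eq d f A
  obtain ⟨q, hq, hqJ⟩ := exists_rss_eq d f J
  have hsub : ∀ {s t : Finset (Fin n)} (φ : Fin n → ℝ), s ⊆ t → ∑ i ∈ s, φ i ^ 2 ≤ ∑ i ∈ t, φ i ^ 2 :=
    fun φ hst => Finset.sum_le_sum_of_subset_of_nonneg hst fun _ _ _ => sq_nonneg _
  have hC := one_le_doublingConst d
  have hY : 0 ≤ Y := by have := rss_nonneg d f A; linarith
  have h1 : ∑ i ∈ N, (p - q).eval ((i : ℕ) : ℝ) ^ 2 ≤ 8 * Y := by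
    calc ∑ i ∈ N, (p - q).eval ((i : ℕ) : ℝ) ^ 2
        ≤ ∑ i ∈ N, (2 * (f i - p.eval ((i : ℕ) : ℝ)) ^ 2 + 2 * (f i - q.eval ((i : ℕ) : ℝ)) ^ 2) := by
          refine Finset.sum_le_sum fun i _ => ?_
          rw [Polynomial.eval_sub]
          nlinarith [sq_nonneg (f i - p.eval ((i : ℕ) : ℝ) + (f i - q.eval ((i : ℕ) : ℝ)))]
      _ = 2 * ∑ i ∈ N, (f i - p.eval ((i : ℕ) : ℝ)) ^ 2 +
          2 * ∑ i ∈ N, (f i - q.eval ((i : ℕ) : ℝ)) ^ 2 := by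
          rw [Finset.sum_add_distrib, Finset.mul_sum, Finset.mul_sum]
      _ ≤ 2 * rss d f A + 2 * rss d f J := by
          rw [hpA, hqJ]
          have := hsub (fun i => f i - p.eval ((i : ℕ) : ℝ)) hNA
          have := hsub (fun i => f i - q.eval ((i : ℕ) : ℝ)) hNJ
          linarith
      _ ≤ _ := by linarith
  have h2 := hdbl (p - q) ((Polynomial.natDegree_sub_le _ _).trans (max_le hp hq))
  have h3 : ∑ i ∈ A \ J, (f i - q.eval ((i : ℕ) : ℝ)) ^ 2 ≤
      2 * rss d f A + 2 * ∑ i ∈ P, (p - q).eval ((i : ℕ) : ℝ) ^ 2 := by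
    calc ∑ i ∈ A \ J, (f i - q.eval ((i : ℕ) : ℝ)) ^ 2
        ≤ ∑ i ∈ P, (f i - q.eval ((i : ℕ) : ℝ)) ^ 2 := hsub (fun i => f i - q.eval ((i : ℕ) : ℝ)) hAJ
      _ ≤ ∑ i ∈ P, (2 * (f i - p.eval ((i : ℕ) : ℝ)) ^ 2 + 2 * (p - q).eval ((i : ℕ) : ℝ) ^ 2) := by
          refine Finset.sum_le_sum fun i _ => ?_
          rw [Polynomial.eval_sub]
          nlinarith [sq_nonneg (f i - p.eval ((i : ℕ) : ℝ) -
            (p.eval ((i : ℕ) : ℝ) - q.eval ((i : ℕ) : ℝ)))]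
      _ = 2 * ∑ i ∈ P, (f i - p.eval ((i : ℕ) : ℝ)) ^ 2 +
          2 * ∑ i ∈ P, (p - q).eval ((i : ℕ) : ℝ) ^ 2 := by
          rw [Finset.sum_add_distrib, Finset.mul_sum, Finset.mul_sum]
      _ ≤ _ := by
          rw [hpA]
          have := hsub (fun i => f i - p.eval ((i : ℕ) : ℝ)) hPA
          linarith
  have h4 : rss d f (A ∪ J) ≤ ∑ i ∈ A \ J, (f i - q.eval ((i : ℕ) : ℝ)) ^ 2 + rss d f J := by
    refine (rss_le f (A ∪ J) hq).trans ?_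
    rw [hqJ, ← Finset.sdiff_union_self_eq_union, Finset.sum_union Finset.sdiff_disjoint]
  have h5 : doublingConst d * ∑ i ∈ N, (p - q).eval ((i : ℕ) : ℝ) ^ 2 ≤ doublingConst d * (8 * Y) := by
    gcongr
  nlinarith

/-- Intervals around `g` with small residual sums of squares and a long right part lie in a common
interval with small residual sum of squares. -/
theorem exists_hull_right {d : ℕ} {f : EuclideanSpace ℝ (Fin n)} {g : Fin n}
    {T : Finset (Finset (Fin n))} (hT : ∀ A ∈ T, IsIntervalAt g A) {Y : ℝ} (hY : 0 ≤ Y)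
    (hTY : ∀ A ∈ T, rss d f A ≤ 2 * Y)
    (hlen : ∀ A ∈ T, (leftPart g A).card ≤ (rightPart g A).card ∧ d + 1 ≤ (rightPart g A).card) :
    ∃ Q, (∀ A ∈ T, A ⊆ Q) ∧ rss d f Q ≤ 22 * doublingConst d * Y := by
  classical
  rcases T.eq_empty_or_nonempty with rfl | hne
  · refine ⟨∅, by simp, ?_⟩
    have h1 := one_le_doublingConst d
    have h2 : rss d f ∅ = 0 := by rw [rss, norm_sq_res_eq_sum, Finset.sum_empty]
    rw [h2]; positivity
  -- The hull joins the interval with the longest left arm to the one with the longest right arm.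
  -- They overlap on the right part of A₀, at least as long as its left part, as doubling requires.
  obtain ⟨A₀, hA₀, hmax₀⟩ := T.exists_max_image (fun A => (leftPart g A).card) hne
  obtain ⟨J, hJ, hmaxJ⟩ := T.exists_max_image (fun A => (rightPart g A).card) hne
  refine ⟨A₀ ∪ J, fun A hA i hi => ?_, rss_union_le (N := rightPart g A₀) (P := leftPart g A₀)
    (Finset.filter_subset _ _) ?_ (Finset.filter_subset _ _) ?_
    ((hT A₀ hA₀).doubling_left (hlen A₀ hA₀).1 (hlen A₀ hA₀).2) (hTY A₀ hA₀) (hTY J hJ)⟩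
  · have h0 := hmax₀ A hA
    have h1 := hmaxJ A hA
    have h2 := ((hT A hA).mem_iff i).1 hi
    rw [Finset.mem_union, (hT A₀ hA₀).mem_iff, (hT J hJ).mem_iff]
    have h3 := (hlen A₀ hA₀).2
    have h4 := (hlen J hJ).2
    omega
  · intro i hi
    obtain ⟨hi1, hi2⟩ := Finset.mem_filter.1 hi
    have h1 := hmaxJ A₀ hA₀
    have h2 := ((hT A₀ hA₀).mem_iff i).1 hi1
    have h3 := Fin.le_def.1 hi2
    rw [(hT J hJ).mem_iff]
    omega
  · intro i hi
    obtain ⟨hi1, hi2⟩ := Finset.mem_sdiff.1 hi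
    refine Finset.mem_filter.2 ⟨hi1, ?_⟩
    have h1 := hmaxJ A₀ hA₀
    have h2 := ((hT A₀ hA₀).mem_iff i).1 hi1
    rw [(hT J hJ).mem_iff] at hi2
    exact Fin.lt_def.2 (by omega)

/-- Mirror image of `exists_hull_right`; here g itself keeps the right parts nonempty. -/
theorem exists_hull_left {d : ℕ} {f : EuclideanSpace ℝ (Fin n)} {g : Fin n}
    {T : Finset (Finset (Fin n))} (hT : ∀ A ∈ T, IsIntervalAt g A) {Y : ℝ} (hY : 0 ≤ Y)
    (hTY : ∀ A ∈ T, rss d f A ≤ 2 * Y)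
    (hlen : ∀ A ∈ T, (rightPart g A).card ≤ (leftPart g A).card ∧ d + 1 ≤ (leftPart g A).card) :
    ∃ Q, (∀ A ∈ T, A ⊆ Q) ∧ rss d f Q ≤ 22 * doublingConst d * Y := by
  classical
  rcases T.eq_empty_or_nonempty with rfl | hne
  · refine ⟨∅, by simp, ?_⟩
    have h1 := one_le_doublingConst d
    have h2 : rss d f ∅ = 0 := by rw [rss, norm_sq_res_eq_sum, Finset.sum_empty]
    rw [h2]; positivity
  obtain ⟨A₀, hA₀, hmax₀⟩ := T.exists_max_image (fun A => (rightPart g A).card) hne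
  obtain ⟨J, hJ, hmaxJ⟩ := T.exists_max_image (fun A => (leftPart g A).card) hne
  have hpos : ∀ A ∈ T, 0 < (rightPart g A).card := fun A hA =>
    Finset.card_pos.2 ⟨g, Finset.mem_filter.2 ⟨(hT A hA).2, le_rfl⟩⟩
  refine ⟨A₀ ∪ J, fun A hA i hi => ?_, rss_union_le (N := leftPart g A₀) (P := rightPart g A₀)
    (Finset.filter_subset _ _) ?_ (Finset.filter_subset _ _) ?_
    ((hT A₀ hA₀).doubling_right (hlen A₀ hA₀).1 (hlen A₀ hA₀).2) (hTY A₀ hA₀) (hTY J hJ)⟩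
  · have h0 := hmax₀ A hA
    have h1 := hmaxJ A hA
    have h2 := ((hT A hA).mem_iff i).1 hi
    rw [Finset.mem_union, (hT A₀ hA₀).mem_iff, (hT J hJ).mem_iff]
    have h3 := hpos A₀ hA₀
    have h4 := hpos J hJ
    omega
  · intro i hi
    obtain ⟨hi1, hi2⟩ := Finset.mem_filter.1 hi
    have h1 := hmaxJ A₀ hA₀
    have h2 := ((hT A₀ hA₀).mem_iff i).1 hi1
    have h3 := Fin.lt_def.1 hi2
    have h4 := hpos J hJ
    rw [(hT J hJ).mem_iff]
    omega
  · intro i hi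
    obtain ⟨hi1, hi2⟩ := Finset.mem_sdiff.1 hi
    refine Finset.mem_filter.2 ⟨hi1, ?_⟩
    have h1 := hmaxJ A₀ hA₀
    have h2 := ((hT A₀ hA₀).mem_iff i).1 hi1
    rw [(hT J hJ).mem_iff] at hi2
    exact Fin.le_def.2 (by omega)

/-- Separation numbers of the residuals on the intervals around `g` with small residual sums of
squares. -/
theorem card_separated_class_le {d : ℕ} {f : EuclideanSpace ℝ (Fin n)} {g : Fin n}
    {T : Finset (Finset (Fin n))} (hT : ∀ A ∈ T, IsIntervalAt g A) {Y ε : ℝ} (hY : 0 ≤ Y)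
    (hTY : ∀ A ∈ T, rss d f A ≤ 2 * Y) (hε : 0 < ε)
    (hsep : ∀ A ∈ T, ∀ B ∈ T, A ≠ B → ε ≤ ‖res d A f - res d B f‖) :
    (T.card : ℝ) ≤ 2 * ((1 + 514 * ((d : ℝ) + 1) ^ 4 * (22 * doublingConst d * Y) *
      (32 / ε ^ 2)) ^ 2 * (1 + 4 * √(2 * Y) / ε) ^ (d + 1)) + ((d : ℝ) + 1) ^ 2 := by
  classical
  set B : ℝ := (1 + 514 * ((d : ℝ) + 1) ^ 4 * (22 * doublingConst d * Y) *
      (32 / ε ^ 2)) ^ 2 * (1 + 4 * √(2 * Y) / ε) ^ (d + 1) with hB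
  have hCd := one_le_doublingConst d
  have hmain : ∀ S ⊆ T, (∃ Q, (∀ A ∈ S, A ⊆ Q) ∧ rss d f Q ≤ 22 * doublingConst d * Y) →
      (S.card : ℝ) ≤ B := by
    rintro S hS ⟨Q, hSQ, hQ⟩
    refine (card_separated_le (fun A hA => hT A (hS hA)) hSQ (Real.sqrt_nonneg (2 * Y))
      (fun A hA => Real.le_sqrt_of_sq_le (hTY A (hS hA))) hε
      (fun A hA A' hA' h => hsep A (hS hA) A' (hS hA') h)).trans ?_
    have := rss_nonneg d f Q
    rw [hB]
    gcongr
  set T₁ := T.filter fun A => (leftPart g A).card ≤ (rightPart g A).card ∧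
    d + 1 ≤ (rightPart g A).card with hT₁
  set T₂ := T.filter fun A => (rightPart g A).card ≤ (leftPart g A).card ∧
    d + 1 ≤ (leftPart g A).card with hT₂
  -- Both arms are too short for doubling, but the two arm lengths determine the interval, so there
  -- are at most (d + 1)² of these.
  set T₃ := T.filter fun A => (leftPart g A).card < d + 1 ∧ (rightPart g A).card < d + 1 with hT₃
  have h1 : (T₁.card : ℝ) ≤ B := hmain T₁ (Finset.filter_subset _ _)
    (exists_hull_right (fun A hA => hT A (Finset.mem_filter.1 hA).1) hY
      (fun A hA => hTY A (Finset.mem_filter.1 hA).1) fun A hA => (Finset.mem_filter.1 hA).2)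
  have h2 : (T₂.card : ℝ) ≤ B := hmain T₂ (Finset.filter_subset _ _)
    (exists_hull_left (fun A hA => hT A (Finset.mem_filter.1 hA).1) hY
      (fun A hA => hTY A (Finset.mem_filter.1 hA).1) fun A hA => (Finset.mem_filter.1 hA).2)
  have h3 : T₃.card ≤ (d + 1) * (d + 1) := by
    have : T₃.card ≤ (Finset.range (d + 1) ×ˢ Finset.range (d + 1)).card := by
      refine Finset.card_le_card_of_injOn
        (fun A => ((leftPart g A).card, (rightPart g A).card)) ?_ ?_
      · intro A hA
        have := (Finset.mem_filter.1 (Finset.mem_coe.1 hA)).2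
        simp [this.1, this.2]
      · intro A hA A' hA' h
        have hA1 := (Finset.mem_filter.1 (Finset.mem_coe.1 hA)).1
        have hA2 := (Finset.mem_filter.1 (Finset.mem_coe.1 hA')).1
        exact (hT A hA1).eq_of_card (hT A' hA2) (congrArg Prod.fst h) (congrArg Prod.snd h)
    simpa using this
  have h4 : T.card ≤ T₁.card + T₂.card + T₃.card := by
    have : T ⊆ T₁ ∪ T₂ ∪ T₃ := by
      intro A hA
      simp only [hT₁, hT₂, hT₃, Finset.mem_union, Finset.mem_filter, hA, true_and]
      omega
    exact (Finset.card_le_card this).trans ((Finset.card_union_le _ _).trans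
      (Nat.add_le_add_right (Finset.card_union_le _ _) _))
  have h3' : (T₃.card : ℝ) ≤ ((d : ℝ) + 1) ^ 2 := by
    rw [sq]; exact_mod_cast h3
  have h4' : (T.card : ℝ) ≤ T₁.card + T₂.card + T₃.card := by exact_mod_cast h4
  linarith

end

/-! ### Numerical entropy bounds and greedy points. -/

section

theorem succ_pow_le_exp_mul_factorial (d : ℕ) :
    ((d : ℝ) + 1) ^ d ≤ Real.exp d * d.factorial := by
  induction d with
  | zero => simp
  | succ d ih =>
    have h0 : (0 : ℝ) < (d : ℝ) + 1 := by positivity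
    have h1 : (((d : ℝ) + 1 + 1) / (d + 1)) ^ (d + 1) ≤ Real.exp 1 := by
      have h2 : ((d : ℝ) + 1 + 1) / (d + 1) ≤ Real.exp (1 / (d + 1)) := by
        refine le_trans (le_of_eq ?_) (Real.add_one_le_exp _)
        field_simp; ring
      refine (pow_le_pow_left₀ (by positivity) h2 _).trans (le_of_eq ?_)
      rw [← Real.exp_nat_mul]; congr 1; push_cast; field_simp
    rw [div_pow, div_le_iff₀ (by positivity)] at h1
    rw [Nat.factorial_succ]; push_cast
    rw [Real.exp_add]
    calc ((d : ℝ) + 1 + 1) ^ (d + 1) ≤ Real.exp 1 * (((d : ℝ) + 1) ^ d * ((d : ℝ) + 1)) := by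
          rw [← pow_succ]; exact h1
      _ ≤ Real.exp 1 * (Real.exp d * d.factorial * ((d : ℝ) + 1)) := by gcongr
      _ = _ := by ring

theorem le_exp_one : (2.718 : ℝ) ≤ Real.exp 1 := by
  have := Real.exp_one_gt_d9
  linarith

/-- Certifies a bound by exp(a/b) through rational arithmetic. -/
theorem le_exp_of_pow_le {x y : ℝ} (a b : ℕ) (hb : b ≠ 0) (hy : y * b = a) (hx : 0 ≤ x)
    (h : x ^ b ≤ 2.718 ^ a) : x ≤ Real.exp y := by
  rw [← pow_le_pow_iff_left₀ hx (Real.exp_nonneg _) hb]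
  refine h.trans ((pow_le_pow_left₀ (by norm_num) le_exp_one a).trans (le_of_eq ?_))
  rw [← Real.exp_nat_mul, ← Real.exp_nat_mul, mul_one, mul_comm, hy]

theorem lebesgueConst_le (d : ℕ) : lebesgueConst d ≤ Real.exp (2.8 * d) := by
  have h1 := succ_pow_le_exp_mul_factorial d
  have h6 : (6 : ℝ) ≤ Real.exp 1.8 := le_exp_of_pow_le 9 5 (by norm_num) (by norm_num)
    (by norm_num) (by norm_num)
  rw [lebesgueConst, div_le_iff₀ (by positivity), mul_pow]
  calc (6 : ℝ) ^ d * ((d : ℝ) + 1) ^ d ≤ Real.exp 1.8 ^ d * (Real.exp d * d.factorial) := by gcongr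
    _ = _ := by
      rw [← Real.exp_nat_mul, ← mul_assoc, ← Real.exp_add]; congr 2; ring

/-- Numerical form of the separation numbers. -/
theorem separation_count_le_exp (d k : ℕ) :
    2 * ((1 + 11579392 * ((d : ℝ) + 1) ^ 4 * doublingConst d * 64 ^ k) ^ 2 *
      (1 + 32 * 8 ^ k) ^ (d + 1)) + ((d : ℝ) + 1) ^ 2 ≤
    Real.exp (42 * ((d : ℝ) + 1) * (1 + 0.3 * k) - (k + 1)) := by
  set D : ℝ := (d : ℝ) + 1 with hD
  have hD1 : 1 ≤ D := by rw [hD]; linarith [(Nat.cast_nonneg d : (0 : ℝ) ≤ d)]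
  have hC := one_le_doublingConst d
  set Cd := doublingConst d with hCd
  have h8k : (1 : ℝ) ≤ 8 ^ k := one_le_pow₀ (by norm_num)
  have h64k : (1 : ℝ) ≤ 64 ^ k := one_le_pow₀ (by norm_num)
  have hD4 : 1 ≤ D ^ 4 := one_le_pow₀ hD1
  have h1 : 1 + 11579392 * D ^ 4 * Cd * 64 ^ k ≤ 12000000 * D ^ 4 * Cd * 64 ^ k := by
    have : 1 ≤ D ^ 4 * Cd * 64 ^ k := one_le_mul_of_one_le_of_one_le
      (one_le_mul_of_one_le_of_one_le hD4 hC) h64k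
    nlinarith
  have h2 : (1 : ℝ) + 32 * 8 ^ k ≤ 33 * 8 ^ k := by linarith
  have hexpD : D ≤ Real.exp d := by rw [hD]; exact Real.add_one_le_exp _
  have hB := lebesgueConst_le d
  have hB0 : 0 ≤ lebesgueConst d := zero_le_one.trans (one_le_lebesgueConst d)
  have hCe : Cd ≤ 2 * Real.exp (7.6 * d) := by
    rw [hCd, doublingConst]
    calc 2 * ((d : ℝ) + 1) ^ 2 * lebesgueConst d ^ 2
        ≤ 2 * Real.exp d ^ 2 * Real.exp (2.8 * d) ^ 2 := by gcongr
      _ = _ := by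
        rw [← Real.exp_nat_mul, ← Real.exp_nat_mul, mul_assoc, ← Real.exp_add]
        congr 2; push_cast; ring
  have h33 : (33 : ℝ) ≤ Real.exp 3.5 := le_exp_of_pow_le 7 2 (by norm_num) (by norm_num)
    (by norm_num) (by norm_num)
  have h8 : (8 : ℝ) ≤ Real.exp 2.1 := le_exp_of_pow_le 21 10 (by norm_num) (by norm_num)
    (by norm_num) (by norm_num)
  have h64 : (64 : ℝ) ≤ Real.exp 4.2 := by
    calc (64 : ℝ) = 8 ^ 2 := by norm_num
      _ ≤ Real.exp 2.1 ^ 2 := by gcongr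
      _ = _ := by rw [← Real.exp_nat_mul]; norm_num
  have hnum : (1728000000000000 : ℝ) ≤ Real.exp 36 := le_exp_of_pow_le 36 1 (by norm_num)
    (by norm_num) (by norm_num) (by norm_num)
  have h3 : D ^ 2 ≤ (12000000 * D ^ 4 * Cd * 64 ^ k) ^ 2 * (33 * 8 ^ k) ^ (d + 1) := by
    have e1 : D ^ 4 ≤ 12000000 * D ^ 4 * Cd * 64 ^ k := by
      have : 1 ≤ Cd * 64 ^ k := one_le_mul_of_one_le_of_one_le hC h64k
      nlinarith
    have e2 : D ^ 2 ≤ (D ^ 4) ^ 2 := by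
      rw [← pow_mul]; exact pow_le_pow_right₀ hD1 (by norm_num)
    have e3 : (1 : ℝ) ≤ (33 * 8 ^ k) ^ (d + 1) := one_le_pow₀ (by linarith)
    calc D ^ 2 ≤ (D ^ 4) ^ 2 * 1 := by rw [mul_one]; exact e2
      _ ≤ _ := by gcongr
  calc 2 * ((1 + 11579392 * D ^ 4 * Cd * 64 ^ k) ^ 2 * (1 + 32 * 8 ^ k) ^ (d + 1)) + D ^ 2
      ≤ 2 * ((12000000 * D ^ 4 * Cd * 64 ^ k) ^ 2 * (33 * 8 ^ k) ^ (d + 1)) +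
        (12000000 * D ^ 4 * Cd * 64 ^ k) ^ 2 * (33 * 8 ^ k) ^ (d + 1) := by gcongr
    _ = 3 * ((12000000 * D ^ 4 * Cd * 64 ^ k) ^ 2 * (33 * 8 ^ k) ^ (d + 1)) := by ring
    _ ≤ 3 * ((12000000 * Real.exp d ^ 4 * (2 * Real.exp (7.6 * d)) * Real.exp 4.2 ^ k) ^ 2 *
        (Real.exp 3.5 * Real.exp 2.1 ^ k) ^ (d + 1)) := by gcongr
    _ = 1728000000000000 * (Real.exp (23.2 * d + 8.4 * k + (3.5 + 2.1 * k) * D)) := by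
      simp only [← Real.exp_nat_mul, mul_pow, ← Real.exp_add]
      have e : Real.exp (23.2 * d + 8.4 * k + (3.5 + 2.1 * k) * D) =
        Real.exp (((2 : ℕ) : ℝ) * (((4 : ℕ) : ℝ) * d)) * Real.exp (((2 : ℕ) : ℝ) * (7.6 * d)) *
          Real.exp (((2 : ℕ) : ℝ) * (k * 4.2)) *
          (Real.exp (((d + 1 : ℕ) : ℝ) * (3.5 + k * 2.1))) := by
        rw [← Real.exp_add, ← Real.exp_add, ← Real.exp_add, hD]
        congr 1; push_cast; ring
      rw [e]; ring
    _ ≤ Real.exp 36 * (Real.exp (23.2 * d + 8.4 * k + (3.5 + 2.1 * k) * D)) := by gcongr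
    _ ≤ _ := by
      rw [← Real.exp_add, Real.exp_le_exp]
      have hd : (d : ℝ) = D - 1 := by rw [hD]; ring
      rw [hd]
      have hk : (0 : ℝ) ≤ k := Nat.cast_nonneg k
      nlinarith [mul_le_mul_of_nonneg_left hD1 hk]

variable {n : ℕ}

theorem rss_Icc_of_le (d : ℕ) (f : EuclideanSpace ℝ (Fin n)) {s t : Fin n} (h : t ≤ s) :
    rss d f (Finset.Icc s t) = 0 := by
  refine le_antisymm ?_ (rss_nonneg _ _ _)
  refine (rss_le f _ (q := Polynomial.C (f s)) (by simp)).trans (le_of_eq ?_)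
  refine Finset.sum_eq_zero fun i hi => ?_
  rw [Finset.mem_Icc] at hi
  rw [le_antisymm (hi.2.trans h) hi.1]
  simp

/-- Greedy choice of points such that any interval with large residual sum of squares contains one
of them, while intervals between two of them have large residual sums of squares. -/
theorem exists_greedy_points (d : ℕ) (f : EuclideanSpace ℝ (Fin n)) {Y : ℝ} (hY : 0 ≤ Y) :
    ∃ G : Finset (Fin n),
      (∀ s t, Y < rss d f (Finset.Icc s t) → ∃ g ∈ G, s < g ∧ g ≤ t) ∧
      ∀ g ∈ G, ∀ g' ∈ G, g < g' → Y < rss d f (Finset.Icc g g') := by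
  classical
  rcases Nat.eq_zero_or_pos n with rfl | hn
  · exact ⟨∅, fun s => s.elim0, fun g => g.elim0⟩
  have hmain : ∀ a : Fin n, ∃ G : Finset (Fin n), (∀ g ∈ G, a < g) ∧
      (∀ s t, a ≤ s → Y < rss d f (Finset.Icc s t) → ∃ g ∈ G, s < g ∧ g ≤ t) ∧
      (∀ g ∈ G, Y < rss d f (Finset.Icc a g)) ∧
      ∀ g ∈ G, ∀ g' ∈ G, g < g' → Y < rss d f (Finset.Icc g g') := by
    intro a
    induction a using WellFoundedGT.induction with
    | _ a ih =>
    -- The next point is the first t at which the interval from a exceeds level Y; the construction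
    -- restarts from that t.
    set P := Finset.univ.filter fun t => Y < rss d f (Finset.Icc a t) with hP
    have hmono : ∀ s t, a ≤ s → Y < rss d f (Finset.Icc s t) → t ∈ P := fun s t has h =>
      Finset.mem_filter.2 ⟨Finset.mem_univ _,
        h.trans_le (rss_mono (Finset.Icc_subset_Icc_left has))⟩
    rcases P.eq_empty_or_nonempty with he | hne
    · refine ⟨∅, by simp, fun s t has h => ?_, by simp, by simp⟩
      have := hmono s t has h
      rw [he] at this
      simp at this
    have ht₀ := (Finset.mem_filter.1 (P.min'_mem hne)).2
    set t₀ := P.min' hne with ht₀def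
    have hat : a < t₀ := by
      by_contra hcon
      rw [rss_Icc_of_le d f (not_lt.1 hcon)] at ht₀
      linarith
    obtain ⟨G, h1, h2, h3, h4⟩ := ih t₀ hat
    refine ⟨insert t₀ G, ?_, ?_, ?_, ?_⟩
    · intro g hg
      rcases Finset.mem_insert.1 hg with rfl | hg
      · exact hat
      · exact hat.trans (h1 g hg)
    · intro s t has h
      rcases lt_or_ge s t₀ with hs | hs
      · exact ⟨t₀, Finset.mem_insert_self _ _, hs, P.min'_le t (hmono s t has h)⟩
      · obtain ⟨g, hg, hgs⟩ := h2 s t hs h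
        exact ⟨g, Finset.mem_insert_of_mem hg, hgs⟩
    · intro g hg
      refine ht₀.trans_le (rss_mono (Finset.Icc_subset_Icc_right ?_))
      rcases Finset.mem_insert.1 hg with rfl | hg
      · exact le_rfl
      · exact (h1 g hg).le
    · intro g hg g' hg' hlt
      rcases Finset.mem_insert.1 hg with hgt | hg <;> rcases Finset.mem_insert.1 hg' with hgt' | hg'
      · rw [hgt, hgt'] at hlt; exact absurd hlt (lt_irrefl _)
      · rw [hgt]; exact h3 g' hg'
      · rw [hgt'] at hlt; exact absurd (h1 g hg) (not_lt.2 hlt.le)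
      · exact h4 g hg g' hg' hlt
  obtain ⟨G, -, h2, -, h4⟩ := hmain ⟨0, hn⟩
  exact ⟨G, fun s t h => h2 s t (Fin.le_def.2 (Nat.zero_le _)) h, h4⟩

/-- Intervals between consecutive greedy points share endpoints, so points are consumed in pairs: 2k
of them give k disjoint intervals, and `rss_add_le` adds these up. -/
theorem mul_le_rss_of_points {d : ℕ} {f : EuclideanSpace ℝ (Fin n)} {Y : ℝ} {G : Finset (Fin n)}
    (hG : ∀ g ∈ G, ∀ g' ∈ G, g < g' → Y < rss d f (Finset.Icc g g')) (k : ℕ) :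
    ∀ {A H : Finset (Fin n)}, (A : Set (Fin n)).OrdConnected → H ⊆ G → H ⊆ A → 2 * k ≤ H.card →
      k * Y ≤ rss d f A := by
  classical
  induction k with
  | zero => intro A H _ _ _ _; simpa using rss_nonneg d f A
  | succ k ih =>
    intro A H hA hHG hHA hcard
    have hne : H.Nonempty := Finset.card_pos.1 (by omega)
    set g := H.min' hne with hg
    have hgH : g ∈ H := H.min'_mem hne
    have hne' : (H.erase g).Nonempty := Finset.card_pos.1 (by
      rw [Finset.card_erase_of_mem hgH]; omega)
    set g' := (H.erase g).min' hne' with hg'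
    have hg'H : g' ∈ H.erase g := Finset.min'_mem _ hne'
    have hg'H' := Finset.mem_of_mem_erase hg'H
    have hlt : g < g' := lt_of_le_of_ne (H.min'_le g' hg'H') (Finset.ne_of_mem_erase hg'H).symm
    have h1 := hG g (hHG hgH) g' (hHG hg'H') hlt
    set A' := A.filter fun i => g' < i with hA'
    have hA'o : (A' : Set (Fin n)).OrdConnected := by
      refine ⟨fun x hx y hy z hz => ?_⟩
      rw [hA', Finset.coe_filter] at hx hy ⊢
      exact ⟨hA.out hx.1 hy.1 hz, hx.2.trans_le hz.1⟩
    have h2 := ih (A := A') (H := (H.erase g).erase g') hA'o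
      ((Finset.erase_subset _ _).trans ((Finset.erase_subset _ _).trans hHG))
      (fun i hi => Finset.mem_filter.2
        ⟨hHA (Finset.mem_of_mem_erase (Finset.mem_of_mem_erase hi)),
          lt_of_le_of_ne (Finset.min'_le _ i (Finset.mem_of_mem_erase hi))
            (Finset.ne_of_mem_erase hi).symm⟩)
      (by rw [Finset.card_erase_of_mem hg'H, Finset.card_erase_of_mem hgH]; omega)
    have h3 : rss d f (Finset.Icc g g') + rss d f A' ≤ rss d f A := by
      refine rss_add_le ?_ ?_ (Finset.filter_subset _ _)
      · rw [Finset.disjoint_left]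
        intro i hi hi'
        exact absurd (Finset.mem_filter.1 hi').2 (not_lt.2 (Finset.mem_Icc.1 hi).2)
      · intro i hi
        exact mem_of_ordConnected hA (hHA hgH) (hHA hg'H') (Finset.mem_Icc.1 hi).1
          (Finset.mem_Icc.1 hi).2
    push_cast
    linarith

/-- The number of greedy points is controlled by the cost of any cell family. -/
theorem IsCellFamily.card_points_le {d : ℕ} {f : EuclideanSpace ℝ (Fin n)} {Y α τ : ℝ}
    {G : Finset (Fin n)}
    (hG : ∀ g ∈ G, ∀ g' ∈ G, g < g' → Y < rss d f (Finset.Icc g g'))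
    {C : Finset (Finset (Fin n))} (hC : IsCellFamily d C) (hα : 0 ≤ α) (hY : 0 ≤ Y) (hτ : 0 ≤ τ) :
    min (α * Y) τ * (G.card : ℝ) ≤ 2 * ∑ A ∈ C, (α * rss d f A + τ) := by
  classical
  set μ₀ := min (α * Y) τ with hμ₀
  have hμ0 : 0 ≤ μ₀ := le_min (by positivity) hτ
  have hcard : (G.card : ℝ) ≤ ∑ A ∈ C, ((G ∩ A).card : ℝ) := by
    have : G ⊆ C.biUnion fun A => G ∩ A := by
      intro g hg
      obtain ⟨A, hA, hgA⟩ := hC.cover g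
      exact Finset.mem_biUnion.2 ⟨A, hA, Finset.mem_inter.2 ⟨hg, hgA⟩⟩
    exact_mod_cast (Finset.card_le_card this).trans Finset.card_biUnion_le
  calc μ₀ * (G.card : ℝ) ≤ μ₀ * ∑ A ∈ C, ((G ∩ A).card : ℝ) := by gcongr
    _ = ∑ A ∈ C, μ₀ * ((G ∩ A).card : ℝ) := Finset.mul_sum _ _ _
    _ ≤ ∑ A ∈ C, 2 * (α * rss d f A + τ) := by
      refine Finset.sum_le_sum fun A hA => ?_
      have h1 := mul_le_rss_of_points hG ((G ∩ A).card / 2) (hC.ordConnected A hA)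
        Finset.inter_subset_left Finset.inter_subset_right (Nat.mul_div_le _ _)
      -- A point left unpaired in the cell is paid for by τ.
      have h2 : ((G ∩ A).card : ℝ) ≤ 2 * (((G ∩ A).card / 2 : ℕ) : ℝ) + 1 := by
        have : (G ∩ A).card ≤ 2 * ((G ∩ A).card / 2) + 1 := by omega
        exact_mod_cast this
      set p : ℝ := (((G ∩ A).card / 2 : ℕ) : ℝ) with hp
      have hp0 : 0 ≤ p := Nat.cast_nonneg _
      have h3 : μ₀ * p ≤ α * Y * p := by gcongr; exact min_le_left _ _
      have h4 : μ₀ ≤ τ := min_le_right _ _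
      have h5 : α * (p * Y) ≤ α * rss d f A := by gcongr
      have h6 : μ₀ * ((G ∩ A).card : ℝ) ≤ μ₀ * (2 * p + 1) := by gcongr
      nlinarith
    _ = _ := (Finset.mul_sum _ _ _).symm

theorem sum_pow_natAbs_le (s : Finset ℤ) {r : ℝ} (hr : 0 ≤ r) (hr1 : r < 1) :
    ∑ l ∈ s, r ^ l.natAbs ≤ 2 / (1 - r) := by
  classical
  have hgeo : ∀ t : Finset ℕ, ∑ k ∈ t, r ^ k ≤ 1 / (1 - r) := fun t => by
    rw [one_div, ← tsum_geometric_of_lt_one hr hr1]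
    exact (summable_geometric_of_lt_one hr hr1).sum_le_tsum t fun k _ => by positivity
  have hpart : ∀ p : ℤ → Prop, [DecidablePred p] → Set.InjOn Int.natAbs {l | p l} →
      ∑ l ∈ s.filter p, r ^ l.natAbs ≤ 1 / (1 - r) := by
    intro p _ hp
    rw [← Finset.sum_image (f := fun k => r ^ k) (g := Int.natAbs)]
    · exact hgeo _
    · intro x hx y hy hxy
      exact hp (Finset.mem_filter.1 (Finset.mem_coe.1 hx)).2
        (Finset.mem_filter.1 (Finset.mem_coe.1 hy)).2 hxy
  rw [← Finset.sum_filter_add_sum_filter_not s fun l => 0 ≤ l]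
  have h1 := hpart (fun l => 0 ≤ l) fun x hx y hy hxy => by
    simp only [Set.mem_ofPred_eq] at hx hy; omega
  have h2 := hpart (fun l => ¬ 0 ≤ l) fun x hx y hy hxy => by
    simp only [Set.mem_ofPred_eq] at hx hy; omega
  rw [show 2 / (1 - r) = 1 / (1 - r) + 1 / (1 - r) by ring]
  exact add_le_add h1 h2

theorem zpow_add_inv_eq (l : ℤ) :
    (2 : ℝ) ^ l + ((2 : ℝ) ^ l)⁻¹ = 2 ^ l.natAbs + ((2 : ℝ) ^ l.natAbs)⁻¹ := by
  rcases Int.natAbs_eq l with h | h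
  · conv_lhs => rw [h]
    rw [zpow_natCast]
  · conv_lhs => rw [h]
    rw [zpow_neg, zpow_natCast, inv_inv, add_comm]

/-- With k the absolute value of the level, 47 + 2k combines the entropy 42 with the exponent 5 +
2k. The imbalance of the two cost terms grows like 2^k and beats this quadratic; 0.0703125 is
0.28125/4 from `level_dev_le`. -/
theorem level_deviation_le (k : ℕ) :
    2 * (47 + 2 * (k : ℝ)) + 3.19 / 40 * (47 + 2 * (k : ℝ)) ^ 2 ≤
      0.0703125 * 1020 * (2 + (2 ^ k + ((2 : ℝ) ^ k)⁻¹)) := by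
  rcases Nat.lt_or_ge k 2 with hk | hk
  · interval_cases k <;> norm_num
  · have h1 : ∀ k : ℕ, 1 + (k : ℝ) + k * (k - 1) / 2 ≤ 2 ^ k := by
      intro k
      induction k with
      | zero => norm_num
      | succ k ih =>
        rw [pow_succ]; push_cast
        have h0 : (1 : ℝ) + k ≤ 2 ^ k := by
          have := one_add_mul_le_pow (show (-2 : ℝ) ≤ 1 by norm_num) k
          norm_num at this
          linarith
        nlinarith
    have h2 : (0 : ℝ) ≤ ((2 : ℝ) ^ k)⁻¹ := by positivity
    have h3 : (2 : ℝ) ≤ k := by exact_mod_cast hk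
    have := h1 k
    nlinarith

end

/-! ### Fluctuations along the residuals, uniformly over cell families. -/

section

variable {n : ℕ} {Ω : Type*} [MeasurableSpace Ω] {μ : Measure Ω} [IsProbabilityMeasure μ]
  {σ c Λ : ℝ} {ξ : Ω → EuclideanSpace ℝ (Fin n)}

/-- A condition on squares that gives the deviation hypothesis of the class bound. -/
theorem level_dev_le {Y α τ z δ : ℝ} (hα : 0 < α) (hτ : 0 < τ) (hz : 0 < z)
    (hYz : α * Y = z * τ)
    (h : δ ^ 2 ≤ 0.28125 * (α * τ) * ((2 + (z + z⁻¹)) / 4)) :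
    2.4 * √(2 * Y) * δ ≤ 0.9 * (α * Y + τ) := by
  have hY : Y = z * τ / α := by field_simp; linarith
  have hY0 : 0 < Y := by rw [hY]; positivity
  have hs : √(2 * Y) ^ 2 = 2 * Y := Real.sq_sqrt (by positivity)
  refine (le_abs_self _).trans (abs_le_of_sq_le_sq ?_ (by positivity))
  have e1 : (2.4 * √(2 * Y) * δ) ^ 2 = 11.52 * Y * δ ^ 2 := by
    rw [mul_pow, mul_pow, hs]; ring
  rw [e1]
  calc 11.52 * Y * δ ^ 2 ≤ 11.52 * Y * (0.28125 * (α * τ) * ((2 + (z + z⁻¹)) / 4)) := by gcongr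
    _ = (0.9 * (α * Y + τ)) ^ 2 := by
      rw [hYz, hY]; field_simp; ring

set_option maxHeartbeats 1000000 in
/-- Control of all the cells of a collection of cell families: the fluctuations along the residuals
are dominated, up to a random variable with nonpositive mean, by the costs of the cells. -/
theorem IsNoise.exists_cell_bound (h : IsNoise μ σ c ξ) (hσ : 0 < σ) (hc : 0 < c) (hΛ : 0 < Λ)
    (hn : 0 < n) {S₀ : Submodule ℝ (EuclideanSpace ℝ (Fin n))}
    (hS₀ : ∀ v ∈ S₀, ∀ i, |v i| ≤ Λ * ‖v‖) {d : ℕ} {f : EuclideanSpace ℝ (Fin n)} {α τ V L : ℝ}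
    (hα : 0 < α) (hτ : 0 < τ) (hL : 1 / 2 ≤ L) (hnL : (n : ℝ) ≤ Real.exp L) (hV : σ ^ 2 ≤ V)
    (hcΛ : (c * Λ) ^ 2 ≤ 3.19 / L * (V - σ ^ 2)) (hατ : 1020 * ((d : ℝ) + 1) * V ≤ α * τ)
    (𝒞 : Finset (Finset (Finset (Fin n)))) (h𝒞 : ∀ C ∈ 𝒞, IsCellFamily d C)
    (hres : ∀ C ∈ 𝒞, ∀ A ∈ C, res d A f ∈ S₀) :
    ∃ W : Ω → ℝ, Integrable W μ ∧ ∫ ω, W ω ∂μ ≤ 0 ∧ ∀ ω, ∀ C ∈ 𝒞,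
      ∑ A ∈ C, (-2 * inner ℝ (ξ ω) (res d A f) - α * rss d f A - τ) ≤ W ω := by
  classical
  have hV0 : 0 < V := lt_of_lt_of_le (by positivity) hV
  have hL0 : 0 < L := by linarith
  set D : ℝ := (d : ℝ) + 1 with hD
  have hD1 : 1 ≤ D := by rw [hD]; linarith [(Nat.cast_nonneg d : (0 : ℝ) ≤ d)]
  set 𝓘 := (𝒞.biUnion id).filter fun A => 0 < rss d f A with h𝓘
  have hmem𝓘 : ∀ C ∈ 𝒞, ∀ A ∈ C, 0 < rss d f A → A ∈ 𝓘 := fun C hC A hA hpos =>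
    Finset.mem_filter.2 ⟨Finset.mem_biUnion.2 ⟨C, hC, hA⟩, hpos⟩
  have h𝓘' : ∀ A ∈ 𝓘, (A : Set (Fin n)).OrdConnected ∧ A.Nonempty ∧ res d A f ∈ S₀ ∧
      0 < rss d f A := by
    intro A hA
    obtain ⟨h1, h2⟩ := Finset.mem_filter.1 hA
    obtain ⟨C, hC, hAC⟩ := Finset.mem_biUnion.1 h1
    exact ⟨(h𝒞 C hC).ordConnected A hAC, Finset.card_pos.1
      (Nat.lt_of_lt_of_le (Nat.succ_pos d) ((h𝒞 C hC).le_card A hAC)), hres C hC A hAC, h2⟩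
  have hsq : ∀ y, 0 ≤ y → dev σ c Λ y ^ 2 ≤ V * (2 * y + 3.19 / L * y ^ 2) := fun y hy =>
    sq_dev_le hV (by positivity) hcΛ hy
  -- For small L, the factor n² of a union bound is affordable because ατ ≥ 1020 D V. For large L,
  -- the coefficient 3.19/L is at most 3.19/(40 D), and entropy of order D, free of n, is
  -- affordable.
  rcases lt_or_ge L (40 * D) with hLD | hLD
  · -- union bound over all the cells
    refine h.exists_gain_bound hτ.le 𝒞 𝓘 (fun A => {A})
      (fun C hC => ⟨id, fun A hA hpos => ⟨hmem𝓘 C hC A hA hpos, Finset.mem_singleton_self A⟩,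
        fun A _ B _ _ _ hAB => hAB⟩) fun C hC => ?_
    have hone : ∀ A ∈ 𝓘, ∫ ω, supPos {A} (gain ξ d f α τ) ω ∂μ ≤
        0.9 * τ * Real.exp (-(2 * L + 3)) := by
      intro A hA
      refine h.integral_supPos_singleton_le hσ hΛ hS₀ hα hτ (h𝓘' A hA).2.2.1 (h𝓘' A hA).2.2.2
        (by linarith) ((hsq _ (by linarith)).trans ?_)
      have h1 : 3.19 / L * (2 * L + 3) ^ 2 ≤ 3.19 * (4 * L + 12 + 18) := by
        have : (2 * L + 3) ^ 2 / L ≤ 4 * L + 12 + 18 := by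
          rw [div_le_iff₀ hL0]; nlinarith
        calc 3.19 / L * (2 * L + 3) ^ 2 = 3.19 * ((2 * L + 3) ^ 2 / L) := by ring
          _ ≤ _ := by gcongr
      have h2 : 2 * (2 * L + 3) + 3.19 / L * (2 * L + 3) ^ 2 ≤ 0.81 * (1020 * D) := by linarith
      calc V * (2 * (2 * L + 3) + 3.19 / L * (2 * L + 3) ^ 2) ≤ V * (0.81 * (1020 * D)) := by gcongr
        _ ≤ _ := by nlinarith
    have hcard : (𝓘.card : ℝ) ≤ Real.exp (2 * L) := by
      have h1 : 𝓘.card ≤ n ^ 2 := card_intervals_le 𝓘 fun A hA => ⟨(h𝓘' A hA).1, (h𝓘' A hA).2.1⟩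
      calc (𝓘.card : ℝ) ≤ (n : ℝ) ^ 2 := by exact_mod_cast h1
        _ ≤ Real.exp L ^ 2 := by gcongr
        _ = _ := by rw [← Real.exp_nat_mul]; norm_num
    obtain ⟨A₀, hA₀⟩ := (h𝒞 C hC).nonempty hn
    have hcost : τ ≤ ∑ A ∈ C, (α * rss d f A + τ) := by
      have h0 : ∀ A ∈ C, 0 ≤ α * rss d f A + τ := fun A _ => by
        have := rss_nonneg d f A; positivity
      refine le_trans ?_ (Finset.single_le_sum h0 hA₀)
      have := rss_nonneg d f A₀
      nlinarith
    have he : Real.exp (2 * L) * Real.exp (-(2 * L + 3)) = Real.exp (-3) := by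
      rw [← Real.exp_add]; congr 1; ring
    have he3 : Real.exp (-3) ≤ 1 / 10 := by
      rw [Real.exp_neg, one_div]
      exact inv_anti₀ (by norm_num) (le_exp_of_pow_le 3 1 (by norm_num) (by norm_num)
        (by norm_num) (by norm_num))
    calc ∑ A ∈ 𝓘, ∫ ω, supPos {A} (gain ξ d f α τ) ω ∂μ
        ≤ 𝓘.card • (0.9 * τ * Real.exp (-(2 * L + 3))) := Finset.sum_le_card_nsmul _ _ _ hone
      _ = 𝓘.card * (0.9 * τ * Real.exp (-(2 * L + 3))) := nsmul_eq_mul _ _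
      _ ≤ Real.exp (2 * L) * (0.9 * τ * Real.exp (-(2 * L + 3))) := by gcongr
      _ = 0.9 * τ * Real.exp (-3) := by rw [← he]; ring
      _ ≤ 0.9 * τ * (1 / 10) := by gcongr
      _ ≤ _ := by linarith
  · -- classes of cells with comparable residual sums of squares around a greedy point
    -- Level 0 balances αY = τ; at level l the ratio of the two cost terms is 2^l.
    set Y : ℤ → ℝ := fun l => 2 ^ l * (τ / α) with hYdef
    have hY0 : ∀ l, 0 < Y l := fun l => by simp only [Y]; positivity
    have hYz : ∀ l, α * Y l = 2 ^ l * τ := fun l => by simp only [Y]; field_simp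
    have hY2 : ∀ l, Y (l + 1) = 2 * Y l := fun l => by
      simp only [Y]; rw [zpow_add_one₀ two_ne_zero]; ring
    choose G hG1 hG2 using fun l => exists_greedy_points d f (hY0 l).le
    have hlevel : ∀ A, ∃ l : ℤ, 0 < rss d f A → Y l < rss d f A ∧ rss d f A ≤ 2 * Y l := by
      intro A
      by_cases hpos : 0 < rss d f A
      · obtain ⟨l, hl1, hl2⟩ := exists_mem_Ioc_zpow (y := (2 : ℝ)) (x := rss d f A / (τ / α))
          (by positivity) one_lt_two
        refine ⟨l, fun _ => ⟨?_, ?_⟩⟩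
        · rwa [lt_div_iff₀ (by positivity)] at hl1
        · rw [← hY2]; rwa [div_le_iff₀ (by positivity)] at hl2
      · exact ⟨0, fun h => absurd h hpos⟩
    choose lev hlev using hlevel
    have hpoint : ∀ A, ∃ g : Fin n, A ∈ 𝓘 → g ∈ G (lev A) ∧ g ∈ A := by
      intro A
      by_cases hA : A ∈ 𝓘
      · obtain ⟨ho, hne, -, hpos⟩ := h𝓘' A hA
        have hAI : A ⊆ Finset.Icc (A.min' hne) (A.max' hne) := fun i hi =>
          Finset.mem_Icc.2 ⟨A.min'_le i hi, A.le_max' i hi⟩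
        obtain ⟨g, hg, h1, h2⟩ := hG1 (lev A) _ _ ((hlev A hpos).1.trans_le (rss_mono hAI))
        exact ⟨g, fun _ => ⟨hg, mem_of_ordConnected ho (A.min'_mem hne) (A.max'_mem hne) h1.le h2⟩⟩
      · exact ⟨⟨0, hn⟩, fun h => absurd h hA⟩
    choose pt hpt using hpoint
    set Ls := 𝓘.image lev with hLs
    set T : (Σ _ : ℤ, Fin n) → Finset (Finset (Fin n)) := fun p => 𝓘.filter fun A =>
      p.2 ∈ A ∧ Y p.1 ≤ rss d f A ∧ rss d f A ≤ 2 * Y p.1 with hT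
    refine h.exists_gain_bound hτ.le 𝒞 (Ls.sigma G) T
      (fun C hC => ⟨fun A => ⟨lev A, pt A⟩, fun A hA hpos => ?_, fun A hA B hB hA0 hB0 hAB => ?_⟩)
      fun C hC => ?_
    · have hA𝓘 := hmem𝓘 C hC A hA hpos
      exact ⟨Finset.mem_sigma.2 ⟨Finset.mem_image_of_mem _ hA𝓘, (hpt A hA𝓘).1⟩,
        Finset.mem_filter.2 ⟨hA𝓘, (hpt A hA𝓘).2, (hlev A hpos).1.le, (hlev A hpos).2⟩⟩
    · have h1 := (hpt A (hmem𝓘 C hC A hA hA0)).2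
      have h2 := (hpt B (hmem𝓘 C hC B hB hB0)).2
      have h3 : pt A = pt B := by
        have := (Sigma.mk.inj_iff.1 hAB).2
        exact eq_of_heq this
      exact (h𝒞 C hC).eq_of_mem A hA B hB (pt A) h1 (h3 ▸ h2)
    -- The extra exponent 2|l| pays for the imbalance. There are at most 2 cost/min(αY, τ) points at
    -- level l, and max/min = 2^|l|, so the sum over levels is geometric with ratio 2 exp(-2).
    · have hclass : ∀ p : Σ _ : ℤ, Fin n, ∫ ω, supPos (T p) (gain ξ d f α τ) ω ∂μ ≤
          max τ (α * Y p.1) * Real.exp (-(5 + 2 * (p.1.natAbs : ℝ))) := by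
        rintro ⟨l, g⟩
        have hTp : ∀ A ∈ T ⟨l, g⟩, A ∈ 𝓘 ∧ g ∈ A ∧ Y l ≤ rss d f A ∧ rss d f A ≤ 2 * Y l :=
          fun A hA => Finset.mem_filter.1 hA
        have hk0 : (0 : ℝ) ≤ (l.natAbs : ℝ) := Nat.cast_nonneg _
        refine h.integral_supPos_class_le hσ hc hΛ hS₀ hα hτ (T ⟨l, g⟩)
          (fun A hA => (h𝓘' A (hTp A hA).1).2.2.1) (hY0 l) (fun A hA => (hTp A hA).2.2)
          (H := 42 * D) (by positivity) (by linarith) ?_ ?_ ?_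
        · have h1 := le_max_left τ (α * Y l)
          have h2 := le_max_right τ (α * Y l)
          linarith
        · refine level_dev_le hα hτ (z := 2 ^ l) (by positivity) (hYz l) ?_
          rw [zpow_add_inv_eq]
          set k := l.natAbs
          have hy : 42 * D + (5 + 2 * (k : ℝ)) ≤ (47 + 2 * (k : ℝ)) * D := by nlinarith
          have h1 : dev σ c Λ (42 * D + (5 + 2 * (k : ℝ))) ^ 2 ≤
              V * (2 * ((47 + 2 * (k : ℝ)) * D) + 3.19 / L * ((47 + 2 * (k : ℝ)) * D) ^ 2) := by
            refine (hsq _ (by positivity)).trans ?_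
            gcongr
          have h2 : 3.19 / L * ((47 + 2 * (k : ℝ)) * D) ^ 2 ≤
              3.19 / 40 * (47 + 2 * (k : ℝ)) ^ 2 * D := by
            calc 3.19 / L * ((47 + 2 * (k : ℝ)) * D) ^ 2
                ≤ 3.19 / (40 * D) * ((47 + 2 * (k : ℝ)) * D) ^ 2 := by gcongr
              _ = _ := by field_simp
          have h3 := level_deviation_le k
          set q : ℝ := 2 + (2 ^ k + ((2 : ℝ) ^ k)⁻¹) with hq
          have hq0 : 0 < q := by positivity
          calc dev σ c Λ (42 * D + (5 + 2 * (k : ℝ))) ^ 2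
              ≤ V * (2 * ((47 + 2 * (k : ℝ)) * D) + 3.19 / 40 * (47 + 2 * (k : ℝ)) ^ 2 * D) :=
                h1.trans (by gcongr)
            _ = (V * D) * (2 * (47 + 2 * (k : ℝ)) + 3.19 / 40 * (47 + 2 * (k : ℝ)) ^ 2) := by ring
            _ ≤ (V * D) * (0.0703125 * 1020 * q) := by gcongr
            _ = 0.0703125 * q * (1020 * D * V) := by ring
            _ ≤ 0.0703125 * q * (α * τ) := by gcongr
            _ = _ := by ring
        · intro k N hN hsep
          refine (card_separated_class_le (Y := Y l) (ε := √(2 * Y l) / 8 ^ (k + 1))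
            (fun A hA => ⟨(h𝓘' A (hTp A (hN hA)).1).1, (hTp A (hN hA)).2.1⟩) (hY0 l).le
            (fun A hA => (hTp A (hN hA)).2.2.2) (by have := hY0 l; positivity) hsep).trans ?_
          refine le_trans (le_of_eq ?_) (separation_count_le_exp d k)
          have hs : √(2 * Y l) ^ 2 = 2 * Y l := Real.sq_sqrt (by have := hY0 l; positivity)
          have hs0 : 0 < √(2 * Y l) := by have := hY0 l; positivity
          have hYl := hY0 l
          have e1 : 4 * √(2 * Y l) / (√(2 * Y l) / 8 ^ (k + 1)) = 32 * 8 ^ k := by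
            rw [pow_succ]; field_simp; norm_num
          have e2 : 514 * ((d : ℝ) + 1) ^ 4 * (22 * doublingConst d * Y l) *
              (32 / (√(2 * Y l) / 8 ^ (k + 1)) ^ 2) =
              11579392 * ((d : ℝ) + 1) ^ 4 * doublingConst d * 64 ^ k := by
            have e3 : (8 : ℝ) ^ (k + 1) * 8 ^ (k + 1) = 64 * 64 ^ k := by
              rw [← mul_pow, pow_succ]; norm_num; ring
            rw [div_pow, hs, sq ((8 : ℝ) ^ (k + 1)), e3]
            field_simp
            ring
          rw [e1, e2]
      set cost := ∑ A ∈ C, (α * rss d f A + τ) with hcost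
      have hcost0 : 0 ≤ cost := Finset.sum_nonneg fun A _ => by
        have := rss_nonneg d f A; positivity
      set r : ℝ := 2 * Real.exp (-2) with hr
      have he2 : Real.exp (-2) ≤ 1 / 7 := by
        rw [Real.exp_neg, one_div]
        exact inv_anti₀ (by norm_num) (le_exp_of_pow_le 2 1 (by norm_num) (by norm_num)
          (by norm_num) (by norm_num))
      have he5 : Real.exp (-5) ≤ 1 / 100 := by
        rw [Real.exp_neg, one_div]
        exact inv_anti₀ (by norm_num) (le_exp_of_pow_le 5 1 (by norm_num) (by norm_num)
          (by norm_num) (by norm_num))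
      have hr0 : 0 ≤ r := by positivity
      have hr1 : r ≤ 2 / 7 := by rw [hr]; linarith
      have hone : ∀ l : ℤ, ∑ g ∈ G l, ∫ ω, supPos (T ⟨l, g⟩) (gain ξ d f α τ) ω ∂μ ≤
          2 * cost * Real.exp (-5) * r ^ l.natAbs := by
        intro l
        have hpts := (h𝒞 C hC).card_points_le (hG2 l) hα.le (hY0 l).le hτ.le
        rw [← hcost] at hpts
        have hmm : max τ (α * Y l) ≤ 2 ^ l.natAbs * min (α * Y l) τ := by
          rw [hYz]
          rcases Int.natAbs_eq l with hl | hl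
          · have e : (2 : ℝ) ^ l = 2 ^ l.natAbs := by
              conv_lhs => rw [hl]
              exact zpow_natCast _ _
            rw [e]
            have h1 : (1 : ℝ) ≤ 2 ^ l.natAbs := one_le_pow₀ one_le_two
            rw [min_eq_right (by nlinarith), max_eq_right (by nlinarith)]
          · have e : (2 : ℝ) ^ l = (2 ^ l.natAbs)⁻¹ := by
              conv_lhs => rw [hl]
              rw [zpow_neg, zpow_natCast]
            rw [e]
            have h1 : (1 : ℝ) ≤ 2 ^ l.natAbs := one_le_pow₀ one_le_two
            have h2 : ((2 : ℝ) ^ l.natAbs)⁻¹ ≤ 1 := inv_le_one_of_one_le₀ h1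
            rw [min_eq_left (by nlinarith), max_eq_left (by nlinarith)]
            rw [mul_inv_cancel_left₀ (by positivity)]
        have hexp : Real.exp (-(5 + 2 * (l.natAbs : ℝ))) =
            Real.exp (-5) * Real.exp (-2) ^ l.natAbs := by
          rw [← Real.exp_nat_mul, ← Real.exp_add]; congr 1; ring
        calc ∑ g ∈ G l, ∫ ω, supPos (T ⟨l, g⟩) (gain ξ d f α τ) ω ∂μ
            ≤ (G l).card • (max τ (α * Y l) * Real.exp (-(5 + 2 * (l.natAbs : ℝ)))) :=
              Finset.sum_le_card_nsmul _ _ _ fun g _ => hclass ⟨l, g⟩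
          _ = (G l).card * (max τ (α * Y l) * Real.exp (-(5 + 2 * (l.natAbs : ℝ)))) :=
              nsmul_eq_mul _ _
          _ ≤ (G l).card * (2 ^ l.natAbs * min (α * Y l) τ *
              Real.exp (-(5 + 2 * (l.natAbs : ℝ)))) := by gcongr
          _ = (min (α * Y l) τ * (G l).card) *
              (2 ^ l.natAbs * Real.exp (-(5 + 2 * (l.natAbs : ℝ)))) := by ring
          _ ≤ (2 * cost) * (2 ^ l.natAbs * Real.exp (-(5 + 2 * (l.natAbs : ℝ)))) := by gcongr
          _ = _ := by rw [hexp, hr, mul_pow]; ring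
      rw [Finset.sum_sigma]
      calc ∑ l ∈ Ls, ∑ g ∈ G l, ∫ ω, supPos (T ⟨l, g⟩) (gain ξ d f α τ) ω ∂μ
          ≤ ∑ l ∈ Ls, 2 * cost * Real.exp (-5) * r ^ l.natAbs := Finset.sum_le_sum fun l _ => hone l
        _ = 2 * cost * Real.exp (-5) * ∑ l ∈ Ls, r ^ l.natAbs := (Finset.mul_sum _ _ _).symm
        _ ≤ 2 * cost * (1 / 100) * (2 / (1 - r)) := by
            gcongr
            exact sum_pow_natAbs_le Ls hr0 (by linarith)
        _ ≤ 2 * cost * (1 / 100) * (2 / (1 - 2 / 7)) := by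
            gcongr
        _ ≤ _ := by
            norm_num
            linarith

end

/-! ### Projection identities and choice of constants. -/

section

variable {n : ℕ}

section Projections

variable {S S₀ : Submodule ℝ (EuclideanSpace ℝ (Fin n))}

theorem starProjection_eq_of_le (hS : S ≤ S₀) (f : EuclideanSpace ℝ (Fin n)) :
    S.starProjection (S₀.starProjection f) = S.starProjection f := by
  rw [← sub_eq_zero, ← map_sub, Submodule.starProjection_apply_eq_zero_iff]
  intro v hv
  rw [← neg_sub, inner_neg_right, real_inner_comm, neg_eq_zero]
  exact Submodule.starProjection_inner_eq_zero f v (hS hv)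

theorem inner_sub_starProjection (f : EuclideanSpace ℝ (Fin n)) {v : EuclideanSpace ℝ (Fin n)}
    (hv : v ∈ S) : inner ℝ (f - S.starProjection f) v = 0 :=
  Submodule.starProjection_inner_eq_zero f v hv

theorem inner_starProjection_self (x : EuclideanSpace ℝ (Fin n)) :
    inner ℝ x (S.starProjection x) = ‖S.starProjection x‖ ^ 2 := by
  have h := inner_sub_starProjection x (S.starProjection_apply_mem x)
  rw [inner_sub_left, real_inner_self_eq_norm_sq] at h
  linarith

/-- The loss of the least squares estimator. -/
theorem norm_sq_sub_starProjection_add (hS : S ≤ S₀) (f x : EuclideanSpace ℝ (Fin n)) :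
    ‖f - S.starProjection (f + x)‖ ^ 2 = ‖f - S₀.starProjection f‖ ^ 2 +
      (‖S₀.starProjection f - S.starProjection (S₀.starProjection f)‖ ^ 2 +
        ‖S.starProjection x‖ ^ 2) := by
  set f₀ := S₀.starProjection f with hf₀
  set w := f₀ - S.starProjection f₀ with hw
  have hp : S.starProjection f = S.starProjection f₀ := (starProjection_eq_of_le hS f).symm
  have hwS : w ∈ S₀ := S₀.sub_mem (S₀.starProjection_apply_mem f)
    (hS (S.starProjection_apply_mem _))
  have hzS := S.starProjection_apply_mem x
  have h1 : inner ℝ (f - f₀) w = 0 := inner_sub_starProjection f hwS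
  have h2 : inner ℝ (f - f₀) (S.starProjection x) = 0 := inner_sub_starProjection f (hS hzS)
  have h3 : inner ℝ w (S.starProjection x) = 0 := inner_sub_starProjection f₀ hzS
  have e : f - S.starProjection (f + x) = (f - f₀) + (w - S.starProjection x) := by
    rw [map_add, hp, hw]; abel
  rw [e, norm_add_sq_real (f - f₀), norm_sub_sq_real w, inner_sub_right (f - f₀) w, h1, h2, h3]
  ring

/-- The residual sum of squares of the least squares estimator. -/
theorem norm_sq_add_sub_starProjection (hS : S ≤ S₀) (f x : EuclideanSpace ℝ (Fin n)) :
    ‖f + x - S.starProjection (f + x)‖ ^ 2 =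
      (‖f - S₀.starProjection f‖ ^ 2 + 2 * inner ℝ x (f - S₀.starProjection f) + ‖x‖ ^ 2) +
      (‖S₀.starProjection f - S.starProjection (S₀.starProjection f)‖ ^ 2 +
        2 * inner ℝ x (S₀.starProjection f - S.starProjection (S₀.starProjection f)) -
        ‖S.starProjection x‖ ^ 2) := by
  set f₀ := S₀.starProjection f with hf₀
  set w := f₀ - S.starProjection f₀ with hw
  have hp : S.starProjection f = S.starProjection f₀ := (starProjection_eq_of_le hS f).symm
  have hwS : w ∈ S₀ := S₀.sub_mem (S₀.starProjection_apply_mem f)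
    (hS (S.starProjection_apply_mem _))
  have hzS := S.starProjection_apply_mem x
  have h1 : inner ℝ (f - f₀) w = 0 := inner_sub_starProjection f hwS
  have h2 : inner ℝ (f - f₀) (S.starProjection x) = 0 := inner_sub_starProjection f (hS hzS)
  have h3 : inner ℝ w (S.starProjection x) = 0 := inner_sub_starProjection f₀ hzS
  have h4 := inner_starProjection_self (S := S) x
  have e : f + x - S.starProjection (f + x) = (f - f₀) + (w + (x - S.starProjection x)) := by
    rw [map_add, hp, hw]; abel
  rw [e, norm_add_sq_real (f - f₀), norm_add_sq_real w, norm_sub_sq_real x,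
    inner_add_right (f - f₀) w, inner_sub_right (f - f₀) x, inner_sub_right w x, h1, h2, h3, h4,
    real_inner_comm x (f - f₀), real_inner_comm x w]
  ring

/-- A direction orthogonal to `S` in a larger space `S₀` adds to the length of projections. -/
theorem sq_inner_le_of_orthogonal (hS : S ≤ S₀) {w : EuclideanSpace ℝ (Fin n)} (hw : w ∈ S₀)
    (hwS : ∀ v ∈ S, inner ℝ w v = 0) (x : EuclideanSpace ℝ (Fin n)) :
    inner ℝ x w ^ 2 ≤ ‖w‖ ^ 2 * (‖S₀.starProjection x‖ ^ 2 - ‖S.starProjection x‖ ^ 2) := by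
  set y := S₀.starProjection x with hy
  have hz : S.starProjection y = S.starProjection x := starProjection_eq_of_le hS x
  have h1 : inner ℝ x w = inner ℝ (y - S.starProjection x) w := by
    have h2 := inner_sub_starProjection x hw
    have h3 := hwS _ (S.starProjection_apply_mem x)
    rw [real_inner_comm] at h3
    rw [inner_sub_left] at h2 ⊢
    linarith
  have h2 : ‖y - S.starProjection x‖ ^ 2 = ‖y‖ ^ 2 - ‖S.starProjection x‖ ^ 2 := by
    have := inner_starProjection_self (S := S) y
    rw [hz] at this
    rw [norm_sub_sq_real, this]; ring
  rw [h1, ← h2, ← mul_pow, mul_comm ‖w‖]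
  exact sq_le_sq.2 ((abs_real_inner_le_norm _ _).trans (le_abs_self _))

end Projections

theorem one_le_riskConst {K : ℝ} (hK : 1 < K) : 1 ≤ riskConst K := by
  rw [riskConst, le_div_iff₀ (pow_pos (by linarith) 3)]
  nlinarith [mul_pos (sub_pos.2 hK) (sub_pos.2 hK)]

theorem inv_le_riskConst_small {K : ℝ} (hK : 1 < K) : 1 ≤ (1 - 1 / K) * riskConst K := by
  have h : (1 - 1 / K) * riskConst K = (K ^ 2 + K - 1) / (K - 1) ^ 2 := by
    rw [riskConst]
    have : K - 1 ≠ 0 := by linarith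
    field_simp
  rw [h, le_div_iff₀ (pow_pos (by linarith) 2)]
  nlinarith

theorem inv_le_riskConst_large {K : ℝ} (hK : 20 < K) : 1 ≤ (1 - 7 / (2 * K)) * riskConst K := by
  have h : (1 - 7 / (2 * K)) * riskConst K =
      (K - 3.5) * (K ^ 2 + K - 1) / (K - 1) ^ 3 := by
    rw [riskConst]
    have : K - 1 ≠ 0 := by linarith
    field_simp
    ring
  rw [h, le_div_iff₀ (pow_pos (by linarith) 3)]
  nlinarith

theorem varFactor_eq (σ c a b : ℝ) (d : ℕ) : varFactor σ c a b d =
    σ ^ 2 + 2 * √2 / 9 * (c * ((σ + c) * ((d : ℝ) + 1) * (b + 2) / a)) := by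
  rw [varFactor, kappa]; ring

/-- Since exp(-4(b + 2)L) ≤ n⁻⁸, both contributions are of order (σ + c)²/n. They fit in the
variance factor because Z ≥ (σ + c)/n. -/
theorem bad_event_le {n : ℕ} {σ c a b L D Z : ℝ} (hσ : 0 < σ) (hc : 0 < c) (ha : 0 < a)
    (hb : 0 < b) (hn2 : (2 : ℝ) ≤ n) (hL : 1 / 2 ≤ L) (hnL : Real.exp L = n)
    (han : a ^ 2 * L ^ 2 ≤ n) (hDb : 2 ≤ D * (b + 2)) (hZ : Z = (σ + c) * D * (b + 2) / a) :
    (1 / (4 * (n : ℝ) ^ 3 * (σ + c) ^ 2) * (40 * (n : ℝ) ^ 2 * (σ + c) ^ 4) +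
      2 * (n : ℝ) ^ 3 * Real.exp (-(4 * (b + 2) * L)) / (1 / (4 * (n : ℝ) ^ 3 * (σ + c) ^ 2))) / 2 ≤
        32.4 * (σ ^ 2 + 2 * √2 / 9 * (c * Z)) := by
  have hs2 : (1.4142 : ℝ) ≤ √2 := Real.le_sqrt_of_sq_le (by norm_num)
  have hL0 : 0 < L := by linarith
  have hn0 : (0 : ℝ) < n := by linarith
  have hexp : Real.exp (-(4 * (b + 2) * L)) ≤ 1 / (n : ℝ) ^ 8 := by
    rw [← hnL, ← Real.exp_nat_mul, one_div, ← Real.exp_neg, Real.exp_le_exp]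
    push_cast
    nlinarith [mul_pos hb hL0]
  have h1 : 1 / (4 * (n : ℝ) ^ 3 * (σ + c) ^ 2) * (40 * (n : ℝ) ^ 2 * (σ + c) ^ 4) =
      10 / n * (σ + c) ^ 2 := by
    have : σ + c ≠ 0 := by positivity
    field_simp; ring
  have h2 : 2 * (n : ℝ) ^ 3 * Real.exp (-(4 * (b + 2) * L)) /
      (1 / (4 * (n : ℝ) ^ 3 * (σ + c) ^ 2)) ≤ 4 / n * (σ + c) ^ 2 := by
    calc 2 * (n : ℝ) ^ 3 * Real.exp (-(4 * (b + 2) * L)) / (1 / (4 * (n : ℝ) ^ 3 * (σ + c) ^ 2))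
        ≤ 2 * (n : ℝ) ^ 3 * (1 / (n : ℝ) ^ 8) / (1 / (4 * (n : ℝ) ^ 3 * (σ + c) ^ 2)) := by gcongr
      _ = 8 / ((n : ℝ) * n) * (σ + c) ^ 2 := by field_simp; ring
      _ ≤ 8 / ((n : ℝ) * 2) * (σ + c) ^ 2 := by gcongr
      _ = _ := by field_simp; ring
  have ha2 : a ≤ 2 * n := by
    refine (le_abs_self _).trans (abs_le_of_sq_le_sq ?_ (by positivity))
    have : a ^ 2 * (1 / 2) ^ 2 ≤ a ^ 2 * L ^ 2 := by gcongr
    nlinarith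
  have hZn : (σ + c) / n ≤ Z := by
    rw [hZ, div_le_div_iff₀ hn0 ha]
    have h3 : (σ + c) * a ≤ (σ + c) * (2 * n) := by gcongr
    have h4 : (σ + c) * n * 2 ≤ (σ + c) * n * (D * (b + 2)) := by gcongr
    nlinarith
  have hmain : 7 / n * (σ + c) ^ 2 ≤ 32.4 * (σ ^ 2 + 2 * √2 / 9 * (c * ((σ + c) / n))) := by
    have h3 : 7 * (σ + c) ^ 2 ≤ 32.4 * (σ ^ 2 + 2 * 1.4142 / 9 * (c * (σ + c))) := by
      nlinarith [sq_nonneg (σ - c / 10)]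
    calc 7 / (n : ℝ) * (σ + c) ^ 2 = 7 * (σ + c) ^ 2 / n := by ring
      _ ≤ 32.4 * (σ ^ 2 + 2 * 1.4142 / 9 * (c * (σ + c))) / n := by gcongr
      _ = 32.4 * (σ ^ 2 / n + 2 * 1.4142 / 9 * (c * ((σ + c) / n))) := by ring
      _ ≤ _ := by
        gcongr
        exact div_le_self (sq_nonneg _) (by linarith)
  have h3 : 2 * √2 / 9 * (c * ((σ + c) / n)) ≤ 2 * √2 / 9 * (c * Z) := by gcongr
  have h4 : (10 / n * (σ + c) ^ 2 + 4 / n * (σ + c) ^ 2) / 2 = 7 / n * (σ + c) ^ 2 := by ring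
  rw [h1]
  linarith

/-- The constants of the deviation bounds. -/
theorem exists_deviation_constants {n d : ℕ} {σ c a b L : ℝ} (hσ : 0 < σ) (hc : 0 < c)
    (ha : 0 < a) (hb : 0 < b) (hn : 2 ≤ n) (hL : 1 / 2 ≤ L) (hnL : Real.exp L = n)
    (haL : 1 ≤ a * L) (han : a ^ 2 * L ^ 2 ≤ n) :
    ∃ Λ U y t : ℝ, 0 < Λ ∧ 0 < U ∧ 0 < y ∧ 0 < t ∧
      Λ ^ 2 = 2 * ((d : ℝ) + 1) / (a ^ 2 * L ^ 2) ∧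
      Λ * σ * √(2 * y) + c * Λ ^ 2 * y ≤ U ∧
      5.15 * ((c * U + 10.1 * σ ^ 2) * (20 / 9)) ≤ 291.6 * varFactor σ c a b d ∧
      (t * (40 * (n : ℝ) ^ 2 * (σ + c) ^ 4) + 2 * (n : ℝ) ^ 3 * Real.exp (-y) / t) / 2 ≤
        32.4 * varFactor σ c a b d ∧
      (c * Λ) ^ 2 ≤ 3.19 / L * (varFactor σ c a b d - σ ^ 2) := by
  set D : ℝ := (d : ℝ) + 1 with hD
  have hD1 : 1 ≤ D := by rw [hD]; linarith [(Nat.cast_nonneg d : (0 : ℝ) ≤ d)]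
  have hL0 : 0 < L := by linarith
  have hn2 : (2 : ℝ) ≤ n := by exact_mod_cast hn
  have hs2 : (1.4142 : ℝ) ≤ √2 := Real.le_sqrt_of_sq_le (by norm_num)
  set Z : ℝ := (σ + c) * D * (b + 2) / a with hZ
  have hZ0 : 0 < Z := by positivity
  have hcZ : 0 < c * Z := by positivity
  set Λ : ℝ := √(2 * D) / (a * L) with hΛ
  have hΛ2 : Λ ^ 2 = 2 * D / (a ^ 2 * L ^ 2) := by
    rw [hΛ, div_pow, Real.sq_sqrt (by positivity), mul_pow]
  have hΛ0 : 0 < Λ := by positivity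
  have hV : varFactor σ c a b d = σ ^ 2 + 2 * √2 / 9 * (c * Z) := varFactor_eq σ c a b d
  have hDb : 2 ≤ D * (b + 2) := by nlinarith
  -- Λ² is 2(d + 1)²/ν for cells with at least ν = (d + 1)a²L² points. U = 8Z bounds the deviation
  -- of a coordinate at exponent y, and fits because 5.15 · (20/9) · 8 is just below 291.6 · 2√2/9,
  -- the coefficient of cZ.
  refine ⟨Λ, 8 * Z, 4 * (b + 2) * L, 1 / (4 * (n : ℝ) ^ 3 * (σ + c) ^ 2), hΛ0, by positivity,
    by positivity, by positivity, hΛ2, ?_, ?_, ?_, ?_⟩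
  · have h1 : Λ * √(2 * (4 * (b + 2) * L)) ≤ 8 * (D * (b + 2) / a) := by
      refine (le_abs_self _).trans (abs_le_of_sq_le_sq ?_ (by positivity))
      rw [mul_pow, hΛ2, Real.sq_sqrt (by positivity)]
      rw [mul_pow, div_pow, div_mul_eq_mul_div, mul_div_assoc', div_le_div_iff₀ (by positivity)
        (by positivity)]
      have : 1 ≤ 4 * L * (D * (b + 2)) := by nlinarith
      have h0 : 0 ≤ D * (b + 2) * L * a ^ 2 := by positivity
      nlinarith [mul_le_mul_of_nonneg_left this h0]
    have h2 : Λ ^ 2 * (4 * (b + 2) * L) ≤ 8 * (D * (b + 2) / a) := by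
      have : Λ ^ 2 * (4 * (b + 2) * L) = 8 * (D * (b + 2) / a) / (a * L) := by
        rw [hΛ2]; field_simp; ring
      rw [this]
      exact div_le_self (by positivity) haL
    have h3 : 8 * Z = σ * (8 * (D * (b + 2) / a)) + c * (8 * (D * (b + 2) / a)) := by
      rw [hZ]; ring
    rw [h3]
    have h4 := mul_le_mul_of_nonneg_left h1 hσ.le
    have h5 := mul_le_mul_of_nonneg_left h2 hc.le
    linarith
  · rw [hV]
    have h1 : c * Z * 1.4142 ≤ c * Z * √2 := by gcongr
    have h2 := sq_nonneg σ
    linarith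
  · rw [hV]
    exact bad_event_le hσ hc ha hb hn2 hL hnL han hDb hZ
  · rw [hV, mul_pow, hΛ2]
    -- 3.19 slightly exceeds 9/(2√2); the factor 2 in Λ² is absorbed by b + 2 > 2.
    have h1 : 3.19 / L * (σ ^ 2 + 2 * √2 / 9 * (c * Z) - σ ^ 2) =
        (3.19 * 2 * √2 / 9 * ((σ + c) * (b + 2))) * (c * D) / (a * L) := by
      rw [hZ]; field_simp; ring
    have h2 : c ^ 2 * (2 * D / (a ^ 2 * L ^ 2)) = 2 * c * (c * D) / (a * L) / (a * L) := by
      field_simp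
    rw [h1, h2]
    refine (div_le_self (by positivity) haL).trans
      (div_le_div_of_nonneg_right (mul_le_mul_of_nonneg_right ?_ (by positivity)) (by positivity))
    have h3 : c * 2 ≤ (σ + c) * (b + 2) := by gcongr <;> linarith
    have h4 : c * 2 * 1.4142 ≤ (σ + c) * (b + 2) * √2 := by gcongr
    linarith

end

/-! ### The excess risk, uniformly over the collection. -/

section

variable {n : ℕ} {Ω : Type*} [MeasurableSpace Ω] {μ : Measure Ω} [IsProbabilityMeasure μ]
  {σ c : ℝ} {ξ : Ω → EuclideanSpace ℝ (Fin n)}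

theorem neg_two_mul_le_of_sq_le {p u v K : ℝ} (hK : 0 < K) (hu : 0 ≤ u) (hv : 0 ≤ v)
    (h : p ^ 2 ≤ u * v) : -(2 * p) ≤ 1 / K * u + K * v := by
  refine (neg_le_abs _).trans (abs_le_of_sq_le_sq ?_ (by positivity))
  have h5 : 1 / K * u * (K * v) = u * v := by field_simp
  nlinarith [sq_nonneg (1 / K * u - K * v)]

theorem two_sub_inv_le {K : ℝ} (hK : 0 < K) : 2 - 1 / K ≤ K := by
  have : 1 / K * K = 1 := by field_simp
  nlinarith [sq_nonneg (K - 1)]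

set_option maxHeartbeats 1000000 in
/-- Uniform control of the excess risk over a collection of cell families refined by `C₀`. -/
theorem IsNoise.exists_excess_bound {ι : Type*} (h : IsNoise μ σ c ξ) (hσ : 0 < σ) (hc : 0 < c)
    (hn : 0 < n) {d : ℕ} {a b K : ℝ} (ha : 0 < a) (hb : 0 < b) (hK : 1 < K)
    {C₀ : Finset (Finset (Fin n))} (hC₀ : IsCellFamily d C₀)
    (hsize : ∀ A ∈ C₀, ((d : ℝ) + 1) * a ^ 2 * Real.log n ^ 2 ≤ (A.card : ℝ) ∧
      (d : ℝ) + 1 ≤ ((d : ℝ) + 1) * a ^ 2 * Real.log n ^ 2)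
    (M : Finset ι) (C : ι → Finset (Finset (Fin n)))
    (hC : ∀ m ∈ M, IsCellFamily d (C m)) (hle : ∀ m ∈ M, pw d (C m) ≤ pw d C₀)
    {Δ pen : ι → ℝ} (hΔ : ∀ m ∈ M, 0 ≤ Δ m)
    (hpen : ∀ m ∈ M, K * (324 * varFactor σ c a b d) *
      ((Module.finrank ℝ (pw d (C m)) : ℝ) + Δ m) ≤ pen m)
    {f : EuclideanSpace ℝ (Fin n)} (hf : f ∈ pw d C₀) :
    ∃ W : Ω → ℝ, ∃ ρ : ℝ, Integrable W μ ∧ 0 < ρ ∧ 1 ≤ ρ * riskConst K ∧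
      ∫ ω, W ω ∂μ ≤ 324 * varFactor σ c a b d * ∑ m ∈ M, Real.exp (-Δ m) ∧
      ∀ ω, ∀ m ∈ M, ρ * (‖f - (pw d (C m)).starProjection f‖ ^ 2 +
          ‖(pw d (C m)).starProjection (ξ ω)‖ ^ 2) ≤
        ‖f - (pw d (C m)).starProjection f‖ ^ 2 +
          2 * inner ℝ (ξ ω) (f - (pw d (C m)).starProjection f) -
          ‖(pw d (C m)).starProjection (ξ ω)‖ ^ 2 + pen m + W ω := by
  classical
  set D : ℝ := (d : ℝ) + 1 with hD
  have hD1 : 1 ≤ D := by rw [hD]; linarith [(Nat.cast_nonneg d : (0 : ℝ) ≤ d)]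
  have hn0 : (0 : ℝ) < n := by exact_mod_cast hn
  set L := Real.log n with hLdef
  have hnL : Real.exp L = n := Real.exp_log hn0
  obtain ⟨A₀, hA₀⟩ := hC₀.nonempty hn
  have haL2 : 1 ≤ a ^ 2 * L ^ 2 := by
    have := (hsize A₀ hA₀).2
    rw [mul_assoc] at this
    exact le_of_mul_le_mul_left (by linarith) (by linarith : (0 : ℝ) < D)
  have han : a ^ 2 * L ^ 2 ≤ n := by
    have h1 := (hsize A₀ hA₀).1
    have h2 : (A₀.card : ℝ) ≤ n := by
      have := Finset.card_le_univ A₀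
      rw [Fintype.card_fin] at this
      exact_mod_cast this
    nlinarith
  have hn2 : 2 ≤ n := by
    by_contra hcon
    have : n = 1 := by omega
    rw [hLdef, this] at haL2
    norm_num at haL2
  have hL : 1 / 2 ≤ L := by
    have h1 : Real.log 2 ≤ L := Real.log_le_log (by norm_num) (by exact_mod_cast hn2)
    have := Real.log_two_gt_d9
    linarith
  have haL : 1 ≤ a * L := by
    rw [← mul_pow] at haL2
    nlinarith [mul_pos ha (by linarith : 0 < L)]
  obtain ⟨Λ, U, y, t, hΛ, hU0, hy, ht, hΛ2, hU, hq, hbad, hcΛ⟩ :=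
    exists_deviation_constants (d := d) hσ hc ha hb hn2 hL hnL haL han
  set V := varFactor σ c a b d with hV
  have hσV : σ ^ 2 ≤ V := by
    rw [hV, varFactor_eq]
    have : 0 ≤ 2 * √2 / 9 * (c * ((σ + c) * ((d : ℝ) + 1) * (b + 2) / a)) := by positivity
    linarith
  have hV0 : 0 < V := lt_of_lt_of_le (by positivity) hσV
  set S₀ := pw d C₀ with hS₀def
  have hS₀ : ∀ v ∈ S₀, ∀ i, |v i| ≤ Λ * ‖v‖ := by
    intro v hv i
    refine abs_le_of_sq_le_sq ?_ (by positivity)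
    refine (hC₀.sq_le_of_mem_pw (ν := D * a ^ 2 * L ^ 2) (by linarith [(hsize A₀ hA₀).2])
      (fun A hA => (hsize A hA).1) hv i).trans (le_of_eq ?_)
    rw [mul_pow, hΛ2, ← hD]
    have hL0 : L ≠ 0 := by linarith
    field_simp
  have hresS : ∀ m ∈ M, ∀ A ∈ C m, res d A f ∈ S₀ := fun m hm A hA =>
    (hC m hm).res_mem_pw (hle m hm) hA hf
  have haug : ∀ m ∈ M, augPw d f (C m) ≤ S₀ := fun m hm =>
    sup_le (hle m hm) (Submodule.span_le.2 (by
      rintro _ ⟨A, hA, rfl⟩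
      exact hresS m hm A hA))
  obtain ⟨W₁, hW₁, hEW₁, hW₁le⟩ := h.exists_dev_bound hσ hc hn hΛ hS₀ M C hC haug hΔ hV0 hU0 hy ht
    hU hq hbad
  set X : ι → Ω → ℝ := fun m ω => ‖(augPw d f (C m)).starProjection (ξ ω)‖ ^ 2 with hX
  set B : ι → Ω → ℝ := fun m ω => ‖(pw d (C m)).starProjection (ξ ω)‖ ^ 2 with hB
  set w : ι → EuclideanSpace ℝ (Fin n) := fun m => f - (pw d (C m)).starProjection f with hw
  have hwaug : ∀ m ∈ M, w m ∈ augPw d f (C m) := by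
    intro m hm
    simp only [hw]
    rw [(hC m hm).sub_starProjection_pw]
    exact Submodule.sum_mem _ fun A hA =>
      Submodule.mem_sup_right (Submodule.subset_span ⟨A, hA, rfl⟩)
  have hsq : ∀ ω, ∀ m ∈ M, inner ℝ (ξ ω) (w m) ^ 2 ≤ ‖w m‖ ^ 2 * (X m ω - B m ω) := fun ω m hm =>
    sq_inner_le_of_orthogonal le_sup_left (hwaug m hm)
      (fun v hv => inner_sub_starProjection f hv) (ξ ω)
  have hB0 : ∀ m ω, 0 ≤ B m ω := fun m ω => sq_nonneg _
  have hBX : ∀ m ω, B m ω ≤ X m ω := by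
    intro m ω
    have h1 : (pw d (C m)).starProjection (ξ ω) =
        (pw d (C m)).starProjection ((augPw d f (C m)).starProjection (ξ ω)) :=
      (starProjection_eq_of_le le_sup_left (ξ ω)).symm
    simp only [hB, hX]
    rw [h1]
    exact pow_le_pow_left₀ (norm_nonneg _) (Submodule.norm_starProjection_apply_le _ _) 2
  set Sg := ∑ m ∈ M, Real.exp (-Δ m) with hSg
  have hSg0 : 0 ≤ Sg := Finset.sum_nonneg fun _ _ => (Real.exp_pos _).le
  have hVSg : 0 ≤ 324 * V * Sg := by positivity
  have hdim : ∀ m, (0 : ℝ) ≤ (Module.finrank ℝ (pw d (C m)) : ℝ) := fun m => Nat.cast_nonneg _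
  -- Up to K = 20 the remainder K W₁ is affordable, since 20 · 0.03 < 1. Beyond that the linear term
  -- is handled cell by cell and W₁ is used only twice.
  rcases le_or_gt K 20 with hK20 | hK20
  · refine ⟨fun ω => K * W₁ ω, 1 - 1 / K, hW₁.const_mul K, ?_, inv_le_riskConst_small hK, ?_, ?_⟩
    · rw [sub_pos, div_lt_one (by linarith)]; exact hK
    · rw [integral_const_mul]
      have h1 : K * ∫ ω, W₁ ω ∂μ ≤ K * (0.03 * (324 * V) * Sg) := by gcongr
      have h2 : K * (324 * V * Sg) ≤ 20 * (324 * V * Sg) := by gcongr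
      linarith
    · intro ω m hm
      have h1 := hW₁le ω m hm
      have h2 := hpen m hm
      have h3 := hsq ω m hm
      change (1 - 1 / K) * (‖w m‖ ^ 2 + B m ω) ≤
        ‖w m‖ ^ 2 + 2 * inner ℝ (ξ ω) (w m) - B m ω + pen m + K * W₁ ω
      change X m ω - _ ≤ _ at h1
      have hBX' := hBX m ω
      have hB0' := hB0 m ω
      have hK0 : 0 < K := by linarith
      -- Using X - B rather than X leaves a term K B, which compensates -B because K ≥ 2 - 1/K.
      have h4 : -(2 * inner ℝ (ξ ω) (w m)) ≤ 1 / K * ‖w m‖ ^ 2 + K * (X m ω - B m ω) :=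
        neg_two_mul_le_of_sq_le hK0 (sq_nonneg _) (by linarith) h3
      have h5 : K * X m ω ≤ K * (W₁ ω + 324 * V * (Module.finrank ℝ (pw d (C m)) + Δ m)) := by
        gcongr; linarith
      have h6 : 2 - 1 / K ≤ K := two_sub_inv_le hK0
      have h7 : (2 - 1 / K) * B m ω ≤ K * B m ω := by gcongr
      linarith
  -- α is of order 1/K, as ρ C(K) ≥ 1 demands, while ατ = 1020.6 D V is free of K. As (d + 1) times
  -- the number of cells is at most the dimension, the τ use nine tenths of the penalty; the last
  -- tenth absorbs 2 · 324 V (D_m + Δ_m) because K > 20.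
  · set α : ℝ := 7 / (2 * K) with hα
    set τ : ℝ := 0.9 * 324 * K * V * D with hτ
    have hK0 : 0 < K := by linarith
    have hα0 : 0 < α := by positivity
    have hτ0 : 0 < τ := by positivity
    have hατ : 1020 * ((d : ℝ) + 1) * V ≤ α * τ := by
      have : α * τ = 1020.6 * D * V := by rw [hα, hτ]; field_simp; norm_num
      rw [this, ← hD]
      gcongr
      norm_num
    obtain ⟨W₂, hW₂, hEW₂, hW₂le⟩ := h.exists_cell_bound hσ hc hΛ hn hS₀ hα0 hτ0 hL hnL.ge hσV hcΛ
      hατ (M.image C) (fun C' hC' => by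
        obtain ⟨m, hm, rfl⟩ := Finset.mem_image.1 hC'
        exact hC m hm) (fun C' hC' => by
        obtain ⟨m, hm, rfl⟩ := Finset.mem_image.1 hC'
        exact hresS m hm)
    refine ⟨fun ω => 2 * W₁ ω + W₂ ω, 1 - 7 / (2 * K), (hW₁.const_mul 2).add hW₂, ?_,
      inv_le_riskConst_large hK20, ?_, ?_⟩
    · rw [sub_pos, div_lt_one (by linarith)]; linarith
    · rw [integral_add (hW₁.const_mul 2) hW₂, integral_const_mul]
      linarith
    · intro ω m hm
      have h1 := hW₁le ω m hm
      have h2 := hpen m hm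
      have h3 := hW₂le ω (C m) (Finset.mem_image_of_mem C hm)
      change (1 - α) * (‖w m‖ ^ 2 + B m ω) ≤
        ‖w m‖ ^ 2 + 2 * inner ℝ (ξ ω) (w m) - B m ω + pen m + (2 * W₁ ω + W₂ ω)
      change X m ω - _ ≤ _ at h1
      have hBX' := hBX m ω
      have hB0' := hB0 m ω
      have h4 : ∑ A ∈ C m, (-2 * inner ℝ (ξ ω) (res d A f) - α * rss d f A - τ) =
          -2 * inner ℝ (ξ ω) (w m) - α * ‖w m‖ ^ 2 - τ * (C m).card := by
        simp only [hw]
        rw [(hC m hm).norm_sq_sub_starProjection_pw, (hC m hm).sub_starProjection_pw, inner_sum,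
          Finset.sum_sub_distrib, Finset.sum_sub_distrib, Finset.mul_sum, Finset.mul_sum,
          Finset.sum_const, nsmul_eq_mul, mul_comm τ]
      have h5 : D * ((C m).card : ℝ) ≤ (Module.finrank ℝ (pw d (C m)) : ℝ) := by
        rw [hD]; exact_mod_cast (hC m hm).card_mul_le_finrank
      set δ : ℝ := (Module.finrank ℝ (pw d (C m)) : ℝ) with hδ
      have hδ0 : 0 ≤ δ := hdim m
      have hΔm := hΔ m hm
      have h6 : τ * (C m).card ≤ 0.9 * (K * (324 * V) * (δ + Δ m)) := by
        calc τ * (C m).card = 0.9 * (K * (324 * V)) * (D * (C m).card) := by rw [hτ]; ring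
          _ ≤ 0.9 * (K * (324 * V)) * (δ + Δ m) := by gcongr; linarith
          _ = _ := by ring
      have h7 : 2 * (324 * V * (δ + Δ m)) ≤ 0.1 * (K * (324 * V) * (δ + Δ m)) := by
        have : 20 * (324 * V * (δ + Δ m)) ≤ K * (324 * V * (δ + Δ m)) := by gcongr
        linarith
      have h8 : 0 ≤ α * B m ω := by positivity
      rw [h4] at h3
      linarith

end

end PiecewisePoly

end

/-! ### The oracle inequality. -/

theorem proposition3p2
    {Ω : Type*} [MeasurableSpace Ω] (μ : Measure Ω) [IsProbabilityMeasure μ]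
    (n d : ℕ) (hn : 0 < n) (σ c a b K : ℝ)
    (hσ : 0 < σ) (hc : 0 < c) (ha : 0 < a) (hb : 0 < b) (hK : 1 < K)
    -- the data: independent components, mean `(F (1 / n), …, F (n / n))`, Bernstein-type noise
    (Y : Ω → EuclideanSpace ℝ (Fin n)) (hY : Measurable Y)
    (hindep : iIndepFun (fun (i : Fin n) (ω : Ω) => Y ω i) μ)
    (F : ℝ → ℝ)
    (hmean : ∀ i : Fin n,
      Integrable (fun ω => Y ω i) μ ∧ ∫ ω, Y ω i ∂μ = PiecewisePoly.sample n F i)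
    (hnoise : ∀ i : Fin n, PiecewisePoly.BernsteinCondition μ σ c
      (fun ω => Y ω i - PiecewisePoly.sample n F i))
    -- the reference partition and the collection of partitions
    (m₀ : Finpartition (Finset.Icc 1 n)) (hm₀ : PiecewisePoly.IsAdmissible d m₀)
    (hsize : ∀ I ∈ m₀.parts,
      ((d : ℝ) + 1) * a ^ 2 * Real.log n ^ 2 ≤ (I.card : ℝ) ∧
        (d : ℝ) + 1 ≤ ((d : ℝ) + 1) * a ^ 2 * Real.log n ^ 2)
    (M : Finset (Finpartition (Finset.Icc 1 n)))
    (hM : ∀ m ∈ M, PiecewisePoly.IsAdmissible d m ∧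
      PiecewisePoly.model d m ≤ PiecewisePoly.model d m₀)
    -- the weights and the penalty
    (Δ pen : Finpartition (Finset.Icc 1 n) → ℝ) (hΔ : ∀ m ∈ M, 0 ≤ Δ m)
    (hpen : ∀ m ∈ M,
      K * PiecewisePoly.kappa ^ 2 * PiecewisePoly.varFactor σ c a b d *
        ((PiecewisePoly.dim d m : ℝ) + Δ m) ≤ pen m)
    -- the selected partition: any (measurable) minimizer of the criterion over the collection
    (mhat : Ω → Finpartition (Finset.Icc 1 n))
    (hmeas : ∀ m, MeasurableSet {ω | mhat ω = m})
    (hmin : ∀ ω, mhat ω ∈ M ∧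
      ∀ m ∈ M, PiecewisePoly.crit d pen (Y ω) (mhat ω) ≤ PiecewisePoly.crit d pen (Y ω) m) :
    Integrable
        (fun ω => ‖PiecewisePoly.sample n F - PiecewisePoly.lse d (mhat ω) (Y ω)‖ ^ 2) μ ∧
      ∫ ω, ‖PiecewisePoly.sample n F - PiecewisePoly.lse d (mhat ω) (Y ω)‖ ^ 2 ∂μ ≤
        PiecewisePoly.riskConst K *
          ((⨅ m : M,
              ((∫ ω, ‖PiecewisePoly.sample n F -
                  PiecewisePoly.lse d (m : Finpartition (Finset.Icc 1 n)) (Y ω)‖ ^ 2 ∂μ) +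
                pen m)) +
            (PiecewisePoly.kappa ^ 2 * PiecewisePoly.varFactor σ c a b d *
                ∑ m ∈ M, Real.exp (-Δ m) +
              4 * ((c + σ) ^ 2 * (b + 2) ^ 2) / (a ^ 2 * (n : ℝ) ^ b))) := by
  classical
  set f := PiecewisePoly.sample n F with hf
  set ξ : Ω → EuclideanSpace ℝ (Fin n) := fun ω => Y ω - f with hξ
  have hYξ : ∀ ω, Y ω = f + ξ ω := fun ω => by simp only [hξ]; abel
  have hnoise' : PiecewisePoly.IsNoise μ σ c ξ := by
    refine PiecewisePoly.isNoise_of_bernstein hσ hc (hY.sub_const f) ?_ (fun i => ?_) hnoise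
    · exact hindep.comp (fun i x => x - f i) fun i => measurable_id.sub_const _
    · refine ⟨(hmean i).1.sub (integrable_const _), ?_⟩
      have : ∫ ω, ξ ω i ∂μ = ∫ ω, (Y ω i - f i) ∂μ := rfl
      rw [this, integral_sub (hmean i).1 (integrable_const _), (hmean i).2]
      simp
  set S₀ := PiecewisePoly.model d m₀ with hS₀
  set f₀ := S₀.starProjection f with hf₀
  have hS₀pw : S₀ = PiecewisePoly.pw d (PiecewisePoly.cells m₀) := PiecewisePoly.model_eq_pw hn hm₀
  have hpw : ∀ m ∈ M, PiecewisePoly.model d m = PiecewisePoly.pw d (PiecewisePoly.cells m) :=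
    fun m hm => PiecewisePoly.model_eq_pw hn (hM m hm).1
  set V := PiecewisePoly.varFactor σ c a b d with hV
  -- Applied to f₀ instead of f: f - f₀ is orthogonal to every model, so it contributes the same
  -- terms to all losses and criteria.
  obtain ⟨W, ρ, hW, hρ, hρC, hEW, hexc⟩ := hnoise'.exists_excess_bound hσ hc hn ha hb hK
    (PiecewisePoly.isCellFamily_cells hm₀) (fun A hA => by
      obtain ⟨I, hI, rfl⟩ := Finset.mem_image.1 hA
      rw [PiecewisePoly.card_positions (m₀.le hI)]
      exact hsize I hI) M PiecewisePoly.cells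
    (fun m hm => PiecewisePoly.isCellFamily_cells (hM m hm).1)
    (fun m hm => by rw [← hpw m hm, ← hS₀pw]; exact (hM m hm).2) hΔ (pen := pen)
    (fun m hm => by
      have := hpen m hm
      rw [PiecewisePoly.dim, hpw m hm, PiecewisePoly.kappa] at this
      refine le_trans (le_of_eq ?_) this
      ring) (f := f₀) (by rw [← hS₀pw]; exact S₀.starProjection_apply_mem f)
  set C := PiecewisePoly.riskConst K with hC
  have hC1 : 1 ≤ C := PiecewisePoly.one_le_riskConst hK
  have hC0 : 0 < C := by linarith
  set e : ℝ := ‖f - f₀‖ ^ 2 with he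
  have he0 : 0 ≤ e := sq_nonneg _
  set w : Finpartition (Finset.Icc 1 n) → EuclideanSpace ℝ (Fin n) := fun m =>
    f₀ - (PiecewisePoly.model d m).starProjection f₀ with hw
  set B : Finpartition (Finset.Icc 1 n) → Ω → ℝ := fun m ω =>
    ‖(PiecewisePoly.model d m).starProjection (ξ ω)‖ ^ 2 with hB
  set Q : Finpartition (Finset.Icc 1 n) → Ω → ℝ := fun m ω =>
    ‖w m‖ ^ 2 + 2 * inner ℝ (ξ ω) (w m) - B m ω + pen m with hQ
  have hloss : ∀ m ∈ M, ∀ ω, ‖f - PiecewisePoly.lse d m (Y ω)‖ ^ 2 = e + (‖w m‖ ^ 2 + B m ω) := by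
    intro m hm ω
    rw [PiecewisePoly.lse, hYξ]
    exact PiecewisePoly.norm_sq_sub_starProjection_add (hM m hm).2 f (ξ ω)
  have hcrit : ∀ m ∈ M, ∀ ω, PiecewisePoly.crit d pen (Y ω) m =
      (e + 2 * inner ℝ (ξ ω) (f - f₀) + ‖ξ ω‖ ^ 2) + Q m ω := by
    intro m hm ω
    rw [PiecewisePoly.crit, PiecewisePoly.lse, hYξ,
      PiecewisePoly.norm_sq_add_sub_starProjection (hM m hm).2 f (ξ ω)]
    simp only [hQ, hB, hw, he, hf₀]
    ring
  have hexc' : ∀ ω, ∀ m ∈ M, ρ * (‖w m‖ ^ 2 + B m ω) ≤ Q m ω + W ω := by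
    intro ω m hm
    have := hexc ω m hm
    rw [← hpw m hm] at this
    exact this
  have hQle : ∀ ω, ∀ m ∈ M, Q (mhat ω) ω ≤ Q m ω := by
    intro ω m hm
    have h1 := (hmin ω).2 m hm
    rw [hcrit _ (hmin ω).1, hcrit m hm] at h1
    linarith
  have hB0 : ∀ m ω, 0 ≤ B m ω := fun m ω => sq_nonneg _
  have hBint : ∀ m, Integrable (B m) μ := fun m => hnoise'.integrable_norm_sq_clm _
  have hlossint : ∀ m ∈ M, Integrable (fun ω => ‖f - PiecewisePoly.lse d m (Y ω)‖ ^ 2) μ := by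
    intro m hm
    simp_rw [hloss m hm]
    exact (integrable_const _).add ((integrable_const _).add (hBint m))
  -- The selected partition takes finitely many values on measurable events, so its loss is a finite
  -- sum of integrable pieces.
  have hint : Integrable (fun ω => ‖f - PiecewisePoly.lse d (mhat ω) (Y ω)‖ ^ 2) μ := by
    have h1 : (fun ω => ‖f - PiecewisePoly.lse d (mhat ω) (Y ω)‖ ^ 2) = fun ω =>
        ∑ m ∈ M, {ω | mhat ω = m}.indicator
          (fun ω => ‖f - PiecewisePoly.lse d m (Y ω)‖ ^ 2) ω := by
      funext ω
      rw [Finset.sum_eq_single_of_mem (mhat ω) (hmin ω).1]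
      · rw [Set.indicator_of_mem]; rfl
      · intro m _ hne
        rw [Set.indicator_of_notMem]
        exact fun h => hne h.symm
    rw [h1]
    exact integrable_finsetSum _ fun m hm => (hlossint m hm).indicator (hmeas m)
  refine ⟨hint, ?_⟩
  have hbound : ∀ m ∈ M, ∫ ω, ‖f - PiecewisePoly.lse d (mhat ω) (Y ω)‖ ^ 2 ∂μ ≤
      C * ((∫ ω, ‖f - PiecewisePoly.lse d m (Y ω)‖ ^ 2 ∂μ) + pen m +
        324 * V * ∑ m ∈ M, Real.exp (-Δ m)) := by
    intro m hm
    have hinner := hnoise'.integrable_inner (w m)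
    have hi₁ : Integrable (fun ω => ‖w m‖ ^ 2 + 2 * inner ℝ (ξ ω) (w m)) μ :=
      (integrable_const _).add (hinner.const_mul 2)
    have hi₂ : Integrable (fun ω => ‖w m‖ ^ 2 + 2 * inner ℝ (ξ ω) (w m) - B m ω) μ :=
      hi₁.sub (hBint m)
    have hQint : Integrable (Q m) μ := hi₂.add (integrable_const _)
    have hi₃ : Integrable (fun ω => ‖w m‖ ^ 2 + B m ω) μ := (integrable_const _).add (hBint m)
    have hi₄ : Integrable (fun ω => C * (Q m ω + W ω)) μ := (hQint.add hW).const_mul C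
    have hEQ : ∫ ω, Q m ω ∂μ = ‖w m‖ ^ 2 - ∫ ω, B m ω ∂μ + pen m := by
      simp only [hQ]
      rw [integral_add hi₂ (integrable_const _), integral_sub hi₁ (hBint m),
        integral_add (integrable_const _) (hinner.const_mul 2), integral_const_mul,
        hnoise'.integral_inner]
      simp
    have hEloss : ∫ ω, ‖f - PiecewisePoly.lse d m (Y ω)‖ ^ 2 ∂μ =
        e + (‖w m‖ ^ 2 + ∫ ω, B m ω ∂μ) := by
      simp_rw [hloss m hm]
      rw [integral_add (integrable_const _) hi₃,
        integral_add (integrable_const _) (hBint m)]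
      simp
    have hEB : 0 ≤ ∫ ω, B m ω ∂μ := integral_nonneg (hB0 m)
    -- The uniform inequality is used at the random partition, where C ρ ≥ 1 recovers the loss;
    -- minimality then replaces its Q by that of the fixed m, whose linear term has mean zero.
    have hpt : ∀ ω, ‖f - PiecewisePoly.lse d (mhat ω) (Y ω)‖ ^ 2 ≤ e + C * (Q m ω + W ω) := by
      intro ω
      have hmem := (hmin ω).1
      rw [hloss _ hmem]
      have h1 := hexc' ω _ hmem
      have h2 := hQle ω m hm
      have h3 : 0 ≤ ‖w (mhat ω)‖ ^ 2 + B (mhat ω) ω := add_nonneg (sq_nonneg _) (hB0 _ _)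
      have h4 : ‖w (mhat ω)‖ ^ 2 + B (mhat ω) ω ≤
          C * (ρ * (‖w (mhat ω)‖ ^ 2 + B (mhat ω) ω)) := by nlinarith
      have h5 : C * (ρ * (‖w (mhat ω)‖ ^ 2 + B (mhat ω) ω)) ≤ C * (Q m ω + W ω) := by
        gcongr; linarith
      linarith
    calc ∫ ω, ‖f - PiecewisePoly.lse d (mhat ω) (Y ω)‖ ^ 2 ∂μ
        ≤ ∫ ω, (e + C * (Q m ω + W ω)) ∂μ :=
          integral_mono hint ((integrable_const _).add hi₄) hpt
      _ = e + C * (‖w m‖ ^ 2 - ∫ ω, B m ω ∂μ + pen m + ∫ ω, W ω ∂μ) := by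
          rw [integral_add (integrable_const _) hi₄, integral_const_mul,
            integral_add hQint hW, hEQ]
          simp
      _ ≤ C * e + C * (‖w m‖ ^ 2 + ∫ ω, B m ω ∂μ + pen m +
          324 * V * ∑ m ∈ M, Real.exp (-Δ m)) := by
          gcongr
          · nlinarith
          · linarith
      _ = _ := by rw [hEloss]; ring
  obtain ⟨ω₀⟩ : Nonempty Ω := nonempty_of_isProbabilityMeasure μ
  have hne : Nonempty M := ⟨⟨mhat ω₀, (hmin ω₀).1⟩⟩
  rw [← div_le_iff₀' hC0, ← sub_le_iff_le_add]
  refine le_ciInf fun m => ?_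
  have h1 := hbound m.1 m.2
  rw [← div_le_iff₀' hC0] at h1
  -- Only the sign of the last remainder term matters: the rare event was already absorbed in the
  -- uniform bound.
  have h2 : 0 ≤ 4 * ((c + σ) ^ 2 * (b + 2) ^ 2) / (a ^ 2 * (n : ℝ) ^ b) := by positivity
  have h3 : PiecewisePoly.kappa ^ 2 = 324 := by rw [PiecewisePoly.kappa]; norm_num
  rw [h3]
  linarith
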